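/- Let $(M,\omega)$ be a smooth symplectic manifold of dimension $2n$ (Hausdorff, second countable) with a symplectic connection $\nabla$ (smooth, torsion free, $\nabla\omega=0$), and let $t>0$. Let $R_{u,v}=[\nabla_u,\nabla_v]-\nabla_{[u,v]}$ be the curvature of $\nabla$. Let $\pi:\mathcal Z^0\to M$ be the bundle whose fibre over $x$ consists of all $j\in\mathrm{End}(T_xM)$ with $j^2=-\mathrm{Id}$, $\omega(j\cdot,j\cdot)=\omega$ and $\omega(\cdot,j\cdot)$ positive definite. It is a submanifold of $\mathrm{End}(TM)$ of dimension $n(n+3)$. Put $E=\pi^*TM$, let $\Phi_j=j$ be the canonical section of $\mathrm{End}(E)$, $\mathcal V=\ker d\pi$ and $\mathcal H^\nabla=\{X\in T\mathcal Z^0:(\pi^*\nabla)_X\Phi=0\}$, so that $T\mathcal Z^0=\mathcal H^\nabla\oplus\mathcal V$ and $\pi_*:\mathcal H^\nabla\cong E$. Identify $\mathcal V_j$ with $\{A\in\mathfrak{sp}(T_xM,\omega):Aj=-jA\}$, where $A$ corresponds to the infinitesimal variation $[A,j]=2Aj$ of $j$. Let $P:T\mathcal Z^0\to\mathcal V\subset\mathrm{End}(E)$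 be the projection with kernel $\mathcal H^\nabla$, so $(\pi^*\nabla)\Phi=[P,\Phi]$. Superscripts $v$, $h$ denote vertical and horizontal parts; for the $\mathrm{End}(E)$-valued form $\pi^*R$, $\pi^*R^{\,v}_{X,Y}=\frac12(R_{\pi_*X,\pi_*Y}+jR_{\pi_*X,\pi_*Y}j)\in\mathcal V_j$. Let $\mathcal J^\nabla$ be the almost complex structure on $\mathcal Z^0$ which at $j$ is $j$ on $\mathcal H^\nabla_j\cong T_xM$ and $A\mapsto jA$ on $\mathcal V_j$. Let $D=\pi^*\nabla-P$ on $E$, with the induced connection $D_XA=(\pi^*\nabla)_XA-[PX,A]$ on $\mathrm{End}(E)$, which preserves $\mathcal V$; with $\mathcal H^\nabla\cong E$ this gives a connection $D$ on $T\mathcal Z^0=\mathcal H^\nabla\oplus\mathcal V$. Finally let $$\langle X,Y\rangle=t\,\omega(\pi_*X,\pi_*\mathcal J^\nabla Y)+\tfrac12\mathrm{Tr}(PX\,PY)$$ on $T\mathcal Z^0$, and $\langle u,w\rangle=t\,\omega(u,jw)$ on $E_j$. Then the metric $\langle\,,\rangle$ has a Levi-Civita connection $\widetilde\nabla$ (torsion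 free, metric), and the following hold. (i) For all vector fields $X,Y$ on $\mathcal Z^0$, $$\widetilde\nabla_XY=D_XY-PY(\pi_*X)-\tfrac12\,\pi^*R^{\,v}_{X,Y}+S(X,Y),$$ where $PY(\pi_*X)\in E$ is lifted to $\mathcal H^\nabla$ and $S$ is the unique symmetric $(2,1)$-tensor on $\mathcal Z^0$ such that $$\langle S^v(X,Y),A\rangle=\langle A\,\pi_*X,\pi_*Y\rangle\quad\text{for all } X,Y\in T\mathcal Z^0,\ A\in\mathcal V,$$ $$\langle S^h(X,B),Y\rangle=\tfrac12\langle\pi^*R^{\,v}_{X,Y},B\rangle\quad\text{for all } X\in T\mathcal Z^0,\ B\in\mathcal V,\ Y\in\mathcal H^\nabla,$$ and $S^h(X,Y)=0$ for $X,Y\in\mathcal H^\nabla$. Such a tensor $S$ exists, and for $X,Y\in\mathcal H^\nabla$ and $A,B\in\mathcal V$ $$S^v(X,A)=S^v(A,B)=0,\qquad S^h(X,Y)=S^h(A,B)=0 .$$ (ii) The fibres $\pi^{-1}(x)$, $x\in M$, are totally geodesic in $\mathcal Z^0$. (iii) If $\nabla$ is flat, then $\widetilde\nabla\mathcal J^\nabla=0$.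 -/

import Mathlib

open Bundle Manifold Module VectorField
open scoped ContDiff Topology

noncomputable section TwistorGeometry

/-! ## Symplectic manifolds and symplectic connections

`M` is a manifold of dimension `2n`, modelled on `ℝ²ⁿ` (without boundary). -/

section Base

variable {n : ℕ} {M : Type*} [TopologicalSpace M]
  [ChartedSpace (EuclideanSpace ℝ (Fin (2 * n))) M] [IsManifold (𝓡 (2 * n)) ∞ M]

/-- The tangent space `T_x M`. -/
abbrev TM (n : ℕ) {M : Type*} [TopologicalSpace M]
    [ChartedSpace (EuclideanSpace ℝ (Fin (2 * n))) M] (x : M) : Type :=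
  TangentSpace (𝓡 (2 * n)) x

/-- The model vector space `ℝ²ⁿ`. -/
abbrev ModelR (n : ℕ) : Type := EuclideanSpace ℝ (Fin (2 * n))

/-- A section of the tangent bundle, seen as a map into the total space. -/
abbrev TM.sec (X : Π x : M, TM n x) (x : M) : TangentBundle (𝓡 (2 * n)) M := ⟨x, X x⟩

variable (n M) in
/-- A symplectic form: a smooth, closed, non-degenerate 2-form. -/
structure SymplecticForm where
  /-- the bilinear form on each tangent space -/
  form : Π x : M, TM n x →L[ℝ] TM n x →L[ℝ] ℝ
  alt : ∀ x (u : TM n x), form x u u = 0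
  nondegenerate : ∀ x (u : TM n x), (∀ v, form x u v = 0) → u = 0
  smooth : ContMDiff (𝓡 (2 * n)) ((𝓡 (2 * n)).prod 𝓘(ℝ, ModelR n →L[ℝ] ModelR n →L[ℝ] ℝ)) ∞
    (fun x ↦ TotalSpace.mk' (ModelR n →L[ℝ] ModelR n →L[ℝ] ℝ)
      (E := fun x : M ↦ TM n x →L[ℝ] TM n x →L[ℝ] ℝ) x (form x))
  /-- `dω = 0`, by the invariant formula for the exterior derivative -/
  closed : ∀ (x : M) (X Y Z : Π x : M, TM n x),
    ContMDiffAt (𝓡 (2 * n)) (𝓡 (2 * n)).tangent ∞ (TM.sec X) x →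
    ContMDiffAt (𝓡 (2 * n)) (𝓡 (2 * n)).tangent ∞ (TM.sec Y) x →
    ContMDiffAt (𝓡 (2 * n)) (𝓡 (2 * n)).tangent ∞ (TM.sec Z) x →
    mvfderiv (𝓡 (2 * n)) (fun y ↦ form y (Y y) (Z y)) x (X x)
      - mvfderiv (𝓡 (2 * n)) (fun y ↦ form y (X y) (Z y)) x (Y x)
      + mvfderiv (𝓡 (2 * n)) (fun y ↦ form y (X y) (Y y)) x (Z x)
      - form x (mlieBracket (𝓡 (2 * n)) X Y x) (Z x)
      + form x (mlieBracket (𝓡 (2 * n)) X Z x) (Y x)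
      - form x (mlieBracket (𝓡 (2 * n)) Y Z x) (X x) = 0

variable (n M) in
/-- Linear connections on `M`. For such `∇`, the vector `∇_u Y` is written `∇ Y x u` in Lean. -/
abbrev LinConnection := CovariantDerivative (𝓡 (2 * n)) (ModelR n) (fun x : M ↦ TM n x)

/-- A symplectic connection: smooth, torsion free, and `∇ω = 0`. -/
structure IsSymplecticConnection (om : SymplecticForm n M) (nab : LinConnection n M) : Prop where
  smooth : CovariantDerivative.ContMDiffCovariantDerivative nab ∞
  torsion_free : nab.torsion = 0
  parallel : ∀ (x : M) (Y Z : Π x : M, TM n x) (u : TM n x),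
    MDifferentiableAt (𝓡 (2 * n)) (𝓡 (2 * n)).tangent (TM.sec Y) x →
    MDifferentiableAt (𝓡 (2 * n)) (𝓡 (2 * n)).tangent (TM.sec Z) x →
    mvfderiv (𝓡 (2 * n)) (fun y ↦ om.form y (Y y) (Z y)) x u =
      om.form x (nab Y x u) (Z x) + om.form x (Y x) (nab Z x u)

/-- The vector field near `x` with value `v` at `x` which is constant in the preferred
trivialization of `TM` at `x` (and zero outside the domain of that trivialization). -/
def constField (x : M) (v : TM n x) (y : M) : TM n y :=
  (trivializationAt (ModelR n) (fun x : M ↦ TM n x) x).symmL ℝ y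
    ((trivializationAt (ModelR n) (fun x : M ↦ TM n x) x).continuousLinearMapAt ℝ x v)

theorem mdifferentiableAt_constField (x : M) (v : TM n x) :
    MDifferentiableAt (𝓡 (2 * n)) (𝓡 (2 * n)).tangent (TM.sec (constField x v)) x := by
  refine (FiberBundle.mdifferentiableAt_extend (𝓡 (2 * n)) (ModelR n)
    (V := fun x : M ↦ TM n x) v).congr_of_eventuallyEq ?_
  set t := trivializationAt (ModelR n) (fun x : M ↦ TM n x) x with ht
  have hx : x ∈ t.baseSet := FiberBundle.mem_baseSet_trivializationAt' x
  filter_upwards [t.open_baseSet.mem_nhds hx] with y hy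
  simp only [TM.sec, constField, FiberBundle.extend, ← ht]
  rw [t.symmL_apply hy, t.continuousLinearMapAt_apply ℝ, t.coe_linearMapAt_of_mem hx]

/-- The curvature `R(u,v)w = ∇_X ∇_Y W - ∇_Y ∇_X W - ∇_{[X,Y]} W` at `x`, where `X`, `Y`, `W` are
vector fields extending `u`, `v`, `w`, here those constant in the preferred trivialization of
`TM` at `x`; for a smooth connection the value does not depend on the extension. -/
def curvature (nab : LinConnection n M) (x : M) (u v w : TM n x) : TM n x :=
  let X := constField x u
  let Y := constField x v
  let W := constField x w
  nab (fun y ↦ nab W y (Y y)) x u - nab (fun y ↦ nab W y (X y)) x v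
    - nab W x (mlieBracket (𝓡 (2 * n)) X Y x)

/-- The connection is flat. -/
def IsFlat (nab : LinConnection n M) : Prop := ∀ (x : M) (u v w : TM n x), curvature nab x u v w = 0

/-- The operator `Γ(u) ∈ End(T_x M)` of the connection in the preferred trivialization of `TM` at
`x`: `Γ(u) v = ∇_u V`, where `V` extends `v` and is constant in that trivialization. So
`∇_u s = d_u s + Γ(u) s(x)` in that trivialization. -/
def connForm (nab : LinConnection n M) (x : M) (u : TM n x) : TM n x →L[ℝ] TM n x :=
  haveI : T2Space (TM n x) := inferInstanceAs (T2Space (ModelR n))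
  haveI : FiniteDimensional ℝ (TM n x) := inferInstanceAs (FiniteDimensional ℝ (ModelR n))
  LinearMap.toContinuousLinearMap
    { toFun := fun v ↦ nab (constField x v) x u
      map_add' := by
        intro v w
        have h : constField x (v + w) = constField x v + constField x w := by
          funext y
          simp only [constField, map_add, Pi.add_apply]
        rw [h, nab.isCovariantDerivativeOn.add (s := Set.univ)
          (mdifferentiableAt_constField x v) (mdifferentiableAt_constField x w)]
        rfl
      map_smul' := by
        intro c v
        have h : constField x (c • v) = c • constField x v := by
          funext y
          simp only [constField, map_smul, Pi.smul_apply]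
        rw [h, nab.isCovariantDerivativeOn.smul_const (s := Set.univ) c
          (mdifferentiableAt_constField x v)]
        rfl }

/-- `j` is an `ω`-compatible complex structure of `T_x M`: `j² = -1`, `ω` is of type `(1,1)` for
`j`, and `ω(·, j·)` is positive definite. -/
structure IsCompatible (om : SymplecticForm n M) (x : M) (j : TM n x →L[ℝ] TM n x) : Prop where
  sq : ∀ v, j (j v) = -v
  inv : ∀ u v, om.form x (j u) (j v) = om.form x u v
  pos : ∀ v, v ≠ 0 → 0 < om.form x v (j v)

variable (n M) in
/-- The total space of the bundle `End(TM)`, a smooth manifold. -/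
abbrev EndTM := TotalSpace (ModelR n →L[ℝ] ModelR n) (fun x : M ↦ TM n x →L[ℝ] TM n x)

/-- The twistor space `𝒵⁰`: pairs `(x, j)` with `j` a compatible complex structure of `T_x M`,
with the subspace topology of `End(TM)`. -/
abbrev TwistorSpace (om : SymplecticForm n M) : Type _ :=
  {p : EndTM n M // IsCompatible om p.1 p.2}

end Base

/-! ## The twistor space as a manifold, its metric and connections -/

section Twistor

variable {n : ℕ} {M : Type*} [TopologicalSpace M]
  [ChartedSpace (EuclideanSpace ℝ (Fin (2 * n))) M] [IsManifold (𝓡 (2 * n)) ∞ M]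

/-- The given smooth structure on `𝒵⁰` is the one of a submanifold of `End(TM)`, of dimension
`2n + n(n+1) = n(n+3)`: the inclusion, which is a topological embedding by the choice of the
topology, is a smooth immersion. -/
class IsTwistorManifold (om : SymplecticForm n M)
    [ChartedSpace (EuclideanSpace ℝ (Fin (n * (n + 3)))) (TwistorSpace om)] : Prop
    extends IsManifold (𝓡 (n * (n + 3))) ∞ (TwistorSpace om) where
  contMDiff_incl : ContMDiff (𝓡 (n * (n + 3)))
    ((𝓡 (2 * n)).prod 𝓘(ℝ, ModelR n →L[ℝ] ModelR n)) ∞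
    (fun z : TwistorSpace om ↦ (z.1 : EndTM n M))
  injective_mfderiv_incl : ∀ z : TwistorSpace om, Function.Injective
    (mfderiv (𝓡 (n * (n + 3))) ((𝓡 (2 * n)).prod 𝓘(ℝ, ModelR n →L[ℝ] ModelR n))
      (fun z : TwistorSpace om ↦ (z.1 : EndTM n M)) z)

variable {om : SymplecticForm n M}

/-- The projection `π : 𝒵⁰ → M`. -/
def twistorProj (z : TwistorSpace om) : M := z.1.1

/-- The complex structure `j` of `T_{π(z)} M` given by a point `z` of `𝒵⁰`; as a section of
`End(π*TM)` this is the canonical section `Φ`. -/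
def twistorPhi (z : TwistorSpace om) : TM n (twistorProj z) →L[ℝ] TM n (twistorProj z) := z.1.2

variable [ChartedSpace (EuclideanSpace ℝ (Fin (n * (n + 3)))) (TwistorSpace om)]

/-- The tangent space of `𝒵⁰` at `z`. -/
abbrev TZ (z : TwistorSpace om) : Type := TangentSpace (𝓡 (n * (n + 3))) z

/-- A vector field on `𝒵⁰`, seen as a map into the tangent bundle. -/
abbrev TZ.sec (X : Π z : TwistorSpace om, TZ z) (z : TwistorSpace om) :
    TangentBundle (𝓡 (n * (n + 3))) (TwistorSpace om) := ⟨z, X z⟩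

/-- The differential `π_* : T_z 𝒵⁰ → T_{π(z)} M`. -/
def dProj (z : TwistorSpace om) : TZ z →L[ℝ] TM n (twistorProj z) :=
  mfderiv (𝓡 (n * (n + 3))) (𝓡 (2 * n)) (twistorProj (om := om)) z

/-- The derivative at `z` in direction `ξ` of a section of `E = π*TM`, taken in the preferred
trivialization of `TM` at `π(z)`. -/
def coordDeriv (s : Π z : TwistorSpace om, TM n (twistorProj z)) (z : TwistorSpace om) (ξ : TZ z) :
    TM n (twistorProj z) :=
  let t := trivializationAt (ModelR n) (fun x : M ↦ TM n x) (twistorProj z)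
  t.symmL ℝ (twistorProj z) (mvfderiv (𝓡 (n * (n + 3)))
    (fun z' : TwistorSpace om ↦ (t ⟨twistorProj z', s z'⟩).2) z ξ)

/-- The derivative at `z` in direction `ξ` of a section of `End(E)`, `E = π*TM`, taken in the
preferred trivialization of `End(TM)` at `π(z)`. -/
def coordDerivEnd (A : Π z : TwistorSpace om, TM n (twistorProj z) →L[ℝ] TM n (twistorProj z))
    (z : TwistorSpace om) (ξ : TZ z) : TM n (twistorProj z) →L[ℝ] TM n (twistorProj z) :=
  let t := trivializationAt (ModelR n →L[ℝ] ModelR n)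
    (fun x : M ↦ TM n x →L[ℝ] TM n x) (twistorProj z)
  t.symmL ℝ (twistorProj z) (mvfderiv (𝓡 (n * (n + 3)))
    (fun z' : TwistorSpace om ↦ (t ⟨twistorProj z', A z'⟩).2) z ξ)

/-- The pull-back connection `π*∇` on `E = π*TM`: in a trivialization of `TM` it is
`d_ξ s + Γ(π_* ξ) s`. -/
def pullCov (nab : LinConnection n M) (s : Π z : TwistorSpace om, TM n (twistorProj z))
    (z : TwistorSpace om) (ξ : TZ z) : TM n (twistorProj z) :=
  coordDeriv s z ξ + connForm nab (twistorProj z) (dProj z ξ) (s z)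

/-- The connection induced by `π*∇` on `End(E)`: in a trivialization of `TM` it is
`d_ξ A + [Γ(π_* ξ), A]`. -/
def pullCovEnd (nab : LinConnection n M)
    (A : Π z : TwistorSpace om, TM n (twistorProj z) →L[ℝ] TM n (twistorProj z))
    (z : TwistorSpace om) (ξ : TZ z) : TM n (twistorProj z) →L[ℝ] TM n (twistorProj z) :=
  coordDerivEnd A z ξ + (connForm nab (twistorProj z) (dProj z ξ) ∘L A z
    - A z ∘L connForm nab (twistorProj z) (dProj z ξ))

/-- `ξ` is vertical: tangent to the fibre of `π`. -/
def IsVertical (z : TwistorSpace om) (ξ : TZ z) : Prop := dProj z ξ = 0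

/-- `ξ` is in the horizontal distribution `ℋ^∇ = {ξ : (π*∇)_ξ Φ = 0}`. -/
def IsHorizontal (nab : LinConnection n M) (z : TwistorSpace om) (ξ : TZ z) : Prop :=
  pullCovEnd nab twistorPhi z ξ = 0

/-- The projection `P` onto the vertical bundle with kernel `ℋ^∇`, as a one-form with values in
`End(E)`. The vertical space at `j` is identified with `{A ∈ sp(T_x M, ω) : A j = - j A}`, `A`
corresponding to the infinitesimal variation `[A, j] = 2 A j` of `j`; so `P ξ` is the `A` of this
space with `[A, j] = (π*∇)_ξ Φ`, that is, `A = -(1/2) ((π*∇)_ξ Φ) j`. -/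
def twistorP (nab : LinConnection n M) (z : TwistorSpace om) (ξ : TZ z) :
    TM n (twistorProj z) →L[ℝ] TM n (twistorProj z) :=
  -(1 / 2 : ℝ) • (pullCovEnd nab twistorPhi z ξ ∘L twistorPhi z)

/-- The tangent vector `ξ` of `𝒵⁰` at `z` with `π_* ξ = v` and `P ξ = A`. (The map
`ξ ↦ (π_* ξ, P ξ)` is injective and its image consists of the `(v, A)` with `A` in
`{A ∈ sp(T_x M, ω) : A j = - j A}`.) -/
def twistorLift (nab : LinConnection n M) (z : TwistorSpace om)
    (v : TM n (twistorProj z)) (A : TM n (twistorProj z) → TM n (twistorProj z)) : TZ z :=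
  Function.invFun (fun ξ : TZ z ↦ (dProj z ξ, (twistorP nab z ξ : _ → _))) (v, A)

/-- The vertical part of a tangent vector of `𝒵⁰`. -/
def vertPart (nab : LinConnection n M) (z : TwistorSpace om) (ξ : TZ z) : TZ z :=
  twistorLift nab z 0 (twistorP nab z ξ)

/-- The horizontal part of a tangent vector of `𝒵⁰`. -/
def horPart (nab : LinConnection n M) (z : TwistorSpace om) (ξ : TZ z) : TZ z :=
  twistorLift nab z (dProj z ξ) 0

/-- The horizontal lift of a tangent vector of `M`. -/
def horLift (nab : LinConnection n M) (z : TwistorSpace om) (v : TM n (twistorProj z)) : TZ z :=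
  twistorLift nab z v 0

/-- The almost complex structure `𝒥^∇ = (J^h, J^v)`: `j` itself on the horizontal space
`≅ T_{π(z)} M`, and left multiplication by `j` on the vertical space. -/
def twistorJ (nab : LinConnection n M) (z : TwistorSpace om) (ξ : TZ z) : TZ z :=
  twistorLift nab z (twistorPhi z (dProj z ξ)) (fun w ↦ twistorPhi z (twistorP nab z ξ w))

/-- The metric `⟨u, v⟩ = t ω(u, j v)` on `E = π*TM`. -/
def metricE (t : ℝ) (z : TwistorSpace om) (u v : TM n (twistorProj z)) : ℝ :=
  t * om.form (twistorProj z) u (twistorPhi z v)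

/-- The metric `⟨X, Y⟩ = t π*ω(X, 𝒥^∇ Y) + (1/2) Tr (PX PY)` on `𝒵⁰`. -/
def twistorMetric (nab : LinConnection n M) (t : ℝ) (z : TwistorSpace om) (X Y : TZ z) : ℝ :=
  t * om.form (twistorProj z) (dProj z X) (dProj z (twistorJ nab z Y))
    + (1 / 2) * LinearMap.trace ℝ (TM n (twistorProj z))
        (twistorP nab z X ∘L twistorP nab z Y : TM n (twistorProj z) →L[ℝ] TM n (twistorProj z))

/-- The connection `D = π*∇ - P` on `E = π*TM`. -/
def twistorDE (nab : LinConnection n M) (s : Π z : TwistorSpace om, TM n (twistorProj z))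
    (z : TwistorSpace om) (ξ : TZ z) : TM n (twistorProj z) :=
  pullCov nab s z ξ - twistorP nab z ξ (s z)

/-- The connection induced by `D = π*∇ - P` on `End(E)`. -/
def twistorDEnd (nab : LinConnection n M)
    (A : Π z : TwistorSpace om, TM n (twistorProj z) →L[ℝ] TM n (twistorProj z))
    (z : TwistorSpace om) (ξ : TZ z) : TM n (twistorProj z) →L[ℝ] TM n (twistorProj z) :=
  pullCovEnd nab A z ξ - (twistorP nab z ξ ∘L A z - A z ∘L twistorP nab z ξ)

/-- The connection `D` on the tangent bundle of `𝒵⁰`: the direct sum of `D` on `ℋ^∇ ≅ E` and of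
`D` on the vertical bundle, a subbundle of `End(E)`. Here `twistorD nab Y z ξ` is `D_ξ Y`. -/
def twistorD (nab : LinConnection n M) (Y : Π z : TwistorSpace om, TZ z) (z : TwistorSpace om)
    (ξ : TZ z) : TZ z :=
  twistorLift nab z (twistorDE nab (fun z' ↦ dProj z' (Y z')) z ξ)
    (twistorDEnd nab (fun z' ↦ twistorP nab z' (Y z')) z ξ)

/-- The vertical part `π*R^v_{X,Y}` of the curvature endomorphism `R(π_* X, π_* Y)` of `E`:
the component in `{A : A j = - j A}` of an endomorphism `B` is `(1/2) (B + j B j)`. -/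
def vertCurvature (nab : LinConnection n M) (z : TwistorSpace om) (X Y : TZ z) : TZ z :=
  twistorLift nab z 0 (fun w ↦ (1 / 2 : ℝ) •
    (curvature nab (twistorProj z) (dProj z X) (dProj z Y) w
      + twistorPhi z (curvature nab (twistorProj z) (dProj z X) (dProj z Y) (twistorPhi z w))))

/-- The conditions that specify the symmetric tensor `S`. -/
structure IsTensorS (nab : LinConnection n M) (t : ℝ)
    (S : Π z : TwistorSpace om, TZ z →L[ℝ] TZ z →L[ℝ] TZ z) : Prop where
  symm : ∀ z (X Y : TZ z), S z X Y = S z Y X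
  vert : ∀ z (X Y A : TZ z), IsVertical z A →
    twistorMetric nab t z (vertPart nab z (S z X Y)) A =
      metricE t z (twistorP nab z A (dProj z X)) (dProj z Y)
  hor : ∀ z (X B Y : TZ z), IsVertical z B → IsHorizontal nab z Y →
    twistorMetric nab t z (horPart nab z (S z X B)) Y =
      (1 / 2) * twistorMetric nab t z (vertCurvature nab z X Y) B
  hor_hor : ∀ z (X Y : TZ z), IsHorizontal nab z X → IsHorizontal nab z Y →
    horPart nab z (S z X Y) = 0

variable [IsTwistorManifold om]

variable (om) in
/-- Linear connections on `𝒵⁰`. For such `∇̃`, the vector `∇̃_ξ Y` is written `con Y z ξ` in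
Lean. -/
abbrev TwistorConnection :=
  CovariantDerivative (𝓡 (n * (n + 3))) (EuclideanSpace ℝ (Fin (n * (n + 3))))
    (fun z : TwistorSpace om ↦ TZ z)

/-- `con` is a Levi-Civita connection of the metric of `𝒵⁰`: torsion free and metric. -/
structure IsLeviCivita (nab : LinConnection n M) (t : ℝ)
    (con : TwistorConnection om) : Prop where
  torsion_free : con.torsion = 0
  metric : ∀ (z : TwistorSpace om) (Y W : Π z : TwistorSpace om, TZ z) (ξ : TZ z),
    MDifferentiableAt (𝓡 (n * (n + 3))) (𝓡 (n * (n + 3))).tangent (TZ.sec Y) z →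
    MDifferentiableAt (𝓡 (n * (n + 3))) (𝓡 (n * (n + 3))).tangent (TZ.sec W) z →
    mvfderiv (𝓡 (n * (n + 3))) (fun z' ↦ twistorMetric nab t z' (Y z') (W z')) z ξ =
      twistorMetric nab t z (con Y z ξ) (W z) + twistorMetric nab t z (Y z) (con W z ξ)

/-- The fibre `π⁻¹(x)` is totally geodesic for `con`: its second fundamental form vanishes, that
is, `∇̃_ξ Y` is tangent to the fibre whenever `ξ` is, and `Y` is tangent to the fibre along the
fibre. -/
def IsTotallyGeodesicFibre (con : TwistorConnection om) (x : M) : Prop :=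
  ∀ (Y : Π z : TwistorSpace om, TZ z), (∀ z, twistorProj z = x → IsVertical z (Y z)) →
    ∀ (z : TwistorSpace om) (ξ : TZ z), twistorProj z = x →
      MDifferentiableAt (𝓡 (n * (n + 3))) (𝓡 (n * (n + 3))).tangent (TZ.sec Y) z →
      IsVertical z ξ → IsVertical z (con Y z ξ)

end Twistor

end TwistorGeometry

/-! The connection D = π*∇ - P is the natural starting point because it makes the whole structure
parallel. By the definition of P one has (π*∇)Φ = [P, Φ], that is DΦ = 0, and Dω = 0 because ∇ω = 0
and P takes values in sp (`mvfderiv_frameJ`, `mvfderiv_frameForm_frameK`). Hence D preserves the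
vertical bundle, is metric, and commutes with the almost complex structure (`twistorDEnd_mem`,
`mvfderiv_twistorMetric`, `twistorD_twistorJ`). Its only defect is torsion: horizontally it is
PY(π_*X) - PX(π_*Y), since ∇ is torsion free, and vertically it is d^D P = π*R^v
(`twistorDE_torsion`, `twistorDEnd_torsion`; the algebra of the second is
`vertical_torsion_identity`).

So one adds to D the tensor -PY(π_*X) - ½ R^v + S (`lcTensor`). Its antisymmetrization cancels the
torsion whatever the symmetric S is, and S is chosen so that the sum is skew for the metric
(`lcTensor_skew`). The conditions imposed on S say exactly that ⟨S(X, Y), W⟩ is one explicit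
trilinear form (`tensorForm`), so nondegeneracy of the metric gives existence and uniqueness of S
(`existsUnique_tensorS`). The result is a Levi-Civita connection (`isLeviCivita_lcConnection`), and
by uniqueness (`IsLeviCivita.unique`) every Levi-Civita connection is given by the formula of (i).

For (ii), all corrections have zero horizontal part on two vertical vectors, so only D contributes,
and its horizontal component is the derivative along the fibre of π_*Y, which vanishes on the fibre.
For (iii), in the flat case the correction reduces to terms that commute with the almost complex
structure, and D commutes with it always (`lcTensor_twistorJ`).

Computations take place in the preferred trivializations of TM: ∇ becomes d + Γ (`christoffel`), Φ
becomes a matrix function (`frameJ`), and D becomes d + K with K = Γ - P (`frameK`). A tangent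
vector of 𝒵⁰ is handled through the pair (π_*ξ, Pξ): it is determined by it because the inclusion is
an immersion, and every pair with vertical second entry occurs by the dimension count 2n + n(n+1) =
n(n+3) (`tangent_ext`, `finrank_antiSp`, `exists_tangent`).

That 𝒵⁰ is a submanifold is proved separately. A square root of endomorphisms close to the identity
identifies the forms ω_y with ω at the centre of a chart, and the Cayley transform linearizes the
compatible structures for that fixed form (`exists_symplectic_trivialization`,
`exists_compatible_chart`, `exists_submanifold_structure`). -/

noncomputable section TwistorLibrary

set_option synthInstance.maxHeartbeats 200000

/-- The topology of the twistor space, for faster instance synthesis. -/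
abbrev twistorTopology {n : ℕ} {M : Type*} [TopologicalSpace M]
    [ChartedSpace (EuclideanSpace ℝ (Fin (2 * n))) M] [IsManifold (𝓡 (2 * n)) ∞ M]
    (om : SymplecticForm n M) : TopologicalSpace (TwistorSpace om) := inferInstance

attribute [local instance high] twistorTopology

/-! ### Calculus of vector-valued functions on a manifold. -/

section VectorValued

variable {E : Type*} [NormedAddCommGroup E] [NormedSpace ℝ E]
  {H : Type*} [TopologicalSpace H] {I : ModelWithCorners ℝ E H}
  {Z : Type*} [TopologicalSpace Z] [ChartedSpace H Z]
  {F G K : Type*} [NormedAddCommGroup F] [NormedSpace ℝ F]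
  [NormedAddCommGroup G] [NormedSpace ℝ G] [NormedAddCommGroup K] [NormedSpace ℝ K]

theorem MDifferentiableAt.comp_differentiableAt {f : Z → F} {h : F → G} {z : Z}
    (hh : DifferentiableAt ℝ h (f z)) (hf : MDifferentiableAt I 𝓘(ℝ, F) f z) :
    MDifferentiableAt I 𝓘(ℝ, G) (fun z ↦ h (f z)) z :=
  hh.mdifferentiableAt.comp z hf

theorem mvfderiv_comp_differentiableAt {f : Z → F} {h : F → G} {z : Z}
    (hh : DifferentiableAt ℝ h (f z)) (hf : MDifferentiableAt I 𝓘(ℝ, F) f z) (ξ : TangentSpace I z) :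
    mvfderiv I (fun z ↦ h (f z)) z ξ = fderiv ℝ h (f z) (mvfderiv I f z ξ) := by
  have := mfderiv_comp (I := I) (I' := 𝓘(ℝ, F)) (I'' := 𝓘(ℝ, G)) z
    hh.mdifferentiableAt hf
  rw [mfderiv_eq_fderiv] at this
  exact DFunLike.congr_fun this ξ

theorem mvfderiv_clm (L : F →L[ℝ] G) {f : Z → F} {z : Z}
    (hf : MDifferentiableAt I 𝓘(ℝ, F) f z) (ξ : TangentSpace I z) :
    mvfderiv I (fun z ↦ L (f z)) z ξ = L (mvfderiv I f z ξ) := by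
  rw [mvfderiv_comp_differentiableAt L.differentiableAt hf, L.fderiv]

theorem MDifferentiableAt.clm_const (L : F →L[ℝ] G) {f : Z → F} {z : Z}
    (hf : MDifferentiableAt I 𝓘(ℝ, F) f z) : MDifferentiableAt I 𝓘(ℝ, G) (fun z ↦ L (f z)) z :=
  MDifferentiableAt.comp_differentiableAt L.differentiableAt hf

theorem mvfderiv_prodMk {f : Z → F} {g : Z → G} {z : Z}
    (hf : MDifferentiableAt I 𝓘(ℝ, F) f z) (hg : MDifferentiableAt I 𝓘(ℝ, G) g z)
    (ξ : TangentSpace I z) :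
    mvfderiv I (fun z ↦ (f z, g z)) z ξ = (mvfderiv I f z ξ, mvfderiv I g z ξ) := by
  have h := hf.prodMk_space hg
  ext
  · exact (mvfderiv_clm (ContinuousLinearMap.fst ℝ F G) h ξ).symm
  · exact (mvfderiv_clm (ContinuousLinearMap.snd ℝ F G) h ξ).symm

theorem MDifferentiableAt.bilin (B : F →L[ℝ] G →L[ℝ] K) {f : Z → F} {g : Z → G} {z : Z}
    (hf : MDifferentiableAt I 𝓘(ℝ, F) f z) (hg : MDifferentiableAt I 𝓘(ℝ, G) g z) :
    MDifferentiableAt I 𝓘(ℝ, K) (fun z ↦ B (f z) (g z)) z :=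
  MDifferentiableAt.comp_differentiableAt (f := fun z ↦ (f z, g z))
    (h := fun p : F × G ↦ B p.1 p.2) (B.isBoundedBilinearMap.differentiableAt (f z, g z)) (hf.prodMk_space hg)

theorem mvfderiv_bilin (B : F →L[ℝ] G →L[ℝ] K) {f : Z → F} {g : Z → G} {z : Z}
    (hf : MDifferentiableAt I 𝓘(ℝ, F) f z) (hg : MDifferentiableAt I 𝓘(ℝ, G) g z)
    (ξ : TangentSpace I z) :
    mvfderiv I (fun z ↦ B (f z) (g z)) z ξ =
      B (mvfderiv I f z ξ) (g z) + B (f z) (mvfderiv I g z ξ) := by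
  rw [mvfderiv_comp_differentiableAt (f := fun z ↦ (f z, g z))
    (h := fun p : F × G ↦ B p.1 p.2)
      (B.isBoundedBilinearMap.differentiableAt (f z, g z)) (hf.prodMk_space hg),
    mvfderiv_prodMk hf hg, B.isBoundedBilinearMap.fderiv]
  simp [IsBoundedBilinearMap.deriv, add_comm]

theorem MDifferentiableAt.clmApply {f : Z → F →L[ℝ] G} {g : Z → F} {z : Z}
    (hf : MDifferentiableAt I 𝓘(ℝ, F →L[ℝ] G) f z) (hg : MDifferentiableAt I 𝓘(ℝ, F) g z) :
    MDifferentiableAt I 𝓘(ℝ, G) (fun z ↦ f z (g z)) z :=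
  MDifferentiableAt.bilin (ContinuousLinearMap.id ℝ (F →L[ℝ] G)) hf hg

theorem mvfderiv_clmApply {f : Z → F →L[ℝ] G} {g : Z → F} {z : Z}
    (hf : MDifferentiableAt I 𝓘(ℝ, F →L[ℝ] G) f z) (hg : MDifferentiableAt I 𝓘(ℝ, F) g z)
    (ξ : TangentSpace I z) :
    mvfderiv I (fun z ↦ f z (g z)) z ξ = mvfderiv I f z ξ (g z) + f z (mvfderiv I g z ξ) :=
  mvfderiv_bilin (ContinuousLinearMap.id ℝ (F →L[ℝ] G)) hf hg ξ

theorem MDifferentiableAt.clmComp {f : Z → G →L[ℝ] K} {g : Z → F →L[ℝ] G} {z : Z}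
    (hf : MDifferentiableAt I 𝓘(ℝ, G →L[ℝ] K) f z) (hg : MDifferentiableAt I 𝓘(ℝ, F →L[ℝ] G) g z) :
    MDifferentiableAt I 𝓘(ℝ, F →L[ℝ] K) (fun z ↦ f z ∘L g z) z :=
  MDifferentiableAt.bilin (ContinuousLinearMap.compL ℝ F G K) hf hg

theorem mvfderiv_clmComp {f : Z → G →L[ℝ] K} {g : Z → F →L[ℝ] G} {z : Z}
    (hf : MDifferentiableAt I 𝓘(ℝ, G →L[ℝ] K) f z) (hg : MDifferentiableAt I 𝓘(ℝ, F →L[ℝ] G) g z)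
    (ξ : TangentSpace I z) :
    mvfderiv I (fun z ↦ f z ∘L g z) z ξ = mvfderiv I f z ξ ∘L g z + f z ∘L mvfderiv I g z ξ :=
  mvfderiv_bilin (ContinuousLinearMap.compL ℝ F G K) hf hg ξ

theorem Filter.EventuallyEq.mvfderiv_eq {f g : Z → F} {z : Z} (h : f =ᶠ[𝓝 z] g) :
    mvfderiv I f z = mvfderiv I g z := by
  have h1 := h.mfderiv_eq (I := I) (I' := 𝓘(ℝ, F))
  ext ξ
  exact DFunLike.congr_fun h1 ξ

theorem mvfderiv_comp_mfderiv {E' : Type*} [NormedAddCommGroup E'] [NormedSpace ℝ E']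
    {H' : Type*} [TopologicalSpace H'] {I' : ModelWithCorners ℝ E' H'}
    {M : Type*} [TopologicalSpace M] [ChartedSpace H' M] {p : Z → M} {f : M → F} {z : Z}
    (hf : MDifferentiableAt I' 𝓘(ℝ, F) f (p z)) (hp : MDifferentiableAt I I' p z)
    (ξ : TangentSpace I z) :
    mvfderiv I (fun z ↦ f (p z)) z ξ = mvfderiv I' f (p z) (mfderiv I I' p z ξ) :=
  DFunLike.congr_fun (mfderiv_comp z hf hp) ξ

/-! ### The Lie bracket as the commutator of derivations. -/

section LieBracket

variable [I.Boundaryless]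

theorem MDifferentiableAt.mvfderiv_eq_fderiv {f : Z → F} {z : Z}
    (hf : MDifferentiableAt I 𝓘(ℝ, F) f z) (ξ : TangentSpace I z) :
    mvfderiv I f z ξ = fderiv ℝ (f ∘ (extChartAt I z).symm) (extChartAt I z z) ξ := by
  rw [hf.mvfderiv, I.range_eq_univ, fderivWithin_univ]
  rfl

theorem MDifferentiableAt.differentiableAt_comp_symm {f : Z → F} {z : Z}
    (hf : MDifferentiableAt I 𝓘(ℝ, F) f z) :
    DifferentiableAt ℝ (f ∘ (extChartAt I z).symm) (extChartAt I z z) := by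
  have := (mdifferentiableAt_iff _ _).1 hf |>.2
  rw [I.range_eq_univ, differentiableWithinAt_univ] at this
  exact this

/-- The coordinate expression of a vector field in the chart at `z`. -/
def chartField (z : Z) (V : Π z : Z, TangentSpace I z) : E → E := fun y ↦
  mpullbackWithin 𝓘(ℝ, E) I (extChartAt I z).symm V (Set.range I) y

variable [IsManifold I 2 Z]

-- `TangentSpace I z` is a copy of the model space through the preferred chart at `z`, whose
-- derivative at `z` is therefore the identity; at the centre a field and its coordinate expression
-- agree as elements of `E`.
omit [I.Boundaryless] in
theorem chartField_self (z : Z) (V : Π z : Z, TangentSpace I z) :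
    chartField z V (extChartAt I z z) = V z := by
  have h1 : chartField z V (extChartAt I z z) = V ((extChartAt I z).symm (extChartAt I z z)) :=
    mfderivWithin_extChartAt_symm_inverse_apply _
  rw [h1]
  exact congrArg (fun w ↦ (V w : E)) (extChartAt_to_inv z)

theorem mlieBracket_eq_chartField (z : Z) (X Y : Π z : Z, TangentSpace I z) :
    mlieBracket I X Y z = fderiv ℝ (chartField z Y) (extChartAt I z z) (X z) -
      fderiv ℝ (chartField z X) (extChartAt I z z) (Y z) := by
  have h1 : mlieBracket I X Y z = lieBracketWithin ℝ (chartField z X) (chartField z Y)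
      ((extChartAt I z).symm ⁻¹' Set.univ ∩ Set.range I) (extChartAt I z z) := by
    rw [← mlieBracketWithin_univ, mlieBracketWithin_apply, mfderiv_extChartAt_self]
    exact DFunLike.congr_fun (ContinuousLinearMap.inverse_id (R := ℝ) (M := E)) _
  rw [h1]
  simp only [I.range_eq_univ, Set.preimage_univ, Set.inter_univ, lieBracketWithin_univ]
  rw [lieBracket, chartField_self, chartField_self]

/-- The chain rule away from the centre: the chart at `z` stays fixed while `z'` moves, so that the
right-hand side can be differentiated once more. -/
theorem mvfderiv_eq_fderiv_chartField {f : Z → F} {z z' : Z}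
    (hf : MDifferentiableAt I 𝓘(ℝ, F) f z') (hz' : z' ∈ (extChartAt I z).source)
    (V : Π z : Z, TangentSpace I z) :
    mvfderiv I f z' (V z') = fderiv ℝ (f ∘ (extChartAt I z).symm) (extChartAt I z z')
      (chartField z V (extChartAt I z z')) := by
  set c := extChartAt I z with hc
  have ht : c z' ∈ c.target := c.map_source hz'
  have hinv : c.symm (c z') = z' := c.left_inv hz'
  have hcs : MDifferentiableAt 𝓘(ℝ, E) I c.symm (c z') := by
    have := mdifferentiableWithinAt_extChartAt_symm ht
    rwa [I.range_eq_univ, mdifferentiableWithinAt_univ] at this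
  have hA := isInvertible_mfderivWithin_extChartAt_symm ht
  have hch := mfderiv_comp (I := 𝓘(ℝ, E)) (I' := I) (I'' := 𝓘(ℝ, F)) (c z')
    (hinv.symm ▸ hf) hcs
  rw [mfderiv_eq_fderiv] at hch
  refine Eq.trans ?_ (DFunLike.congr_fun hch (chartField z V (c z'))).symm
  have h2 : mfderiv 𝓘(ℝ, E) I c.symm (c z')
      (mpullbackWithin 𝓘(ℝ, E) I c.symm V (Set.range I) (c z')) = V (c.symm (c z')) := by
    rw [← mfderivWithin_univ, ← I.range_eq_univ]
    exact hA.self_apply_inverse _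
  have h3 : mvfderiv I f z' (V z') = mvfderiv I f (c.symm (c z')) (V (c.symm (c z'))) := by
    rw [hinv]
  exact h3.trans (congrArg (mvfderiv I f (c.symm (c z'))) h2).symm

variable [CompleteSpace E]

theorem differentiableAt_chartField {z : Z} {V : Π z : Z, TangentSpace I z}
    (hV : MDifferentiableAt I I.tangent (fun z ↦ (⟨z, V z⟩ : TangentBundle I Z)) z) :
    DifferentiableAt ℝ (chartField z V) (extChartAt I z z) := by
  have h : DifferentiableWithinAt ℝ (chartField z V)
      ((extChartAt I z).symm ⁻¹' Set.univ ∩ Set.range I) (extChartAt I z z) :=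
    MDifferentiableWithinAt.differentiableWithinAt_mpullbackWithin_vectorField
      (s := Set.univ) (mdifferentiableWithinAt_univ.2 hV)
  rwa [I.range_eq_univ, Set.preimage_univ, Set.inter_univ, differentiableWithinAt_univ] at h

/-- The product rule in the chart at `z`. The first term is the Hessian of `f`, so only the second
survives in a commutator. Differentiability of `V` at the single point `z` is enough. -/
theorem mvfderiv_mvfderiv {f : Z → F} {z : Z} (hf : ContMDiffAt I 𝓘(ℝ, F) 2 f z)
    {V : Π z : Z, TangentSpace I z}
    (hV : MDifferentiableAt I I.tangent (fun z ↦ (⟨z, V z⟩ : TangentBundle I Z)) z) :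
    MDifferentiableAt I 𝓘(ℝ, F) (fun z ↦ mvfderiv I f z (V z)) z ∧ ∀ ξ : TangentSpace I z,
    mvfderiv I (fun z ↦ mvfderiv I f z (V z)) z ξ =
      fderiv ℝ (fderiv ℝ (f ∘ (extChartAt I z).symm)) (extChartAt I z z) ξ (V z) +
      mvfderiv I f z (fderiv ℝ (chartField z V) (extChartAt I z z) ξ) := by
  set c := extChartAt I z with hc
  have hfh2 : ContDiffAt ℝ 2 (f ∘ c.symm) (c z) := by
    have := (contMDiffAt_iff.1 hf).2
    rw [I.range_eq_univ, contDiffWithinAt_univ] at this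
    exact this
  have hloc : (fun z' ↦ mvfderiv I f z' (V z')) =ᶠ[𝓝 z]
      fun z' ↦ (fun y ↦ fderiv ℝ (f ∘ c.symm) y (chartField z V y)) (c z') := by
    have h1 : ∀ᶠ z' in 𝓝 z, ContMDiffAt I 𝓘(ℝ, F) 2 f z' := by
      have := (contMDiffAt_iff_contMDiffAt_nhds (I := I) (I' := 𝓘(ℝ, F)) (f := f) (x := z)
        (n := 2) (by simp)).1 hf
      exact this
    filter_upwards [h1, extChartAt_source_mem_nhds (I := I) z] with z' hz' hs
    exact mvfderiv_eq_fderiv_chartField (hz'.mdifferentiableAt (by simp)) hs V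
  have h1 : DifferentiableAt ℝ (fderiv ℝ (f ∘ c.symm)) (c z) :=
    (hfh2.fderiv_right (m := 1) (by norm_num)).differentiableAt (by simp)
  have hφ := h1.clm_apply (differentiableAt_chartField hV)
  have hcd : MDifferentiableAt I 𝓘(ℝ, E) c z := mdifferentiableAt_extChartAt (mem_chart_source H z)
  refine ⟨(MDifferentiableAt.comp_differentiableAt hφ hcd).congr_of_eventuallyEq hloc, fun ξ ↦ ?_⟩
  have hcid : mvfderiv I c z ξ = ξ := DFunLike.congr_fun (mfderiv_extChartAt_self (I := I)) ξ
  rw [hloc.mvfderiv_eq, mvfderiv_comp_differentiableAt hφ hcd,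
    fderiv_clm_apply h1 (differentiableAt_chartField hV)]
  have h2 := (hf.mdifferentiableAt (by simp)).mvfderiv_eq_fderiv
    (fderiv ℝ (chartField z V) (c z) ξ)
  refine Eq.trans (add_comm _ _) ?_
  refine congrArg₂ (· + ·) ?_ ?_
  · exact congrArg₂ (fun v w ↦ fderiv ℝ (fderiv ℝ (f ∘ c.symm)) (c z) v w) hcid
      (chartField_self z V)
  · refine Eq.trans ?_ h2.symm
    exact congrArg (fun v ↦ fderiv ℝ (f ∘ c.symm) (c z) (fderiv ℝ (chartField z V) (c z) v)) hcid

/-- The Lie bracket of two vector fields acts on functions as the commutator of their actions. -/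
theorem mvfderiv_mlieBracket {f : Z → F} {z : Z} (hf : ContMDiffAt I 𝓘(ℝ, F) 2 f z)
    {X Y : Π z : Z, TangentSpace I z}
    (hX : MDifferentiableAt I I.tangent (fun z ↦ (⟨z, X z⟩ : TangentBundle I Z)) z)
    (hY : MDifferentiableAt I I.tangent (fun z ↦ (⟨z, Y z⟩ : TangentBundle I Z)) z) :
    mvfderiv I (fun z ↦ mvfderiv I f z (Y z)) z (X z) -
      mvfderiv I (fun z ↦ mvfderiv I f z (X z)) z (Y z) = mvfderiv I f z (mlieBracket I X Y z) := by
  have hfh2 : ContDiffAt ℝ 2 (f ∘ (extChartAt I z).symm) (extChartAt I z z) := by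
    have := (contMDiffAt_iff.1 hf).2
    rw [I.range_eq_univ, contDiffWithinAt_univ] at this
    exact this
  rw [(mvfderiv_mvfderiv hf hX).2, (mvfderiv_mvfderiv hf hY).2, mlieBracket_eq_chartField]
  -- The Hessian terms cancel by the symmetry of second derivatives, and the bracket remains.
  have hsymm := hfh2.isSymmSndFDerivAt (by simp) (X z) (Y z)
  have hsub : mvfderiv I f z (fderiv ℝ (chartField z Y) (extChartAt I z z) (X z) -
      fderiv ℝ (chartField z X) (extChartAt I z z) (Y z)) =
      mvfderiv I f z (fderiv ℝ (chartField z Y) (extChartAt I z z) (X z)) -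
      mvfderiv I f z (fderiv ℝ (chartField z X) (extChartAt I z z) (Y z)) := ContinuousLinearMap.map_sub _ _ _
  rw [hsub, add_sub_add_comm, sub_eq_zero.2 hsymm, zero_add]

end LieBracket
end VectorValued

/-! ### Connections on `M` and their Christoffel symbols in the preferred trivializations. -/

section Frame

variable {n : ℕ} {M : Type*} [TopologicalSpace M]
  [ChartedSpace (EuclideanSpace ℝ (Fin (2 * n))) M] [IsManifold (𝓡 (2 * n)) ∞ M]

/-- The domain of the preferred trivialization of `TM` at `x₀`. -/
def frameDom (n : ℕ) {M : Type*} [TopologicalSpace M]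
    [ChartedSpace (EuclideanSpace ℝ (Fin (2 * n))) M] (x₀ : M) : Set M :=
  (chartAt (EuclideanSpace ℝ (Fin (2 * n))) x₀).source

/-- The preferred trivialization of `TM` at `x₀`, on the fibre over `y`. -/
def frameL (x₀ y : M) : TM n y →L[ℝ] ModelR n :=
  (trivializationAt (ModelR n) (fun x : M ↦ TM n x) x₀).continuousLinearMapAt ℝ y

/-- The inverse of the preferred trivialization of `TM` at `x₀`, on the fibre over `y`. -/
def frameSymmL (x₀ y : M) : ModelR n →L[ℝ] TM n y :=
  (trivializationAt (ModelR n) (fun x : M ↦ TM n x) x₀).symmL ℝ y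

/-- The local section of `TM` which is constant in the preferred trivialization at `x₀`. -/
def frameSec (x₀ : M) (w : ModelR n) (y : M) : TM n y := frameSymmL x₀ y w

omit [IsManifold (𝓡 (2 * n)) ∞ M] in
theorem isOpen_frameDom (x₀ : M) : IsOpen (frameDom n x₀) :=
  (chartAt (EuclideanSpace ℝ (Fin (2 * n))) x₀).open_source

omit [IsManifold (𝓡 (2 * n)) ∞ M] in
theorem mem_frameDom (x₀ : M) : x₀ ∈ frameDom n x₀ :=
  mem_chart_source _ x₀

omit [IsManifold (𝓡 (2 * n)) ∞ M] in
theorem frameDom_mem_nhds {x₀ y : M} (hy : y ∈ frameDom n x₀) : frameDom n x₀ ∈ 𝓝 y :=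
  (isOpen_frameDom x₀).mem_nhds hy

theorem frameL_symm {x₀ y : M} (hy : y ∈ frameDom n x₀) (w : ModelR n) :
    frameL x₀ y (frameSymmL x₀ y w) = w :=
  Trivialization.continuousLinearMapAt_symmL _ hy w

theorem frameSymmL_frameL {x₀ y : M} (hy : y ∈ frameDom n x₀) (v : TM n y) :
    frameSymmL x₀ y (frameL x₀ y v) = v :=
  Trivialization.symmL_continuousLinearMapAt _ hy v

theorem frameL_injective {x₀ y : M} (hy : y ∈ frameDom n x₀) :
    Function.Injective (frameL (n := n) x₀ y) := fun u v h ↦ by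
  rw [← frameSymmL_frameL hy u, h, frameSymmL_frameL hy v]

/-- The trivialization of the tangent bundle is the differential of the chart; this lets the
commutator formula for functions be applied to components of vector fields. -/
theorem frameL_eq_mvfderiv {x₀ y : M} (hy : y ∈ frameDom n x₀) (v : TM n y) :
    frameL x₀ y v = mvfderiv (𝓡 (2 * n)) (extChartAt (𝓡 (2 * n)) x₀) y v :=
  DFunLike.congr_fun (TangentBundle.continuousLinearMapAt_trivializationAt hy) v

theorem mdifferentiableAt_sec_iff {x₀ y : M} (hy : y ∈ frameDom n x₀) (s : Π x : M, TM n x) :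
    MDifferentiableAt (𝓡 (2 * n)) (𝓡 (2 * n)).tangent (TM.sec s) y ↔
      MDifferentiableAt (𝓡 (2 * n)) 𝓘(ℝ, ModelR n) (fun y ↦ frameL x₀ y (s y)) y := by
  refine ((trivializationAt (ModelR n) (fun x : M ↦ TM n x) x₀).mdifferentiableAt_section_iff
    (𝓡 (2 * n)) s hy).trans (Filter.EventuallyEq.mdifferentiableAt_iff ?_)
  filter_upwards [frameDom_mem_nhds hy] with y' hy'
  exact (Trivialization.continuousLinearMapAt_apply_of_mem ℝ _ hy' (s y')).symm

theorem frameL_frameSec_eventuallyEq {x₀ y : M} (hy : y ∈ frameDom n x₀) (w : ModelR n) :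
    (fun y ↦ frameL x₀ y (frameSec x₀ w y)) =ᶠ[𝓝 y] fun _ ↦ w := by
  filter_upwards [frameDom_mem_nhds hy] with y' hy'
  exact frameL_symm hy' w

theorem mdifferentiableAt_frameSec {x₀ y : M} (hy : y ∈ frameDom n x₀) (w : ModelR n) :
    MDifferentiableAt (𝓡 (2 * n)) (𝓡 (2 * n)).tangent (TM.sec (frameSec x₀ w)) y := by
  rw [mdifferentiableAt_sec_iff hy]
  exact mdifferentiableAt_const.congr_of_eventuallyEq (frameL_frameSec_eventuallyEq hy w)

theorem contMDiffAt_frameChart {x₀ y : M} (hy : y ∈ frameDom n x₀) :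
    ContMDiffAt (𝓡 (2 * n)) 𝓘(ℝ, ModelR n) ∞ (extChartAt (𝓡 (2 * n)) x₀) y :=
  contMDiffAt_extChartAt' hy

theorem two_le_infty : (2 : WithTop ℕ∞) ≤ ∞ := WithTop.coe_le_coe.2 (le_top : (2 : ℕ∞) ≤ ⊤)

/-- The frame fields are coordinate fields: the differential of the chart takes constant values on
them, so their commutator annihilates every coordinate. -/
theorem mlieBracket_frameSec {x₀ y : M} (hy : y ∈ frameDom n x₀) (u v : ModelR n) :
    mlieBracket (𝓡 (2 * n)) (frameSec x₀ u) (frameSec x₀ v) y = 0 := by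
  apply frameL_injective hy
  have hc : ∀ w : ModelR n, (fun y ↦ mvfderiv (𝓡 (2 * n)) (extChartAt (𝓡 (2 * n)) x₀) y
      (frameSec x₀ w y)) =ᶠ[𝓝 y] fun _ ↦ w := by
    intro w
    filter_upwards [frameDom_mem_nhds hy] with y' hy'
    exact (frameL_eq_mvfderiv hy' _).symm.trans (frameL_symm hy' w)
  rw [frameL_eq_mvfderiv hy, ← mvfderiv_mlieBracket ((contMDiffAt_frameChart hy).of_le two_le_infty)
    (mdifferentiableAt_frameSec hy u) (mdifferentiableAt_frameSec hy v), (hc u).mvfderiv_eq,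
    (hc v).mvfderiv_eq]
  rw [mvfderiv_const, mvfderiv_const]
  exact (sub_self (0 : ModelR n)).trans (ContinuousLinearMap.map_zero (frameL x₀ y)).symm

variable (nab : LinConnection n M)

/-- The Christoffel symbol `Γ(u) w` of the connection in the preferred trivialization at `x₀`. -/
def christoffel (x₀ y : M) : ModelR n →L[ℝ] ModelR n →L[ℝ] ModelR n :=
  (∑ i, (EuclideanSpace.proj i : ModelR n →L[ℝ] ℝ).smulRight
    (frameL x₀ y ∘L nab (frameSec x₀ (EuclideanSpace.single i 1)) y ∘L frameSymmL x₀ y)).flip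

theorem christoffel_apply (x₀ y : M) (u w : ModelR n) :
    christoffel nab x₀ y u w = ∑ i, w i • frameL x₀ y
      (nab (frameSec x₀ (EuclideanSpace.single i 1)) y (frameSymmL x₀ y u)) := by
  simp [christoffel]

theorem nab_sum {ι : Type*} (S : Finset ι) (σ : ι → Π x : M, TM n x) {y : M}
    (hσ : ∀ i, MDifferentiableAt (𝓡 (2 * n)) (𝓡 (2 * n)).tangent (TM.sec (σ i)) y) :
    nab (fun y ↦ ∑ i ∈ S, σ i y) y = ∑ i ∈ S, nab (σ i) y := by
  classical
  induction S using Finset.induction_on with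
  | empty =>
    exact congrFun nab.zero y
  | insert i S hi ih =>
    rw [Finset.sum_insert hi, ← ih]
    have h2 : MDifferentiableAt (𝓡 (2 * n)) (𝓡 (2 * n)).tangent
        (TM.sec (fun y ↦ ∑ i ∈ S, σ i y)) y :=
      MDifferentiableAt.sum_section (fun i _ ↦ hσ i)
    rw [← nab.isCovariantDerivativeOnUniv.add (hσ i) h2]
    congr 1
    funext y
    simp [Finset.sum_insert hi]

theorem nab_congr {s s' : Π x : M, TM n x} {y : M}
    (hs : MDifferentiableAt (𝓡 (2 * n)) (𝓡 (2 * n)).tangent (TM.sec s) y)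
    (h : ∀ᶠ x in 𝓝 y, s x = s' x) : nab s y = nab s' y := by
  have hs' : MDifferentiableAt (𝓡 (2 * n)) (𝓡 (2 * n)).tangent (TM.sec s') y := by
    refine hs.congr_of_eventuallyEq ?_
    filter_upwards [h] with x hx
    simp [TM.sec, hx]
  exact nab.isCovariantDerivativeOnUniv.congr_of_eventuallyEq hs hs' Filter.univ_mem h

/-- Expand `s` in the frame fields and apply the Leibniz rule. The formula d + Γ holds at every
point of the chart domain, so it can be differentiated again. -/
theorem frameL_nab {x₀ y : M} (hy : y ∈ frameDom n x₀) {s : Π x : M, TM n x}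
    (hs : MDifferentiableAt (𝓡 (2 * n)) (𝓡 (2 * n)).tangent (TM.sec s) y) (u : TM n y) :
    frameL x₀ y (nab s y u) = mvfderiv (𝓡 (2 * n)) (fun y ↦ frameL x₀ y (s y)) y u +
      christoffel nab x₀ y (frameL x₀ y u) (frameL x₀ y (s y)) := by
  have hs' := (mdifferentiableAt_sec_iff hy s).1 hs
  set c : Fin (2 * n) → M → ℝ := fun i y ↦ (frameL x₀ y (s y)) i with hc
  have hcd : ∀ i, MDifferentiableAt (𝓡 (2 * n)) 𝓘(ℝ, ℝ) (c i) y := fun i ↦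
    MDifferentiableAt.clm_const (EuclideanSpace.proj i : ModelR n →L[ℝ] ℝ) hs'
  have hcdd : ∀ i, mvfderiv (𝓡 (2 * n)) (c i) y u =
      (mvfderiv (𝓡 (2 * n)) (fun y ↦ frameL x₀ y (s y)) y u) i := fun i ↦
    mvfderiv_clm (EuclideanSpace.proj i : ModelR n →L[ℝ] ℝ) hs' u
  have hsec := fun i : Fin (2 * n) ↦
    mdifferentiableAt_frameSec hy (EuclideanSpace.single i (1 : ℝ))
  have heq : ∀ᶠ x in 𝓝 y, s x =
      ∑ i, (c i • frameSec x₀ (EuclideanSpace.single i (1 : ℝ))) x := by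
    filter_upwards [frameDom_mem_nhds hy] with x hx
    apply frameL_injective hx
    rw [map_sum]
    simp only [Pi.smul_apply', ContinuousLinearMap.map_smul, frameSec, frameL_symm hx]
    ext j
    simp [hc, Pi.single_apply]
  rw [nab_congr nab hs heq, nab_sum nab Finset.univ _ fun i ↦ (hcd i).smul_section (hsec i),
    sum_apply, map_sum, christoffel_apply, frameSymmL_frameL hy]
  have : ∀ i, frameL x₀ y (nab (c i • frameSec x₀ (EuclideanSpace.single i (1 : ℝ))) y u) =
      (mvfderiv (𝓡 (2 * n)) (fun y ↦ frameL x₀ y (s y)) y u) i • EuclideanSpace.single i (1 : ℝ) +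
      (frameL x₀ y (s y)) i •
        frameL x₀ y (nab (frameSec x₀ (EuclideanSpace.single i 1)) y u) := by
    intro i
    rw [nab.isCovariantDerivativeOnUniv.leibniz (hsec i) (hcd i), add_apply,
      smul_apply, ContinuousLinearMap.smulRight_apply, ContinuousLinearMap.map_add,
        ContinuousLinearMap.map_smul,
      ContinuousLinearMap.map_smul, hcdd, frameSec, frameL_symm hy, add_comm]
  simp only [this, Finset.sum_add_distrib]
  congr 1
  ext j
  simp [Pi.single_apply]

/-- `connForm` refers to the trivialization centred at `y`, so in the one centred at `x₀` it picks
up a derivative of the change of frame. For `y = x₀` this term vanishes. -/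
theorem frameL_connForm {x₀ y : M} (hy : y ∈ frameDom n x₀) (u w : TM n y) :
    frameL x₀ y (connForm nab y u w) =
      mvfderiv (𝓡 (2 * n)) (fun y' ↦ frameL x₀ y' (constField y w y')) y u +
      christoffel nab x₀ y (frameL x₀ y u) (frameL x₀ y w) := by
  have h := frameL_nab nab hy (mdifferentiableAt_constField y w) u
  have hw : constField y w y = w := frameSymmL_frameL (mem_frameDom y) w
  rw [hw] at h
  exact h

theorem frameL_connForm_self (x : M) (u w : TM n x) :
    frameL x x (connForm nab x u w) = christoffel nab x x (frameL x x u) (frameL x x w) := by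
  rw [frameL_connForm nab (mem_frameDom x)]
  have : (fun y' ↦ frameL x y' (constField x w y')) =ᶠ[𝓝 x] fun _ ↦ frameL x x w :=
    frameL_frameSec_eventuallyEq (mem_frameDom x) _
  rw [this.mvfderiv_eq, mvfderiv_const]
  simp

/-- Zero torsion evaluated on two frame fields, whose bracket vanishes. -/
theorem christoffel_symm (htor : nab.torsion = 0) {x₀ y : M} (hy : y ∈ frameDom n x₀)
    (u w : ModelR n) : christoffel nab x₀ y u w = christoffel nab x₀ y w u := by
  have h := CovariantDerivative.torsion_eq_zero_iff nab |>.1 htor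
    (mdifferentiableAt_frameSec hy u) (mdifferentiableAt_frameSec hy w)
  rw [mlieBracket_frameSec hy, sub_eq_zero] at h
  have h' := congrArg (frameL x₀ y) h
  rw [frameL_nab nab hy (mdifferentiableAt_frameSec hy _),
    frameL_nab nab hy (mdifferentiableAt_frameSec hy _),
    (frameL_frameSec_eventuallyEq hy u).mvfderiv_eq,
    (frameL_frameSec_eventuallyEq hy w).mvfderiv_eq] at h'
  simpa [mvfderiv_const, frameSec, frameL_symm hy] using h'

end Frame

/-- Isolates the shape of `christoffel`: it depends linearly on finitely many operators, so it is
differentiable as soon as they are. -/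
theorem MDifferentiableAt.sum_smulRight_flip {E : Type*} [NormedAddCommGroup E] [NormedSpace ℝ E]
    {H : Type*} [TopologicalSpace H] {I : ModelWithCorners ℝ E H}
    {Z : Type*} [TopologicalSpace Z] [ChartedSpace H Z]
    {F G K : Type*} [NormedAddCommGroup F] [NormedSpace ℝ F]
    [NormedAddCommGroup G] [NormedSpace ℝ G] [NormedAddCommGroup K] [NormedSpace ℝ K]
    {ι : Type} [Fintype ι] (l : ι → F →L[ℝ] ℝ) {A : ι → Z → G →L[ℝ] K} {z : Z}
    (hA : ∀ i, MDifferentiableAt I 𝓘(ℝ, G →L[ℝ] K) (A i) z) :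
    MDifferentiableAt I 𝓘(ℝ, G →L[ℝ] F →L[ℝ] K)
      (fun z ↦ (∑ i, (l i).smulRight (A i z)).flip) z := by
  have hB : ∀ i ∈ Finset.univ, MDifferentiableAt I 𝓘(ℝ, G →L[ℝ] F →L[ℝ] K)
      (fun z ↦ ((l i).smulRight (A i z)).flip) z := fun i _ ↦ by
    let T : (F →L[ℝ] G →L[ℝ] K) →L[ℝ] G →L[ℝ] F →L[ℝ] K :=
      (ContinuousLinearMap.flipₗᵢ ℝ F G K).toContinuousLinearEquiv.toContinuousLinearMap
    let S : (G →L[ℝ] K) →L[ℝ] F →L[ℝ] G →L[ℝ] K := ContinuousLinearMap.smulRightL ℝ F _ (l i)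
    exact MDifferentiableAt.clm_const (F := F →L[ℝ] G →L[ℝ] K) (G := G →L[ℝ] F →L[ℝ] K) T
      (MDifferentiableAt.clm_const (F := G →L[ℝ] K) (G := F →L[ℝ] G →L[ℝ] K) S (hA i))
  refine (MDifferentiableAt.sum (t := Finset.univ)
    (f := fun (i : ι) (z : Z) ↦ ((l i).smulRight (A i z)).flip) hB).congr_of_eventuallyEq (Filter.Eventually.of_forall fun y ↦ ?_)
  ext v w
  simp

/-! ### Curvature and symplectic form in a frame. -/

section FrameCurvature

variable {n : ℕ} {M : Type*} [TopologicalSpace M]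
  [ChartedSpace (EuclideanSpace ℝ (Fin (2 * n))) M] [IsManifold (𝓡 (2 * n)) ∞ M]

theorem contMDiffAt_frameSec {x₀ y : M} (hy : y ∈ frameDom n x₀) (w : ModelR n) :
    ContMDiffAt (𝓡 (2 * n)) (𝓡 (2 * n)).tangent ∞ (TM.sec (frameSec x₀ w)) y := by
  refine ((trivializationAt (ModelR n) (fun x : M ↦ TM n x) x₀).contMDiffAt_section_iff hy).2 ?_
  refine ContMDiffAt.congr_of_eventuallyEq (contMDiffAt_const (c := w)) ?_
  filter_upwards [frameDom_mem_nhds hy] with y' hy'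
  exact (Trivialization.continuousLinearMapAt_apply_of_mem ℝ _ hy' _).symm.trans (frameL_symm hy' w)

/-- A smooth section defined near a point agrees near it with a global smooth section. -/
theorem exists_contMDiff_eq_frameSec [T2Space M] (x₀ : M) (w : ModelR n) :
    ∃ σ : Π x : M, TM n x, ContMDiff (𝓡 (2 * n)) (𝓡 (2 * n)).tangent ∞ (TM.sec σ) ∧
      ∀ᶠ y in 𝓝 x₀, σ y = frameSec x₀ w y := by
  let ψ : SmoothBumpFunction (𝓡 (2 * n)) x₀ := Classical.arbitrary _
  refine ⟨(ψ : M → ℝ) • frameSec x₀ w, ?_, ?_⟩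
  · exact ContMDiffOn.smul_section_of_tsupport ψ.contMDiff.contMDiffOn (isOpen_frameDom x₀)
      ψ.tsupport_subset_chartAt_source fun y hy ↦ (contMDiffAt_frameSec hy w).contMDiffWithinAt
  · filter_upwards [ψ.eventuallyEq_one] with y hy
    simp [hy]

variable {nab : LinConnection n M}

/-- The smoothness of a connection is used on globally smooth sections, so the local frame fields
are first replaced by global ones through bump functions; this is where the Hausdorff property
enters. -/
theorem mdifferentiableAt_christoffel [T2Space M]
    (hs : CovariantDerivative.ContMDiffCovariantDerivative nab ∞) (x₀ : M) :
    MDifferentiableAt (𝓡 (2 * n)) 𝓘(ℝ, ModelR n →L[ℝ] ModelR n →L[ℝ] ModelR n)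
      (christoffel nab x₀) x₀ := by
  have hA : ∀ w, MDifferentiableAt (𝓡 (2 * n)) 𝓘(ℝ, ModelR n →L[ℝ] ModelR n)
      (fun y ↦ frameL x₀ y ∘L nab (frameSec x₀ w) y ∘L frameSymmL x₀ y) x₀ := by
    intro w
    obtain ⟨σ, hσ, hσe⟩ := exists_contMDiff_eq_frameSec x₀ w
    have h1 := hs.contMDiff.contMDiff (σ := σ) (contMDiffOn_univ.2 hσ)
    have h2 := (contMDiffAt_hom_bundle _).1 ((contMDiffOn_univ.1 h1) x₀) |>.2
    refine (h2.mdifferentiableAt (by simp)).congr_of_eventuallyEq ?_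
    filter_upwards [hσe.eventually_nhds, frameDom_mem_nhds (mem_frameDom (n := n) x₀)] with y hy hyd
    rw [nab_congr nab (mdifferentiableAt_frameSec hyd w) (hy.mono fun _ h ↦ h.symm)]
    rfl
  exact MDifferentiableAt.sum_smulRight_flip _ fun i ↦ hA (EuclideanSpace.single i 1)

/-- The curvature at `x` in the preferred trivialization. -/
def curvatureForm (nab : LinConnection n M) (x : M) (u v : ModelR n) : ModelR n →L[ℝ] ModelR n :=
  mvfderiv (𝓡 (2 * n)) (christoffel nab x) x (frameSymmL x x u) v -
    mvfderiv (𝓡 (2 * n)) (christoffel nab x) x (frameSymmL x x v) u +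
    (christoffel nab x x u ∘L christoffel nab x x v - christoffel nab x x v ∘L christoffel nab x x u)

/-- The extensions in `curvature` are frame fields at `x`, so the bracket term drops, and an
iterated derivative of frame fields is dΓ(a)(b)c + Γ(a)Γ(b)c. -/
theorem frameL_curvature [T2Space M]
    (hs : CovariantDerivative.ContMDiffCovariantDerivative nab ∞) (x : M) (u v w : TM n x) :
    frameL x x (curvature nab x u v w) =
      curvatureForm nab x (frameL x x u) (frameL x x v) (frameL x x w) := by
  have hx := mem_frameDom (n := n) x
  have hG := mdifferentiableAt_christoffel hs x
  have key : ∀ a b c : ModelR n,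
      frameL x x (nab (fun y ↦ nab (frameSec x c) y (frameSec x b y)) x (frameSymmL x x a)) =
      mvfderiv (𝓡 (2 * n)) (christoffel nab x) x (frameSymmL x x a) b c +
        christoffel nab x x a (christoffel nab x x b c) := by
    intro a b c
    have hloc : (fun y ↦ frameL x y (nab (frameSec x c) y (frameSec x b y))) =ᶠ[𝓝 x]
        fun y ↦ christoffel nab x y b c := by
      filter_upwards [frameDom_mem_nhds hx] with y hy
      rw [frameL_nab nab hy (mdifferentiableAt_frameSec hy c),
        (frameL_frameSec_eventuallyEq hy c).mvfderiv_eq, mvfderiv_const]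
      simp [frameSec, frameL_symm hy]
    have h1 := hG.clmApply (mdifferentiableAt_const (c := b))
    have hd := h1.clmApply (mdifferentiableAt_const (c := c))
    rw [frameL_nab nab hx ((mdifferentiableAt_sec_iff hx _).2 (hd.congr_of_eventuallyEq hloc)),
      hloc.mvfderiv_eq, frameL_symm hx, show frameL x x (nab (frameSec x c) x (frameSec x b x)) =
        christoffel nab x x b c from hloc.self_of_nhds,
      mvfderiv_clmApply h1 mdifferentiableAt_const, mvfderiv_clmApply hG mdifferentiableAt_const]
    simp [mvfderiv_const]
  have hbr : mlieBracket (𝓡 (2 * n)) (constField x u) (constField x v) x = 0 :=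
    mlieBracket_frameSec hx _ _
  have k1 := key (frameL x x u) (frameL x x v) (frameL x x w)
  have k2 := key (frameL x x v) (frameL x x u) (frameL x x w)
  rw [frameSymmL_frameL hx] at k1 k2
  simp only [curvature, curvatureForm]
  rw [hbr]
  simp only [ContinuousLinearMap.map_sub, ContinuousLinearMap.map_zero, sub_zero]
  refine (congrArg₂ (· - ·) k1 k2).trans ?_
  simp only [add_apply, sub_apply, ContinuousLinearMap.comp_apply, frameSymmL_frameL hx]
  abel

variable {om : SymplecticForm n M}

/-- The symplectic form in the preferred trivialization of `TM` at `x₀`. -/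
def frameForm (om : SymplecticForm n M) (x₀ y : M) : ModelR n →L[ℝ] ModelR n →L[ℝ] ℝ :=
  ContinuousLinearMap.precomp ℝ (frameSymmL x₀ y) ∘L om.form y ∘L frameSymmL x₀ y

theorem frameForm_apply (x₀ y : M) (a b : ModelR n) :
    frameForm om x₀ y a b = om.form y (frameSymmL x₀ y a) (frameSymmL x₀ y b) := rfl

theorem frameForm_frameL {x₀ y : M} (hy : y ∈ frameDom n x₀) (a b : TM n y) :
    frameForm om x₀ y (frameL x₀ y a) (frameL x₀ y b) = om.form y a b := by
  rw [frameForm_apply, frameSymmL_frameL hy, frameSymmL_frameL hy]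

theorem contMDiffAt_frameForm {x₀ y : M} (hy : y ∈ frameDom n x₀) :
    ContMDiffAt (𝓡 (2 * n)) 𝓘(ℝ, ModelR n →L[ℝ] ModelR n →L[ℝ] ℝ) ∞ (frameForm om x₀) y := by
  have hb : y ∈ (trivializationAt (ModelR n →L[ℝ] ModelR n →L[ℝ] ℝ)
      (fun x : M ↦ TM n x →L[ℝ] TM n x →L[ℝ] ℝ) x₀).baseSet := by
    simpa using show y ∈ (chartAt (EuclideanSpace ℝ (Fin (2 * n))) x₀).source from hy
  refine ((Trivialization.contMDiffAt_section_iff (trivializationAt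
    (ModelR n →L[ℝ] ModelR n →L[ℝ] ℝ) (fun x : M ↦ TM n x →L[ℝ] TM n x →L[ℝ] ℝ) x₀) hb).1 om.smooth.contMDiffAt).congr_of_eventuallyEq
    ?_
  filter_upwards [frameDom_mem_nhds hy] with y' hy'
  ext a b
  refine ((inCoordinates_apply_eq₂ hy' hy' (by simp)).trans ?_).symm
  have hs : ∀ c, frameSymmL x₀ y' c =
      (trivializationAt (ModelR n) (fun x : M ↦ TM n x) x₀).symm y' c := fun c ↦
    (trivializationAt (ModelR n) (fun x : M ↦ TM n x) x₀).symmL_apply hy' c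
  rw [frameForm_apply, hs, hs]
  simp

/-- This is ∇ω = 0 tested on frame fields, whose covariant derivatives are Christoffel symbols. -/
theorem mvfderiv_frameForm (hnab : IsSymplecticConnection om nab) {x₀ y : M}
    (hy : y ∈ frameDom n x₀) (u : TM n y) (a b : ModelR n) :
    mvfderiv (𝓡 (2 * n)) (frameForm om x₀) y u a b =
      frameForm om x₀ y (christoffel nab x₀ y (frameL x₀ y u) a) b +
      frameForm om x₀ y a (christoffel nab x₀ y (frameL x₀ y u) b) := by
  have hd := (contMDiffAt_frameForm (om := om) hy).mdifferentiableAt (by simp)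
  have h := hnab.parallel y (frameSec x₀ a) (frameSec x₀ b) u (mdifferentiableAt_frameSec hy a)
    (mdifferentiableAt_frameSec hy b)
  have hl : (fun y ↦ om.form y (frameSec x₀ a y) (frameSec x₀ b y)) =
    fun y ↦ frameForm om x₀ y a b := rfl
  have hd1 := hd.clmApply (mdifferentiableAt_const (c := a))
  rw [hl, mvfderiv_clmApply hd1 mdifferentiableAt_const,
    mvfderiv_clmApply hd mdifferentiableAt_const, mvfderiv_const, mvfderiv_const] at h
  have hn : ∀ c, frameL x₀ y (nab (frameSec x₀ c) y u) =
      christoffel nab x₀ y (frameL x₀ y u) c := by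
    intro c
    rw [frameL_nab nab hy (mdifferentiableAt_frameSec hy c),
      (frameL_frameSec_eventuallyEq hy c).mvfderiv_eq, mvfderiv_const]
    simp [frameSec, frameL_symm hy]
  rw [← frameForm_frameL hy, ← frameForm_frameL hy, hn, hn] at h
  simpa [frameSec, frameL_symm hy] using h

/-- The curvature of a connection preserving ω lies in sp. The value of ω on two frame fields has
commuting derivatives along coordinate fields; expanding both orders by ∇ω = 0, the terms with one Γ
in each argument cancel and the curvature is left. -/
theorem frameForm_curvatureForm [T2Space M] (hnab : IsSymplecticConnection om nab) (x : M)
    (u v a b : ModelR n) :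
    frameForm om x x (curvatureForm nab x u v a) b +
      frameForm om x x a (curvatureForm nab x u v b) = 0 := by
  have hx := mem_frameDom (n := n) x
  have hG := mdifferentiableAt_christoffel hnab.smooth x
  have hO := (contMDiffAt_frameForm (om := om) hx).mdifferentiableAt (by simp)
  have hΓ : ∀ p c : ModelR n,
      MDifferentiableAt (𝓡 (2 * n)) 𝓘(ℝ, ModelR n) (fun y ↦ christoffel nab x y p c) x := fun p c ↦
    (hG.clmApply (mdifferentiableAt_const (c := p))).clmApply (mdifferentiableAt_const (c := c))
  have hΓd : ∀ (p c : ModelR n) ξ, mvfderiv (𝓡 (2 * n)) (fun y ↦ christoffel nab x y p c) x ξ =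
      mvfderiv (𝓡 (2 * n)) (christoffel nab x) x ξ p c := fun p c ξ ↦ by
    rw [mvfderiv_clmApply (hG.clmApply (mdifferentiableAt_const (c := p))) mdifferentiableAt_const,
      mvfderiv_clmApply hG mdifferentiableAt_const]
    simp [mvfderiv_const]
  have hOab : ∀ (f g : M → ModelR n), MDifferentiableAt (𝓡 (2 * n)) 𝓘(ℝ, ModelR n) f x →
      MDifferentiableAt (𝓡 (2 * n)) 𝓘(ℝ, ModelR n) g x → 
      MDifferentiableAt (𝓡 (2 * n)) 𝓘(ℝ, ℝ) (fun y ↦ frameForm om x y (f y) (g y)) x ∧ ∀ ξ,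
      mvfderiv (𝓡 (2 * n)) (fun y ↦ frameForm om x y (f y) (g y)) x ξ =
        frameForm om x x (christoffel nab x x (frameL x x ξ) (f x)) (g x) +
        frameForm om x x (f x) (christoffel nab x x (frameL x x ξ) (g x)) +
        frameForm om x x (mvfderiv (𝓡 (2 * n)) f x ξ) (g x) +
        frameForm om x x (f x) (mvfderiv (𝓡 (2 * n)) g x ξ) := by
    intro f g hf hg
    refine ⟨(hO.clmApply hf).clmApply hg, fun ξ ↦ ?_⟩
    rw [mvfderiv_clmApply (hO.clmApply hf) hg, mvfderiv_clmApply hO hf, add_apply,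
      mvfderiv_frameForm hnab hx]
  have hfab : ContMDiffAt (𝓡 (2 * n)) 𝓘(ℝ, ℝ) 2 (fun y ↦ frameForm om x y a b) x :=
    (((contMDiffAt_frameForm (om := om) hx).clm_apply contMDiffAt_const).clm_apply
      contMDiffAt_const).of_le two_le_infty
  have hder : ∀ p : ModelR n, (fun y ↦ mvfderiv (𝓡 (2 * n)) (fun y ↦ frameForm om x y a b) y
      (frameSec x p y)) =ᶠ[𝓝 x] fun y ↦ frameForm om x y (christoffel nab x y p a) b +
        frameForm om x y a (christoffel nab x y p b) := by
    intro p
    filter_upwards [frameDom_mem_nhds hx] with y hy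
    have hd := (contMDiffAt_frameForm (om := om) hy).mdifferentiableAt (by simp)
    rw [mvfderiv_clmApply (hd.clmApply (mdifferentiableAt_const (c := a))) mdifferentiableAt_const,
      mvfderiv_clmApply hd mdifferentiableAt_const, mvfderiv_const, mvfderiv_const, add_apply,
      mvfderiv_frameForm hnab hy]
    simp [frameSec, frameL_symm hy]
  have h := mvfderiv_mlieBracket hfab (mdifferentiableAt_frameSec hx u)
    (mdifferentiableAt_frameSec hx v)
  rw [mlieBracket_frameSec hx, ContinuousLinearMap.map_zero, (hder u).mvfderiv_eq,
    (hder v).mvfderiv_eq] at h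
  have hc : ∀ c : ModelR n, MDifferentiableAt (𝓡 (2 * n)) 𝓘(ℝ, ModelR n) (fun _ : M ↦ c) x :=
    fun c ↦ mdifferentiableAt_const
  rw [mvfderiv_fun_add (hOab _ _ (hΓ v a) (hc b)).1 (hOab _ _ (hc a) (hΓ v b)).1,
    mvfderiv_fun_add (hOab _ _ (hΓ u a) (hc b)).1 (hOab _ _ (hc a) (hΓ u b)).1, add_apply,
      add_apply,
    (hOab _ _ (hΓ v a) (hc b)).2, (hOab _ _ (hc a) (hΓ v b)).2,
    (hOab _ _ (hΓ u a) (hc b)).2, (hOab _ _ (hc a) (hΓ u b)).2, hΓd, hΓd, hΓd, hΓd,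
    mvfderiv_const, mvfderiv_const] at h
  simp only [frameSec, frameL_symm hx, zero_apply, ContinuousLinearMap.map_zero, add_zero] at h
  simp only [curvatureForm, add_apply, sub_apply, ContinuousLinearMap.comp_apply,
    ContinuousLinearMap.map_add, ContinuousLinearMap.map_sub]
  linarith

end FrameCurvature

/-! ### Endomorphisms of the tangent spaces in a frame. -/

section ConjL

variable {n : ℕ} {M : Type*} [TopologicalSpace M]
  [ChartedSpace (EuclideanSpace ℝ (Fin (2 * n))) M] [IsManifold (𝓡 (2 * n)) ∞ M]

/-- An endomorphism of `T_y M` in the preferred trivialization of `TM` at `x₀`. -/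
def conjL (x₀ y : M) (A : TM n y →L[ℝ] TM n y) : ModelR n →L[ℝ] ModelR n :=
  frameL x₀ y ∘L A ∘L frameSymmL x₀ y

theorem conjL_apply (x₀ y : M) (A : TM n y →L[ℝ] TM n y) (w : ModelR n) :
    conjL x₀ y A w = frameL x₀ y (A (frameSymmL x₀ y w)) := rfl

theorem conjL_frameL {x₀ y : M} (hy : y ∈ frameDom n x₀) (A : TM n y →L[ℝ] TM n y) (v : TM n y) :
    conjL x₀ y A (frameL x₀ y v) = frameL x₀ y (A v) := by
  rw [conjL_apply, frameSymmL_frameL hy]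

theorem conjL_add (x₀ y : M) (A B : TM n y →L[ℝ] TM n y) :
    conjL x₀ y (A + B) = conjL x₀ y A + conjL x₀ y B := by
  ext1 w; simp [conjL_apply]

theorem conjL_sub (x₀ y : M) (A B : TM n y →L[ℝ] TM n y) :
    conjL x₀ y (A - B) = conjL x₀ y A - conjL x₀ y B := by
  ext1 w; simp [conjL_apply]

theorem conjL_smul (x₀ y : M) (c : ℝ) (A : TM n y →L[ℝ] TM n y) :
    conjL x₀ y (c • A) = c • conjL x₀ y A := by
  ext1 w; simp [conjL_apply]

theorem conjL_comp {x₀ y : M} (hy : y ∈ frameDom n x₀) (A B : TM n y →L[ℝ] TM n y) :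
    conjL x₀ y (A ∘L B) = conjL x₀ y A ∘L conjL x₀ y B := by
  ext1 w; simp [conjL_apply, frameSymmL_frameL hy]

theorem conjL_injective {x₀ y : M} (hy : y ∈ frameDom n x₀) :
    Function.Injective (conjL (n := n) x₀ y) := fun A B h ↦ by
  ext1 v
  apply frameL_injective hy
  rw [← conjL_frameL hy, h, conjL_frameL hy]

/-- The endomorphism of `T_y M` with given matrix in the preferred trivialization at `x₀`. -/
def conjSymmL (x₀ y : M) (A : ModelR n →L[ℝ] ModelR n) : TM n y →L[ℝ] TM n y :=
  frameSymmL x₀ y ∘L A ∘L frameL x₀ y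

theorem conjL_conjSymmL {x₀ y : M} (hy : y ∈ frameDom n x₀) (A : ModelR n →L[ℝ] ModelR n) :
    conjL x₀ y (conjSymmL x₀ y A) = A := by
  ext1 w; simp [conjL_apply, conjSymmL, frameL_symm hy]

theorem trace_conjL {x₀ y : M} (hy : y ∈ frameDom n x₀) (A : TM n y →L[ℝ] TM n y) :
    LinearMap.trace ℝ (ModelR n) (conjL x₀ y A : ModelR n →L[ℝ] ModelR n) =
      LinearMap.trace ℝ (TM n y) (A : TM n y →L[ℝ] TM n y) := by
  have : Module.Free ℝ (TM n y) := inferInstanceAs (Module.Free ℝ (ModelR n))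
  have : Module.Finite ℝ (TM n y) := inferInstanceAs (Module.Finite ℝ (ModelR n))
  have h := LinearMap.trace_comp_comm' (R := ℝ) (M := TM n y) (N := ModelR n)
    (frameL x₀ y).toLinearMap (A ∘L frameSymmL x₀ y).toLinearMap
  refine h.symm.trans (congrArg _ ?_)
  ext v
  simp [frameSymmL_frameL hy]

theorem trivializationAt_end_snd (x₀ : M) (p : EndTM n M) :
    (trivializationAt (ModelR n →L[ℝ] ModelR n) (fun x : M ↦ TM n x →L[ℝ] TM n x) x₀ p).2 =
      conjL x₀ p.1 p.2 := rfl

theorem mem_baseSet_end {x₀ y : M} (hy : y ∈ frameDom n x₀) :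
    y ∈ (trivializationAt (ModelR n →L[ℝ] ModelR n)
      (fun x : M ↦ TM n x →L[ℝ] TM n x) x₀).baseSet := by
  simpa using show y ∈ (chartAt (EuclideanSpace ℝ (Fin (2 * n))) x₀).source from hy

theorem conjL_symmL {x₀ y : M} (hy : y ∈ frameDom n x₀) (A : ModelR n →L[ℝ] ModelR n) :
    conjL x₀ y ((trivializationAt (ModelR n →L[ℝ] ModelR n)
      (fun x : M ↦ TM n x →L[ℝ] TM n x) x₀).symmL ℝ y A) = A := by
  have h := Trivialization.continuousLinearMapAt_symmL (R := ℝ)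
    (trivializationAt (ModelR n →L[ℝ] ModelR n) (fun x : M ↦ TM n x →L[ℝ] TM n x) x₀)
    (mem_baseSet_end hy) A
  exact (Trivialization.continuousLinearMapAt_apply_of_mem ℝ _ (mem_baseSet_end hy) _).symm.trans h

/-- The transition between the preferred trivializations at `y` and at `x₀`. -/
def frameTrans (x₀ y y' : M) : ModelR n →L[ℝ] ModelR n := frameL x₀ y' ∘L frameSymmL y y'

theorem mdifferentiableAt_frameTrans {x₀ y : M} (hy : y ∈ frameDom n x₀) :
    MDifferentiableAt (𝓡 (2 * n)) 𝓘(ℝ, ModelR n →L[ℝ] ModelR n) (frameTrans (n := n) x₀ y) y := by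
  have h := contMDiffAt_coordChangeL (IB := 𝓡 (2 * n)) (n := ∞)
    (e := trivializationAt (ModelR n) (fun x : M ↦ TM n x) y)
    (e' := trivializationAt (ModelR n) (fun x : M ↦ TM n x) x₀) (x := y) (mem_frameDom y) hy
  refine (h.mdifferentiableAt (by simp)).congr_of_eventuallyEq ?_
  filter_upwards [frameDom_mem_nhds hy, frameDom_mem_nhds (mem_frameDom (n := n) y)] with y' h1 h2
  ext1 w
  have h3 := Trivialization.coordChangeL_apply
    (trivializationAt (ModelR n) (fun x : M ↦ TM n x) y) 
    (trivializationAt (ModelR n) (fun x : M ↦ TM n x) x₀) (R := ℝ) (b := y') ⟨h2, h1⟩ w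
  refine Eq.trans ?_ h3.symm
  refine (Trivialization.continuousLinearMapAt_apply_of_mem ℝ _ h1 _).trans ?_
  refine congrArg (fun v : TM n y' ↦ (trivializationAt (ModelR n) (fun x : M ↦ TM n x) x₀ ⟨y', v⟩).2) ?_
  exact Trivialization.symmL_apply _ h2 w

end ConjL

/-! ### The projection, the section Φ and the one-form P in a frame. -/

section Coordinates

variable {n : ℕ} {M : Type*} [TopologicalSpace M]
  [ChartedSpace (EuclideanSpace ℝ (Fin (2 * n))) M] [IsManifold (𝓡 (2 * n)) ∞ M]
  {om : SymplecticForm n M}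

/-- The canonical section `Φ` in the preferred trivialization of `TM` at `x₀`. -/
def frameJ (x₀ : M) (z : TwistorSpace om) : ModelR n →L[ℝ] ModelR n :=
  conjL x₀ (twistorProj z) (twistorPhi z)

/-- The projection to `M` in the preferred chart at `x₀`. -/
def projChart (x₀ : M) (z : TwistorSpace om) : ModelR n :=
  extChartAt (𝓡 (2 * n)) x₀ (twistorProj z)

theorem continuous_twistorProj : Continuous (twistorProj (om := om)) :=
  (FiberBundle.continuous_proj (ModelR n →L[ℝ] ModelR n)
    (fun x : M ↦ TM n x →L[ℝ] TM n x)).comp continuous_subtype_val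

theorem eventually_twistorProj_mem {x₀ : M} {z : TwistorSpace om}
    (hz : twistorProj z ∈ frameDom n x₀) : ∀ᶠ z' in 𝓝 z, twistorProj z' ∈ frameDom n x₀ :=
  continuous_twistorProj.continuousAt.eventually_mem (frameDom_mem_nhds hz)

theorem frameJ_comp_frameJ {x₀ : M} {z : TwistorSpace om} (hz : twistorProj z ∈ frameDom n x₀) :
    frameJ x₀ z ∘L frameJ x₀ z = -ContinuousLinearMap.id ℝ (ModelR n) := by
  rw [frameJ, ← conjL_comp hz]
  ext1 w
  have h : twistorPhi z (twistorPhi z (frameSymmL x₀ (twistorProj z) w)) = 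
    -frameSymmL x₀ (twistorProj z) w := z.2.sq _
  simp [conjL_apply, h, frameL_symm hz]

theorem frameForm_frameJ {x₀ : M} {z : TwistorSpace om} (hz : twistorProj z ∈ frameDom n x₀)
    (a b : ModelR n) : frameForm om x₀ (twistorProj z) (frameJ x₀ z a) (frameJ x₀ z b) =
      frameForm om x₀ (twistorProj z) a b := by
  rw [frameJ, conjL_apply, conjL_apply, frameForm_frameL hz]
  exact z.2.inv _ _

variable [ChartedSpace (EuclideanSpace ℝ (Fin (n * (n + 3)))) (TwistorSpace om)]
  [IsTwistorManifold om]

theorem contMDiffAt_frameJ {x₀ : M} {z : TwistorSpace om} (hz : twistorProj z ∈ frameDom n x₀) :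
    ContMDiffAt (𝓡 (n * (n + 3))) 𝓘(ℝ, ModelR n →L[ℝ] ModelR n) ∞ (frameJ (om := om) x₀) z := by
  have h := (IsTwistorManifold.contMDiff_incl (om := om)) z
  have hs : z.1 ∈ (trivializationAt (ModelR n →L[ℝ] ModelR n)
      (fun x : M ↦ TM n x →L[ℝ] TM n x) x₀).source :=
    (Trivialization.mem_source _).2 (mem_baseSet_end hz)
  exact ((Trivialization.contMDiffAt_iff hs).1 h).2

theorem contMDiff_twistorProj :
    ContMDiff (𝓡 (n * (n + 3))) (𝓡 (2 * n)) ∞ (twistorProj (om := om)) := fun z ↦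
  (contMDiffAt_totalSpace.1 ((IsTwistorManifold.contMDiff_incl (om := om)) z)).1

theorem contMDiffAt_projChart {x₀ : M} {z : TwistorSpace om}
    (hz : twistorProj z ∈ frameDom n x₀) :
    ContMDiffAt (𝓡 (n * (n + 3))) 𝓘(ℝ, ModelR n) ∞ (projChart (om := om) x₀) z :=
  (contMDiffAt_frameChart hz).comp z (contMDiff_twistorProj z)

theorem frameL_dProj {x₀ : M} {z : TwistorSpace om} (hz : twistorProj z ∈ frameDom n x₀)
    (ξ : TZ z) : frameL x₀ (twistorProj z) (dProj z ξ) =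
      mvfderiv (𝓡 (n * (n + 3))) (projChart (om := om) x₀) z ξ := by
  rw [frameL_eq_mvfderiv hz]
  exact (mvfderiv_comp_mfderiv ((contMDiffAt_frameChart hz).mdifferentiableAt (by simp))
    ((contMDiff_twistorProj z).mdifferentiableAt (by simp)) ξ).symm

omit [IsTwistorManifold om] in
theorem conjL_coordDerivEnd
    (A : Π z : TwistorSpace om, TM n (twistorProj z) →L[ℝ] TM n (twistorProj z))
    (z : TwistorSpace om) (ξ : TZ z) :
    conjL (twistorProj z) (twistorProj z) (coordDerivEnd A z ξ) =
      mvfderiv (𝓡 (n * (n + 3))) (fun z' ↦ conjL (twistorProj z) (twistorProj z') (A z')) z ξ :=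
  conjL_symmL (mem_frameDom _) _

omit [IsTwistorManifold om] in
theorem frameL_coordDeriv (s : Π z : TwistorSpace om, TM n (twistorProj z))
    (z : TwistorSpace om) (ξ : TZ z) :
    frameL (twistorProj z) (twistorProj z) (coordDeriv s z ξ) =
      mvfderiv (𝓡 (n * (n + 3))) (fun z' ↦ frameL (twistorProj z) (twistorProj z') (s z')) z ξ := by
  have he : (fun z' ↦ (trivializationAt (ModelR n) (fun x : M ↦ TM n x) (twistorProj z)
      ⟨twistorProj z', s z'⟩).2) =ᶠ[𝓝 z]
        fun z' ↦ frameL (twistorProj z) (twistorProj z') (s z') := by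
    filter_upwards [eventually_twistorProj_mem (mem_frameDom (n := n) (twistorProj z))] with z' hz'
    exact (Trivialization.continuousLinearMapAt_apply_of_mem ℝ _ hz' _).symm
  rw [← he.mvfderiv_eq]
  exact frameL_symm (mem_frameDom _) _

/-- The gauge law for connection forms, with the transition kept as a right factor so that it need
not be inverted. -/
theorem conjL_connForm (nab : LinConnection n M) {x₀ y : M} (hy : y ∈ frameDom n x₀) (u : TM n y) :
    conjL x₀ y (connForm nab y u) ∘L frameTrans x₀ y y =
      mvfderiv (𝓡 (2 * n)) (frameTrans (n := n) x₀ y) y u +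
      christoffel nab x₀ y (frameL x₀ y u) ∘L frameTrans x₀ y y := by
  ext1 w
  have h := frameL_connForm nab hy u (frameSymmL y y w)
  have h1 : (fun y' ↦ frameL x₀ y' (constField y (frameSymmL y y w) y')) =
      fun y' ↦ frameTrans x₀ y y' w := by
    funext y'
    simp only [constField, frameTrans]
    exact congrArg (fun w ↦ frameL x₀ y' (frameSymmL y y' w)) (frameL_symm (mem_frameDom y) w)
  rw [h1, mvfderiv_clmApply (mdifferentiableAt_frameTrans hy) mdifferentiableAt_const,
    mvfderiv_const] at h
  simp only [zero_apply, ContinuousLinearMap.map_zero, add_zero] at h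
  simp only [ContinuousLinearMap.comp_apply, add_apply, frameTrans, conjL_frameL hy]
  exact h

/-- `pullCovEnd` at `z` uses the frame centred at π(z), which moves with `z`; to differentiate P it
is needed in a fixed frame. The two expressions of `A` are intertwined by the transition `h`;
differentiate this relation and insert the gauge law for Γ. -/
theorem conjL_pullCovEnd (nab : LinConnection n M) {x₀ : M} {z : TwistorSpace om}
    (hz : twistorProj z ∈ frameDom n x₀)
    {A : Π z : TwistorSpace om, TM n (twistorProj z) →L[ℝ] TM n (twistorProj z)}
    (hA : MDifferentiableAt (𝓡 (n * (n + 3))) 𝓘(ℝ, ModelR n →L[ℝ] ModelR n)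
      (fun z' ↦ conjL x₀ (twistorProj z') (A z')) z)
    (hA' : MDifferentiableAt (𝓡 (n * (n + 3))) 𝓘(ℝ, ModelR n →L[ℝ] ModelR n)
      (fun z' ↦ conjL (twistorProj z) (twistorProj z') (A z')) z) (ξ : TZ z) :
    conjL x₀ (twistorProj z) (pullCovEnd nab A z ξ) =
      mvfderiv (𝓡 (n * (n + 3))) (fun z' ↦ conjL x₀ (twistorProj z') (A z')) z ξ +
      (christoffel nab x₀ (twistorProj z) (frameL x₀ _ (dProj z ξ)) ∘L conjL x₀ _ (A z) -
        conjL x₀ _ (A z) ∘L christoffel nab x₀ (twistorProj z) (frameL x₀ _ (dProj z ξ))) := by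
  set y := twistorProj z with hy
  set h : TwistorSpace om → ModelR n →L[ℝ] ModelR n := fun z' ↦ frameTrans x₀ y (twistorProj z')
  have hhd : MDifferentiableAt (𝓡 (n * (n + 3))) 𝓘(ℝ, ModelR n →L[ℝ] ModelR n) h z :=
    (mdifferentiableAt_frameTrans hz).comp z ((contMDiff_twistorProj z).mdifferentiableAt (by simp))
  have hdh : mvfderiv (𝓡 (n * (n + 3))) h z ξ =
      mvfderiv (𝓡 (2 * n)) (frameTrans (n := n) x₀ y) y (dProj z ξ) :=
    mvfderiv_comp_mfderiv (mdifferentiableAt_frameTrans hz)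
      ((contMDiff_twistorProj z).mdifferentiableAt (by simp)) ξ
  have heq : (fun z' ↦ h z' ∘L conjL y (twistorProj z') (A z')) =ᶠ[𝓝 z]
      fun z' ↦ conjL x₀ (twistorProj z') (A z') ∘L h z' := by
    filter_upwards [eventually_twistorProj_mem hz,
      eventually_twistorProj_mem (mem_frameDom (n := n) (twistorProj z))] with z' h1 h2
    ext1 w
    simp only [h, frameTrans, ContinuousLinearMap.comp_apply, conjL_apply, frameSymmL_frameL h1,
      frameSymmL_frameL h2, y]
  have hd := congrArg (fun L ↦ L ξ) heq.mvfderiv_eq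
  simp only [] at hd
  rw [mvfderiv_clmComp hhd hA', mvfderiv_clmComp hA hhd, hdh, ← conjL_coordDerivEnd] at hd
  have hc := conjL_connForm nab hz (dProj z ξ)
  -- As the transition is onto, it is enough to compare both sides after composing with it.
  have hinj : Function.Surjective (h z) := fun w ↦ ⟨frameL y y (frameSymmL x₀ y w),
    (congrArg (frameL x₀ y) (frameSymmL_frameL (mem_frameDom y) _)).trans (frameL_symm hz w)⟩
  have hcd : conjL x₀ y (coordDerivEnd A z ξ) ∘L h z = h z ∘L conjL y y (coordDerivEnd A z ξ) := by
    ext1 w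
    exact (conjL_frameL hz _ _).trans
      (congrArg (frameL x₀ y) (frameSymmL_frameL (mem_frameDom y) _)).symm
  have hAh : h z ∘L conjL y y (A z) = conjL x₀ y (A z) ∘L h z := heq.self_of_nhds
  rw [pullCovEnd, conjL_add, conjL_sub, conjL_comp hz, conjL_comp hz]
  ext1 w
  obtain ⟨w, rfl⟩ := hinj w
  have e1 := DFunLike.congr_fun hd w
  have e2 := fun w ↦ DFunLike.congr_fun hc w
  have e3 := DFunLike.congr_fun hcd w
  have e4 := DFunLike.congr_fun hAh w
  simp only [ContinuousLinearMap.comp_apply, add_apply, sub_apply] at e1 e2 e3 e4 ⊢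
  have e5 : conjL x₀ y (connForm nab y (dProj z ξ)) (conjL x₀ y (A z) (h z w)) =
    (mvfderiv (𝓡 (2 * n)) (frameTrans (n := n) x₀ y) y (dProj z ξ)) (conjL y y (A z) w) +
      christoffel nab x₀ y (frameL x₀ y (dProj z ξ)) (conjL x₀ y (A z) (h z w)) := by
    rw [← e4]; exact e2 _
  have e6 := e2 w
  have e7 : conjL x₀ y (connForm nab y (dProj z ξ)) (h z w) = _ := e6
  rw [e3, e5, e7, ContinuousLinearMap.map_add]
  have e8 : (mvfderiv (𝓡 (2 * n)) (frameTrans (n := n) x₀ y) y (dProj z ξ)) (conjL y y (A z) w) +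
    h z (conjL y y (coordDerivEnd A z ξ) w) = mvfderiv (𝓡 (n * (n + 3))) (fun z' ↦ conjL x₀ (twistorProj z') (A z')) z ξ (h z w) + conjL x₀ y (A z) ((mvfderiv (𝓡 (2 * n)) (frameTrans (n := n) x₀ y) y (dProj z ξ)) w) := e1
  have e9 : frameTrans x₀ y y w = h z w := rfl
  rw [e9, eq_sub_of_add_eq' e8]
  abel

/-- The one-form `P` in the preferred trivialization of `TM` at `x₀`. -/
theorem conjL_twistorP (nab : LinConnection n M) {x₀ : M} {z : TwistorSpace om}
    (hz : twistorProj z ∈ frameDom n x₀) (ξ : TZ z) :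
    conjL x₀ (twistorProj z) (twistorP nab z ξ) = -(1 / 2 : ℝ) •
      ((mvfderiv (𝓡 (n * (n + 3))) (frameJ x₀) z ξ +
      (christoffel nab x₀ (twistorProj z) (frameL x₀ _ (dProj z ξ)) ∘L frameJ x₀ z -
        frameJ x₀ z ∘L christoffel nab x₀ (twistorProj z) (frameL x₀ _ (dProj z ξ)))) ∘L
          frameJ x₀ z) := by
  rw [twistorP, conjL_smul, conjL_comp hz, conjL_pullCovEnd nab hz
    ((contMDiffAt_frameJ hz).mdifferentiableAt (by simp))
    ((contMDiffAt_frameJ (mem_frameDom _)).mdifferentiableAt (by simp))]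
  rfl

end Coordinates

/-! ### Linear algebra of compatible complex structures. -/

section LinearAlgebra

theorem LinearMap.trace_matrix_eq_sum {m : Type*} [Fintype m] [DecidableEq m]
    (f : Matrix m m ℝ →ₗ[ℝ] Matrix m m ℝ) :
    LinearMap.trace ℝ _ f = ∑ i, ∑ j, f (Matrix.single i j 1) i j := by
  rw [LinearMap.trace_eq_matrix_trace ℝ (Matrix.stdBasis ℝ m m), Matrix.trace,
    Fintype.sum_prod_type]
  refine Finset.sum_congr rfl fun i _ ↦ Finset.sum_congr rfl fun j _ ↦ ?_
  rw [Matrix.diag_apply, LinearMap.toMatrix_apply, Matrix.stdBasis_eq_single]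
  simp [Matrix.stdBasis]

theorem exists_basis_orthonormal {V : Type*} [AddCommGroup V] [Module ℝ V] [FiniteDimensional ℝ V]
    (G : V → V → ℝ) (hadd : ∀ u v w, G (u + v) w = G u w + G v w)
    (hsmul : ∀ (c : ℝ) u v, G (c • u) v = c * G u v) (hsymm : ∀ u v, G u v = G v u)
    (hpos : ∀ v, v ≠ 0 → 0 < G v v) {m : ℕ} (hm : finrank ℝ V = m) :
    ∃ b : Basis (Fin m) ℝ V, ∀ i j, G (b i) (b j) = if i = j then 1 else 0 := by
  have h0 : ∀ v, G 0 v = 0 := fun v ↦ by simpa using hsmul 0 0 v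
  let core : InnerProductSpace.Core ℝ V :=
    { inner := G
      conj_inner_symm := fun u v ↦ hsymm v u
      re_inner_nonneg := fun v ↦ by
        by_cases hv : v = 0
        · simp [hv, h0]
        · exact (hpos v hv).le
      add_left := hadd
      smul_left := fun u v c ↦ hsmul c u v
      definite := fun v hv ↦ by
        by_contra h
        exact (hpos v h).ne' hv }
  let _ : NormedAddCommGroup V := core.toNormedAddCommGroup
  let _ : InnerProductSpace ℝ V := InnerProductSpace.ofCore core.toCore
  refine ⟨((stdOrthonormalBasis ℝ V).reindex (finCongr hm)).toBasis, fun i j ↦ ?_⟩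
  have h := orthonormal_iff_ite.1 ((stdOrthonormalBasis ℝ V).reindex (finCongr hm)).orthonormal i j
  rw [OrthonormalBasis.coe_toBasis]
  exact h

/-- The symmetric matrices anticommuting with `J`. -/
def antiSymmSubmodule {m : Type*} [Fintype m] (J : Matrix m m ℝ) :
    Submodule ℝ (Matrix m m ℝ) where
  carrier := {A | A.transpose = A ∧ A * J = -(J * A)}
  add_mem' := by
    rintro A B ⟨h1, h2⟩ ⟨h3, h4⟩
    exact ⟨by rw [Matrix.transpose_add, h1, h3], by rw [add_mul, mul_add, h2, h4, neg_add]⟩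
  zero_mem' := by simp
  smul_mem' := by
    rintro c A ⟨h1, h2⟩
    exact ⟨by rw [Matrix.transpose_smul, h1], by simp [h2]⟩

/-- The projection of matrices to `antiSymmSubmodule J`. -/
def antiSymmProj {m : Type*} [Fintype m] (J : Matrix m m ℝ) :
    Matrix m m ℝ →ₗ[ℝ] Matrix m m ℝ where
  toFun A := (1 / 4 : ℝ) • (A + A.transpose + (J * A * J + J * A.transpose * J))
  map_add' A B := by
    rw [← smul_add]; congr 1; simp only [Matrix.transpose_add, mul_add, add_mul]; abel
  map_smul' c A := by
    simp only [Matrix.transpose_smul, Matrix.mul_smul, Matrix.smul_mul, ← smul_add,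
      RingHom.id_apply]
    rw [smul_comm]

/-- The dimension is the trace of the projector `antiSymmProj`. Its diagonal entry at (i, j) is ¼(1
+ δ_ij + J_ii J_jj + J_ij²); the product of diagonal entries vanishes as J is skew, and Σ J_ij² =
-Tr J² = m, so the sum is ¼(m² + m + m). -/
theorem finrank_antiSymmSubmodule {m : Type*} [Fintype m] [DecidableEq m] {J : Matrix m m ℝ}
    (hJ : J * J = -1) (hJt : J.transpose = -J) :
    4 * finrank ℝ (antiSymmSubmodule J) = Fintype.card m ^ 2 + 2 * Fintype.card m := by
  have hp : LinearMap.IsProj (antiSymmSubmodule J) (antiSymmProj J) := by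
    refine ⟨fun A ↦ ?_, fun A hA ↦ ?_⟩
    · have e1 : ∀ B : Matrix m m ℝ, J * (J * B) = -B := fun B ↦ by rw [← mul_assoc, hJ]; simp
      constructor
      · simp only [antiSymmProj, LinearMap.coe_mk, AddHom.coe_mk, Matrix.transpose_smul,
          Matrix.transpose_add, Matrix.transpose_mul, Matrix.transpose_transpose, hJt]
        congr 1
        simp only [neg_mul, mul_neg, neg_neg, mul_assoc]
        abel
      · simp only [antiSymmProj, LinearMap.coe_mk, AddHom.coe_mk, Matrix.smul_mul, Matrix.mul_smul,
          ← smul_neg]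
        congr 1
        simp only [add_mul, mul_add, mul_assoc, hJ, e1, mul_neg, mul_one]
        abel
    · obtain ⟨h1, h2⟩ := hA
      simp only [antiSymmProj, LinearMap.coe_mk, AddHom.coe_mk, h1]
      have : J * A * J = A := by rw [mul_assoc, h2, mul_neg, ← mul_assoc, hJ]; simp
      rw [this]
      ext i j
      simp; ring
  have htr := hp.trace
  rw [LinearMap.trace_matrix_eq_sum] at htr
  have hd : ∀ i, J i i = 0 := fun i ↦ by
    have := congrFun (congrFun hJt i) i
    simp at this
    linarith
  have hval : ∀ i j : m, antiSymmProj J (Matrix.single i j 1) i j =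
      (1 / 4 : ℝ) * (1 + (if i = j then 1 else 0) + J i j * J i j) := fun i j ↦ by
    have a1 : (J * (Matrix.single i j (1 : ℝ) : Matrix m m ℝ) * J) i j = J i i * J j j := by
      simp [Matrix.mul_apply, Matrix.single_apply, ite_and]
    have a2 : (J * (Matrix.single j i (1 : ℝ) : Matrix m m ℝ) * J) i j = J i j * J i j := by
      simp [Matrix.mul_apply, Matrix.single_apply, ite_and]
    simp only [antiSymmProj, LinearMap.coe_mk, AddHom.coe_mk, Matrix.smul_apply, Matrix.add_apply,
      Matrix.transpose_single, a1, a2, hd]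
    simp [Matrix.single_apply, eq_comm]
  have hJJ : ∑ i, ∑ j, J i j * J i j = Fintype.card m := by
    have h := congrArg Matrix.trace hJ
    rw [Matrix.trace_neg, Matrix.trace_one] at h
    simp only [Matrix.trace, Matrix.diag_apply, Matrix.mul_apply] at h
    rw [← neg_inj, ← h, ← Finset.sum_neg_distrib]
    refine Finset.sum_congr rfl fun i _ ↦ ?_
    rw [← Finset.sum_neg_distrib]
    refine Finset.sum_congr rfl fun j _ ↦ ?_
    have := congrFun (congrFun hJt j) i
    simp at this
    rw [this]; ring
  simp only [hval, ← Finset.mul_sum, Finset.sum_add_distrib] at htr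
  rw [hJJ] at htr
  simp at htr
  have : (4 * finrank ℝ (antiSymmSubmodule J) : ℝ) = (Fintype.card m ^ 2 + 2 * Fintype.card m : ℝ) := by
    rw [← htr]; ring
  exact_mod_cast this

variable {V : Type*} [NormedAddCommGroup V] [NormedSpace ℝ V]

/-- The endomorphisms in `sp(V, Ω)` which anticommute with `J`. -/
def antiSp (Om : V →L[ℝ] V →L[ℝ] ℝ) (J : V →L[ℝ] V) : Submodule ℝ (V →L[ℝ] V) where
  carrier := {A | (∀ a b, Om (A a) b + Om a (A b) = 0) ∧ ∀ a, A (J a) = -J (A a)}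
  add_mem' := by
    rintro A B ⟨h1, h2⟩ ⟨h3, h4⟩
    refine ⟨fun a b ↦ ?_, fun a ↦ ?_⟩
    · simp only [add_apply, map_add]
      linear_combination h1 a b + h3 a b
    · simp only [add_apply, map_add, h2, h4]; abel
  zero_mem' := by simp
  smul_mem' := by
    rintro c A ⟨h1, h2⟩
    refine ⟨fun a b ↦ ?_, fun a ↦ by simp [h2]⟩
    simp only [smul_apply, map_smul, smul_eq_mul]
    linear_combination c * h1 a b

/-- `J` is a complex structure compatible with the bilinear form `Ω`. -/
structure CompatibleStr (Om : V →L[ℝ] V →L[ℝ] ℝ) (J : V →L[ℝ] V) : Prop where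
  alt : ∀ a, Om a a = 0
  sq : ∀ v, J (J v) = -v
  inv : ∀ u v, Om (J u) (J v) = Om u v
  pos : ∀ v, v ≠ 0 → 0 < Om v (J v)

variable {Om : V →L[ℝ] V →L[ℝ] ℝ} {J : V →L[ℝ] V}

theorem CompatibleStr.skew (h : CompatibleStr Om J) (a b : V) : Om a b = -Om b a := by
  have h1 := h.alt (a + b)
  simp only [map_add, add_apply, h.alt] at h1
  linarith

theorem CompatibleStr.symm (h : CompatibleStr Om J) (a b : V) : Om a (J b) = Om b (J a) := by
  rw [← h.inv, h.sq, map_neg, h.skew]; simp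

theorem CompatibleStr.left (h : CompatibleStr Om J) (a b : V) : Om (J a) b = -Om a (J b) := by
  rw [h.skew, h.symm]

theorem CompatibleStr.nondegenerate (h : CompatibleStr Om J) {a : V} (ha : ∀ b, Om a (J b) = 0) :
    a = 0 := by
  by_contra hne
  exact (h.pos a hne).ne' (ha a)

theorem mul_left_mem_antiSp (h : CompatibleStr Om J) {A : V →L[ℝ] V} (hA : A ∈ antiSp Om J) :
    J ∘L A ∈ antiSp Om J := by
  refine ⟨fun a b ↦ ?_, fun a ↦ ?_⟩
  · have := hA.1 a (J b)
    simp only [ContinuousLinearMap.comp_apply, h.left]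
    rw [hA.2 b] at this
    simp only [map_neg] at this
    linarith
  · simp [hA.2]

/-- The part anticommuting with `J` of an element of `sp(V, Ω)`. -/
theorem half_add_mem_antiSp (h : CompatibleStr Om J) {R : V →L[ℝ] V}
    (hR : ∀ a b, Om (R a) b + Om a (R b) = 0) :
    (1 / 2 : ℝ) • (R + J ∘L R ∘L J) ∈ antiSp Om J := by
  refine Submodule.smul_mem _ _ ⟨fun a b ↦ ?_, fun a ↦ ?_⟩
  · have h1 := hR (J a) (J b)
    simp only [add_apply, ContinuousLinearMap.comp_apply, map_add, h.left]
    have h3 : Om (R (J a)) (J b) = -Om (J a) (R (J b)) := by linarith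
    rw [h3, h.left]
    linarith [hR a b]
  · simp only [add_apply, ContinuousLinearMap.comp_apply, map_add, h.sq, map_neg]
    abel

/-- `D` stands for the covariant derivative of `J`: the two hypotheses are the derivatives of J² =
-1 and of Ω(J·, J·) = Ω, and the endomorphism in the conclusion is P. -/
theorem neg_half_mem_antiSp (h : CompatibleStr Om J) {D : V →L[ℝ] V}
    (hDJ : ∀ a, D (J a) = -J (D a)) (hD : ∀ a b, Om (D a) (J b) + Om (J a) (D b) = 0) :
    -(1 / 2 : ℝ) • (D ∘L J) ∈ antiSp Om J := by
  refine Submodule.smul_mem _ _ ⟨fun a b ↦ ?_, fun a ↦ ?_⟩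
  · have h1 := hD (J a) (J b)
    simp only [h.sq, map_neg, neg_apply] at h1
    simp only [ContinuousLinearMap.comp_apply]
    linarith
  · simp only [ContinuousLinearMap.comp_apply, h.sq, map_neg]
    rw [hDJ a, map_neg, h.sq]; simp

variable [FiniteDimensional ℝ V]

/-- The trace, as a continuous linear form. -/
def traceL (V : Type*) [NormedAddCommGroup V] [NormedSpace ℝ V] [FiniteDimensional ℝ V] :
    (V →L[ℝ] V) →L[ℝ] ℝ :=
  LinearMap.toContinuousLinearMap
    ((LinearMap.trace ℝ V) ∘ₗ (LinearMap.toContinuousLinearMap (𝕜 := ℝ) (E := V) (F' := V)).symm.toLinearMap)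

theorem traceL_apply (A : V →L[ℝ] V) : traceL V A = LinearMap.trace ℝ V (A : V →ₗ[ℝ] V) := rfl

theorem traceL_comp_comm (A B : V →L[ℝ] V) : traceL V (A ∘L B) = traceL V (B ∘L A) :=
  LinearMap.trace_mul_comm ℝ (A : V →ₗ[ℝ] V) (B : V →ₗ[ℝ] V)

/-- The matrix of a continuous linear map. -/
def matrixL {m : ℕ} (b : Basis (Fin m) ℝ V) : (V →L[ℝ] V) ≃ₗ[ℝ] Matrix (Fin m) (Fin m) ℝ :=
  (LinearMap.toContinuousLinearMap (𝕜 := ℝ) (E := V) (F' := V)).symm.trans (LinearMap.toMatrix b b)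

theorem matrixL_comp {m : ℕ} (b : Basis (Fin m) ℝ V) (A B : V →L[ℝ] V) :
    matrixL b (A ∘L B) = matrixL b A * matrixL b B :=
  LinearMap.toMatrix_mul b (A : V →ₗ[ℝ] V) (B : V →ₗ[ℝ] V)

theorem trace_matrixL {m : ℕ} (b : Basis (Fin m) ℝ V) (A : V →L[ℝ] V) :
    (matrixL b A).trace = traceL V A :=
  (LinearMap.trace_eq_matrix_trace ℝ b (A : V →ₗ[ℝ] V)).symm

theorem CompatibleStr.exists_basis (h : CompatibleStr Om J) {m : ℕ} (hm : finrank ℝ V = m) :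
    ∃ b : Basis (Fin m) ℝ V, ∀ i j, Om (b i) (J (b j)) = if i = j then 1 else 0 :=
  exists_basis_orthonormal (fun u v ↦ Om u (J v)) (by simp) (by simp) h.symm h.pos hm

theorem matrixL_apply_eq {m : ℕ} {b : Basis (Fin m) ℝ V}
    (hb : ∀ i j, Om (b i) (J (b j)) = if i = j then 1 else 0)
    (A : V →L[ℝ] V) (i j : Fin m) : matrixL b A i j = Om (A (b j)) (J (b i)) := by
  have h1 : matrixL b A i j = b.repr (A (b j)) i := LinearMap.toMatrix_apply ..
  have h2 := b.sum_repr (A (b j))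
  rw [h1]
  conv_rhs => rw [← h2]
  simp only [map_sum, map_smul, sum_apply, smul_apply, hb, smul_eq_mul]
  simp

/-- For endomorphisms anticommuting with `J`, being in sp is the same as being self-adjoint for Ω(·,
J·), hence as having a symmetric matrix in an orthonormal basis. -/
theorem mem_antiSp_iff {m : ℕ} {b : Basis (Fin m) ℝ V}
    (hb : ∀ i j, Om (b i) (J (b j)) = if i = j then 1 else 0) (h : CompatibleStr Om J)
    (A : V →L[ℝ] V) : A ∈ antiSp Om J ↔ matrixL b A ∈ antiSymmSubmodule (matrixL b J) := by
  have h2 : (∀ a, A (J a) = -J (A a)) ↔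
      matrixL b A * matrixL b J = -(matrixL b J * matrixL b A) := by
    rw [← matrixL_comp, ← matrixL_comp, ← map_neg, (matrixL b).injective.eq_iff]
    exact ⟨fun h ↦ by ext1 a; simpa using h a, fun h a ↦ by simpa using DFunLike.congr_fun h a⟩
  have h1 : (∀ a, A (J a) = -J (A a)) → ((∀ a b, Om (A a) b + Om a (A b) = 0) ↔
      (matrixL b A).transpose = matrixL b A) := by
    intro hJ
    have h3 : (∀ a b, Om (A a) b + Om a (A b) = 0) ↔ ∀ a c, Om (A a) (J c) = Om a (J (A c)) := by
      constructor
      · intro h4 a c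
        have := h4 a (J c)
        rw [hJ, map_neg] at this
        linarith
      · intro h4 a c
        have := h4 a (J c)
        rw [h.sq, ← neg_eq_iff_eq_neg.2 (hJ (J c)), h.sq] at this
        simp only [map_neg] at this
        linarith
    rw [h3]
    constructor
    · intro h4
      ext i j
      rw [Matrix.transpose_apply, matrixL_apply_eq hb, matrixL_apply_eq hb, h4, h.symm]
    · intro h4 a c
      have h5 : ∀ i j, Om (A (b i)) (J (b j)) = Om (b i) (J (A (b j))) := fun i j ↦ by
        have := congrFun (congrFun h4 i) j
        rw [Matrix.transpose_apply, matrixL_apply_eq hb, matrixL_apply_eq hb,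
          h.symm (A (b j))] at this
        exact this
      rw [← b.sum_repr a, ← b.sum_repr c]
      simp only [map_sum, map_smul, sum_apply, smul_apply, h5]
  constructor
  · rintro ⟨ha, hc⟩
    exact ⟨(h1 hc).1 ha, h2.1 hc⟩
  · rintro ⟨ha, hc⟩
    exact ⟨(h1 (h2.2 hc)).2 ha, h2.2 hc⟩

/-- In an orthonormal basis of Ω(·, J·) the matrix of J is skew with square -1, so four times the
dimension is (2n)² + 2(2n). -/
theorem finrank_antiSp (h : CompatibleStr Om J) {n : ℕ} (hn : finrank ℝ V = 2 * n) :
    finrank ℝ (antiSp Om J) = n * (n + 1) := by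
  obtain ⟨b, hb⟩ := h.exists_basis hn
  have hmap : antiSp Om J = (antiSymmSubmodule (matrixL b J)).comap (matrixL b).toLinearMap := by
    ext A
    exact mem_antiSp_iff hb h A
  have hfr : finrank ℝ (antiSp Om J) = finrank ℝ (antiSymmSubmodule (matrixL b J)) := by
    rw [hmap]
    rw [Submodule.comap_equiv_eq_map_symm]
    exact LinearEquiv.finrank_map_eq _ _
  have hJ : matrixL b J * matrixL b J = -1 := by
    rw [← matrixL_comp]
    have : J ∘L J = -ContinuousLinearMap.id ℝ V := by ext1 v; simp [h.sq]
    rw [this, map_neg]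
    congr 1
    exact LinearMap.toMatrix_id b
  have hJt : (matrixL b J).transpose = -matrixL b J := by
    ext i j
    rw [Matrix.transpose_apply, Matrix.neg_apply, matrixL_apply_eq hb, matrixL_apply_eq hb,
      h.inv, h.inv, h.skew]
  have := finrank_antiSymmSubmodule hJ hJt
  rw [hfr]
  simp only [Fintype.card_fin] at this
  nlinarith

/-- The matrix of A in an orthonormal basis is symmetric, so Tr A² = Tr AᵀA is a sum of squares. -/
theorem eq_zero_of_traceL_comp_self (h : CompatibleStr Om J) {A : V →L[ℝ] V}
    (hA : A ∈ antiSp Om J) (htr : traceL V (A ∘L A) = 0) : A = 0 := by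
  obtain ⟨b, hb⟩ := h.exists_basis rfl
  have h1 := ((mem_antiSp_iff hb h A).1 hA).1
  rw [← trace_matrixL b, matrixL_comp] at htr
  have h3 : matrixL b A = 0 := Matrix.trace_conjTranspose_mul_self_eq_zero_iff.1 (by
    rw [Matrix.conjTranspose_eq_transpose_of_trivial, h1, htr])
  exact (matrixL b).map_eq_zero_iff.1 h3

end LinearAlgebra

/-! ### The isomorphism (π_*, P) from the tangent spaces of 𝒵⁰ to E ⊕ 𝒱. -/

section Splitting

variable {n : ℕ} {M : Type*} [TopologicalSpace M]
  [ChartedSpace (EuclideanSpace ℝ (Fin (2 * n))) M] [IsManifold (𝓡 (2 * n)) ∞ M]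
  {om : SymplecticForm n M}

theorem compatibleStr_frame {x₀ : M} {z : TwistorSpace om} (hz : twistorProj z ∈ frameDom n x₀) :
    CompatibleStr (frameForm om x₀ (twistorProj z)) (frameJ x₀ z) where
  alt a := om.alt _ _
  sq v := DFunLike.congr_fun (frameJ_comp_frameJ hz) v
  inv := frameForm_frameJ hz
  pos v hv := by
    rw [frameForm_apply, frameJ, conjL_apply, frameSymmL_frameL hz]
    refine z.2.pos _ fun h ↦ hv ?_
    exact (frameL_symm hz v).symm.trans ((congrArg (frameL x₀ _) h).trans (ContinuousLinearMap.map_zero _))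

/-- The space `{A ∈ sp(T_x M, ω) : A j = - j A}`. -/
def vertSpace (z : TwistorSpace om) :
    Submodule ℝ (TM n (twistorProj z) →L[ℝ] TM n (twistorProj z)) where
  carrier := {A | (∀ a b, om.form _ (A a) b + om.form _ a (A b) = 0) ∧
    ∀ a, A (twistorPhi z a) = -twistorPhi z (A a)}
  add_mem' := by
    rintro A B ⟨h1, h2⟩ ⟨h3, h4⟩
    refine ⟨fun a b ↦ ?_, fun a ↦ ?_⟩
    · simp only [add_apply, ContinuousLinearMap.map_add]
      linear_combination h1 a b + h3 a b
    · simp only [add_apply, ContinuousLinearMap.map_add, h2, h4]; abel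
  zero_mem' := by simp
  smul_mem' := by
    rintro c A ⟨h1, h2⟩
    refine ⟨fun a b ↦ ?_, fun a ↦ by simp [h2]⟩
    simp only [smul_apply, ContinuousLinearMap.map_smul, smul_eq_mul]
    linear_combination c * h1 a b

theorem conjL_mem_antiSp_iff {x₀ : M} {z : TwistorSpace om} (hz : twistorProj z ∈ frameDom n x₀)
    (A : TM n (twistorProj z) →L[ℝ] TM n (twistorProj z)) :
    conjL x₀ _ A ∈ antiSp (frameForm om x₀ (twistorProj z)) (frameJ x₀ z) ↔ A ∈ vertSpace z := by
  constructor
  · rintro ⟨h1, h2⟩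
    refine ⟨fun a b ↦ ?_, fun a ↦ ?_⟩
    · have := h1 (frameL x₀ _ a) (frameL x₀ _ b)
      rwa [conjL_frameL hz, conjL_frameL hz, frameForm_frameL hz, frameForm_frameL hz] at this
    · have := h2 (frameL x₀ _ a)
      rw [frameJ, conjL_frameL hz, conjL_frameL hz, conjL_frameL hz, conjL_frameL hz,
        ← ContinuousLinearMap.map_neg] at this
      exact frameL_injective hz this
  · rintro ⟨h1, h2⟩
    refine ⟨fun a b ↦ ?_, fun a ↦ ?_⟩
    · rw [← frameL_symm hz a, ← frameL_symm hz b, conjL_frameL hz, conjL_frameL hz,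
        frameForm_frameL hz, frameForm_frameL hz]
      exact h1 _ _
    · rw [← frameL_symm hz a, frameJ, conjL_frameL hz, conjL_frameL hz, conjL_frameL hz,
        conjL_frameL hz, h2, ContinuousLinearMap.map_neg]

variable [ChartedSpace (EuclideanSpace ℝ (Fin (n * (n + 3)))) (TwistorSpace om)]
  [IsTwistorManifold om] {nab : LinConnection n M}

/-- The covariant derivative of `Φ` in the preferred trivialization at `x₀`. -/
def frameDJ (nab : LinConnection n M) (x₀ : M) (z : TwistorSpace om) (ξ : TZ z) :
    ModelR n →L[ℝ] ModelR n :=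
  mvfderiv (𝓡 (n * (n + 3))) (frameJ x₀) z ξ +
      (christoffel nab x₀ (twistorProj z) (frameL x₀ _ (dProj z ξ)) ∘L frameJ x₀ z -
        frameJ x₀ z ∘L christoffel nab x₀ (twistorProj z) (frameL x₀ _ (dProj z ξ)))

theorem conjL_twistorP' {x₀ : M} {z : TwistorSpace om}
    (hz : twistorProj z ∈ frameDom n x₀) (ξ : TZ z) :
    conjL x₀ (twistorProj z) (twistorP nab z ξ) =
      -(1 / 2 : ℝ) • (frameDJ nab x₀ z ξ ∘L frameJ x₀ z) := conjL_twistorP nab hz ξ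

theorem mvfderiv_frameJ_anticomm {x₀ : M} {z : TwistorSpace om}
    (hz : twistorProj z ∈ frameDom n x₀) (ξ : TZ z) :
    mvfderiv (𝓡 (n * (n + 3))) (frameJ x₀) z ξ ∘L frameJ x₀ z +
      frameJ x₀ z ∘L mvfderiv (𝓡 (n * (n + 3))) (frameJ x₀) z ξ = 0 := by
  have hJ := (contMDiffAt_frameJ hz).mdifferentiableAt (by simp)
  have he : (fun z' ↦ frameJ x₀ z' ∘L frameJ x₀ z') =ᶠ[𝓝 z]
      fun _ ↦ -ContinuousLinearMap.id ℝ (ModelR n) := by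
    filter_upwards [eventually_twistorProj_mem hz] with z' hz'
    exact frameJ_comp_frameJ hz'
  rw [← mvfderiv_clmComp hJ hJ, he.mvfderiv_eq, mvfderiv_const, zero_apply]

/-- dJ anticommutes with J by differentiating J² = -1, and so does any commutator [Γ, J]. -/
theorem frameDJ_anticomm {x₀ : M} {z : TwistorSpace om}
    (hz : twistorProj z ∈ frameDom n x₀) (ξ : TZ z) (a : ModelR n) :
    frameDJ nab x₀ z ξ (frameJ x₀ z a) = -frameJ x₀ z (frameDJ nab x₀ z ξ a) := by
  have h := DFunLike.congr_fun (mvfderiv_frameJ_anticomm hz ξ) a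
  have hsq := (compatibleStr_frame hz).sq
  simp only [add_apply, ContinuousLinearMap.comp_apply, zero_apply] at h
  simp only [frameDJ, add_apply, sub_apply, ContinuousLinearMap.comp_apply,
    ContinuousLinearMap.map_add, ContinuousLinearMap.map_sub, hsq,
    ContinuousLinearMap.map_neg, eq_neg_of_add_eq_zero_left h]
  abel

/-- The endomorphism `Γ(π_* ξ)` in the preferred trivialization at `x₀`. -/
def frameGamma (nab : LinConnection n M) (x₀ : M) (z : TwistorSpace om) (ξ : TZ z) :
    ModelR n →L[ℝ] ModelR n :=
  christoffel nab x₀ (twistorProj z) (frameL x₀ _ (dProj z ξ))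

theorem mdifferentiableAt_frameForm_proj {x₀ : M} {z : TwistorSpace om}
    (hz : twistorProj z ∈ frameDom n x₀) :
    MDifferentiableAt (𝓡 (n * (n + 3))) 𝓘(ℝ, ModelR n →L[ℝ] ModelR n →L[ℝ] ℝ)
      (fun z : TwistorSpace om ↦ frameForm om x₀ (twistorProj z)) z :=
  ((contMDiffAt_frameForm (om := om) hz).mdifferentiableAt (by simp)).comp z
    ((contMDiff_twistorProj z).mdifferentiableAt (by simp))

theorem mvfderiv_frameForm_proj (hnab : IsSymplecticConnection om nab) {x₀ : M}
    {z : TwistorSpace om} (hz : twistorProj z ∈ frameDom n x₀) (ξ : TZ z) (a b : ModelR n) :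
    mvfderiv (𝓡 (n * (n + 3))) (fun z : TwistorSpace om ↦ frameForm om x₀ (twistorProj z)) z ξ a b =
      frameForm om x₀ (twistorProj z) (frameGamma nab x₀ z ξ a) b +
      frameForm om x₀ (twistorProj z) a (frameGamma nab x₀ z ξ b) := by
  rw [mvfderiv_comp_mfderiv ((contMDiffAt_frameForm (om := om) hz).mdifferentiableAt (by simp))
    ((contMDiff_twistorProj z).mdifferentiableAt (by simp))]
  exact mvfderiv_frameForm hnab hz _ a b

/-- Differentiate Ω(J a, J b) = Ω(a, b); the Γ-terms coming from ∇ω = 0 complete dJ to the covariant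
derivative of Φ. -/
theorem frameForm_frameDJ (hnab : IsSymplecticConnection om nab) {x₀ : M} {z : TwistorSpace om}
    (hz : twistorProj z ∈ frameDom n x₀) (ξ : TZ z) (a b : ModelR n) :
    frameForm om x₀ (twistorProj z) (frameDJ nab x₀ z ξ a) (frameJ x₀ z b) +
      frameForm om x₀ (twistorProj z) (frameJ x₀ z a) (frameDJ nab x₀ z ξ b) = 0 := by
  have hJ := (contMDiffAt_frameJ hz).mdifferentiableAt (by simp)
  have hO := mdifferentiableAt_frameForm_proj hz
  have hc : ∀ c : ModelR n, MDifferentiableAt (𝓡 (n * (n + 3))) 𝓘(ℝ, ModelR n)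
    (fun _ : TwistorSpace om ↦ c) z := fun c ↦ mdifferentiableAt_const
  have he : (fun z' ↦ frameForm om x₀ (twistorProj z') (frameJ x₀ z' a) (frameJ x₀ z' b)) =ᶠ[𝓝 z]
      fun z' ↦ frameForm om x₀ (twistorProj z') a b := by
    filter_upwards [eventually_twistorProj_mem hz] with z' hz'
    exact frameForm_frameJ hz' a b
  have h := DFunLike.congr_fun he.mvfderiv_eq ξ
  rw [mvfderiv_clmApply (hO.clmApply (hJ.clmApply (hc a))) (hJ.clmApply (hc b)),
    mvfderiv_clmApply hO (hJ.clmApply (hc a)), mvfderiv_clmApply hJ (hc a),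
    mvfderiv_clmApply hJ (hc b), mvfderiv_clmApply (hO.clmApply (hc a)) (hc b),
    mvfderiv_clmApply hO (hc a), mvfderiv_const, mvfderiv_const] at h
  simp only [zero_apply, ContinuousLinearMap.map_zero, add_zero, add_apply] at h
  rw [mvfderiv_frameForm_proj hnab hz, mvfderiv_frameForm_proj hnab hz] at h
  have hinv := (compatibleStr_frame hz).inv
  simp only [frameDJ, add_apply, sub_apply, ContinuousLinearMap.comp_apply,
    ContinuousLinearMap.map_add, ContinuousLinearMap.map_sub, hinv]
  simp only [frameGamma] at h
  linarith

theorem twistorP_mem (hnab : IsSymplecticConnection om nab) (z : TwistorSpace om) (ξ : TZ z) :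
    twistorP nab z ξ ∈ vertSpace z := by
  have hz := mem_frameDom (n := n) (twistorProj z)
  rw [← conjL_mem_antiSp_iff hz, conjL_twistorP' hz]
  exact neg_half_mem_antiSp (compatibleStr_frame hz) (frameDJ_anticomm hz ξ)
    (frameForm_frameDJ hnab hz ξ)

omit [IsTwistorManifold om] in
theorem frameDJ_add (x₀ : M) (z : TwistorSpace om) (ξ η : TZ z) :
    frameDJ nab x₀ z (ξ + η) = frameDJ nab x₀ z ξ + frameDJ nab x₀ z η := by
  ext1 w
  simp only [frameDJ, ContinuousLinearMap.map_add, add_apply, sub_apply,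
    ContinuousLinearMap.comp_apply]
  abel

omit [IsTwistorManifold om] in
theorem frameDJ_smul (x₀ : M) (z : TwistorSpace om) (c : ℝ) (ξ : TZ z) :
    frameDJ nab x₀ z (c • ξ) = c • frameDJ nab x₀ z ξ := by
  ext1 w
  simp only [frameDJ, ContinuousLinearMap.map_smul, add_apply, sub_apply,
    ContinuousLinearMap.comp_apply, smul_apply,
    smul_add, smul_sub]

theorem twistorP_add (z : TwistorSpace om) (ξ η : TZ z) :
    twistorP nab z (ξ + η) = twistorP nab z ξ + twistorP nab z η := by
  have hz := mem_frameDom (n := n) (twistorProj z)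
  apply conjL_injective hz
  rw [conjL_add, conjL_twistorP' hz, conjL_twistorP' hz, conjL_twistorP' hz, frameDJ_add,
    ContinuousLinearMap.add_comp, smul_add]

theorem twistorP_smul (z : TwistorSpace om) (c : ℝ) (ξ : TZ z) :
    twistorP nab z (c • ξ) = c • twistorP nab z ξ := by
  have hz := mem_frameDom (n := n) (twistorProj z)
  apply conjL_injective hz
  rw [conjL_smul, conjL_twistorP' hz, conjL_twistorP' hz, frameDJ_smul,
    ContinuousLinearMap.smul_comp, smul_comm]

theorem twistorP_zero (z : TwistorSpace om) : twistorP nab z 0 = 0 := by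
  simpa using twistorP_smul (nab := nab) z 0 0

theorem twistorP_neg (z : TwistorSpace om) (ξ : TZ z) :
    twistorP nab z (-ξ) = -twistorP nab z ξ := by
  simpa using twistorP_smul (nab := nab) z (-1) ξ

theorem twistorP_sub (z : TwistorSpace om) (ξ η : TZ z) :
    twistorP nab z (ξ - η) = twistorP nab z ξ - twistorP nab z η := by
  rw [sub_eq_add_neg, twistorP_add, twistorP_neg, ← sub_eq_add_neg]

/-- The inclusion of `𝒵⁰` in `End(TM)` is an immersion. -/
theorem eq_zero_of_mvfderiv_eq_zero {z : TwistorSpace om} {ξ : TZ z}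
    (h1 : mvfderiv (𝓡 (n * (n + 3))) (projChart (om := om) (twistorProj z)) z ξ = 0)
    (h2 : mvfderiv (𝓡 (n * (n + 3))) (frameJ (twistorProj z)) z ξ = 0) : ξ = 0 := by
  have hz := mem_frameDom (n := n) (twistorProj z)
  have hp : MDifferentiableAt (𝓡 (n * (n + 3)))
      ((𝓡 (2 * n)).prod 𝓘(ℝ, ModelR n →L[ℝ] ModelR n))
      (fun z : TwistorSpace om ↦ (z.1 : EndTM n M)) z :=
    (IsTwistorManifold.contMDiff_incl (om := om) z).mdifferentiableAt (by simp)
  have hcomp := mvfderiv_comp_mfderiv (p := fun z : TwistorSpace om ↦ (z.1 : EndTM n M))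
    (f := extChartAt ((𝓡 (2 * n)).prod 𝓘(ℝ, ModelR n →L[ℝ] ModelR n)) z.1)
    (mdifferentiableAt_extChartAt (mem_chart_source _ z.1)) hp ξ
  have he : (fun z' : TwistorSpace om ↦
      extChartAt ((𝓡 (2 * n)).prod 𝓘(ℝ, ModelR n →L[ℝ] ModelR n)) z.1 (z'.1 : EndTM n M)) =ᶠ[𝓝 z]
      fun z' ↦ (projChart (twistorProj z) z', frameJ (twistorProj z) z') := by
    filter_upwards [eventually_twistorProj_mem hz] with z' hz'
    rw [FiberBundle.extChartAt]
    have h := (trivializationAt (ModelR n →L[ℝ] ModelR n)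
      (fun x : M ↦ TM n x →L[ℝ] TM n x) z.1.1).coe_fst' (x := z'.1) (mem_baseSet_end hz')
    exact Prod.ext (congrArg (extChartAt (𝓡 (2 * n)) z.1.1) h) rfl
  have h0 := DFunLike.congr_fun he.mvfderiv_eq ξ
  rw [mvfderiv_prodMk ((contMDiffAt_projChart hz).mdifferentiableAt (by simp))
    ((contMDiffAt_frameJ hz).mdifferentiableAt (by simp)), h1, h2] at h0
  have hself := DFunLike.congr_fun (mfderiv_extChartAt_self
    (I := (𝓡 (2 * n)).prod 𝓘(ℝ, ModelR n →L[ℝ] ModelR n)) (x := z.1))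
    (mfderiv (𝓡 (n * (n + 3))) ((𝓡 (2 * n)).prod 𝓘(ℝ, ModelR n →L[ℝ] ModelR n))
      (fun z : TwistorSpace om ↦ (z.1 : EndTM n M)) z ξ)
  apply IsTwistorManifold.injective_mfderiv_incl z
  exact (hself.symm.trans (hcomp.symm.trans h0)).trans (ContinuousLinearMap.map_zero _).symm

/-- If π_*ξ = 0 the Γ-terms drop and Pξ = -½ dJ(ξ)J with J invertible, so both components of the
differential of the inclusion vanish on ξ. -/
theorem eq_zero_of_dProj_of_twistorP {z : TwistorSpace om} {ξ : TZ z} (h1 : dProj z ξ = 0)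
    (h2 : twistorP nab z ξ = 0) : ξ = 0 := by
  have hz := mem_frameDom (n := n) (twistorProj z)
  have h3 := frameL_dProj hz ξ
  rw [h1, ContinuousLinearMap.map_zero] at h3
  refine eq_zero_of_mvfderiv_eq_zero h3.symm ?_
  have h4 := conjL_twistorP' (nab := nab) hz ξ
  rw [h2] at h4
  ext1 a
  have h5 := DFunLike.congr_fun h4 (frameJ (twistorProj z) z a)
  simp only [conjL_apply, zero_apply, ContinuousLinearMap.map_zero, smul_apply,
    ContinuousLinearMap.comp_apply,
    (compatibleStr_frame hz).sq, ContinuousLinearMap.map_neg] at h5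
  simp only [frameDJ, h1, ContinuousLinearMap.map_zero, ContinuousLinearMap.zero_comp,
    ContinuousLinearMap.comp_zero,
    sub_zero, add_zero, neg_smul, neg_neg, smul_neg] at h5
  simpa using h5.symm

theorem tangent_ext {z : TwistorSpace om} {ξ η : TZ z} (h1 : dProj z ξ = dProj z η)
    (h2 : twistorP nab z ξ = twistorP nab z η) : ξ = η := by
  rw [← sub_eq_zero]
  refine eq_zero_of_dProj_of_twistorP (nab := nab) ?_ ?_
  · rw [ContinuousLinearMap.map_sub, h1, sub_self]
  · rw [twistorP_sub, h2, sub_self]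

instance instFiniteDimensionalTZ (z : TwistorSpace om) : FiniteDimensional ℝ (TZ z) :=
  inferInstanceAs (FiniteDimensional ℝ (EuclideanSpace ℝ (Fin (n * (n + 3)))))

/-- The map (π_*, P) is injective, and source and target have the same dimension: n(n+3) = 2n +
n(n+1). -/
theorem exists_tangent (hnab : IsSymplecticConnection om nab) (z : TwistorSpace om)
    (v : TM n (twistorProj z)) {A : TM n (twistorProj z) →L[ℝ] TM n (twistorProj z)}
    (hA : A ∈ vertSpace z) : ∃ ξ : TZ z, dProj z ξ = v ∧ twistorP nab z ξ = A := by
  have hz := mem_frameDom (n := n) (twistorProj z)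
  let x := twistorProj z
  let 𝔪 := antiSp (frameForm om x x) (frameJ x z)
  let L : TZ z →ₗ[ℝ] ModelR n × 𝔪 :=
    { toFun := fun ξ ↦ (frameL x x (dProj z ξ), ⟨conjL x x (twistorP nab z ξ),
        (conjL_mem_antiSp_iff hz _).2 (twistorP_mem hnab z ξ)⟩)
      map_add' := fun ξ η ↦ by
        ext1
        · simp
        · ext1; simp only [twistorP_add, conjL_add]; rfl
      map_smul' := fun c ξ ↦ by
        ext1
        · simp
        · ext1; simp only [twistorP_smul, conjL_smul]; rfl }
  have hinj : Function.Injective L := by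
    intro ξ η h
    have h1 := congrArg Prod.fst h
    have h2 := congrArg (fun p ↦ (p.2 : ModelR n →L[ℝ] ModelR n)) h
    exact tangent_ext (nab := nab) (frameL_injective hz h1) (conjL_injective hz h2)
  have hfr : finrank ℝ (TZ z) = finrank ℝ (ModelR n × 𝔪) := by
    have h1 : finrank ℝ (TZ z) = n * (n + 3) :=
      finrank_euclideanSpace_fin (𝕜 := ℝ) (n := n * (n + 3))
    rw [finrank_prod, h1, finrank_euclideanSpace_fin,
      finrank_antiSp (compatibleStr_frame hz) finrank_euclideanSpace_fin]
    ring
  obtain ⟨ξ, hξ⟩ := (LinearMap.injective_iff_surjective_of_finrank_eq_finrank hfr).1 hinj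
    (frameL x x v, ⟨conjL x x A, (conjL_mem_antiSp_iff hz _).2 hA⟩)
  have h1 := congrArg Prod.fst hξ
  have h2 := congrArg (fun p ↦ (p.2 : ModelR n →L[ℝ] ModelR n)) hξ
  exact ⟨ξ, frameL_injective hz h1, conjL_injective hz h2⟩

/-- `twistorLift` is a choice made by `Function.invFun`, and is known to be the intended vector only
when the endomorphism is vertical. Every later statement about a lifted object has to supply that
membership. -/
theorem twistorLift_spec (hnab : IsSymplecticConnection om nab) {z : TwistorSpace om}
    {v : TM n (twistorProj z)} {A : TM n (twistorProj z) →L[ℝ] TM n (twistorProj z)}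
    (hA : A ∈ vertSpace z) :
    dProj z (twistorLift nab z v A) = v ∧ twistorP nab z (twistorLift nab z v A) = A := by
  obtain ⟨ξ, h1, h2⟩ := exists_tangent hnab z v hA
  have h := Function.invFun_eq (f := fun ξ : TZ z ↦ (dProj z ξ, (twistorP nab z ξ : _ → _)))
    (b := (v, A)) ⟨ξ, by simp [h1, h2]⟩
  exact ⟨congrArg Prod.fst h, DFunLike.coe_injective (congrArg Prod.snd h)⟩

end Splitting

/-- Here JX is dJ(X), GX is Γ(X), DX is ∇_XΦ; DXY and GXY are the derivatives along X of DY and GY;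
N and GB are dJ and Γ on [X, Y]. Since P = -½(∇Φ)J, this is twice the identity d^D P = ½(R + JRJ).
It is formal: eliminate DXY, then move each J to the left past JX and JY, and both sides agree. -/
theorem vertical_torsion_identity {A : Type*} [Ring A] {J DX DY GX GY JX JY N GXY GYX GB R : A}
    (hJ : J * J = -1) (hX : JX * J + J * JX = 0) (hY : JY * J + J * JY = 0)
    (hDX : DX = JX + (GX * J - J * GX)) (hDY : DY = JY + (GY * J - J * GY)) {DXY DYX : A}
    (hN : DXY - DYX = N + ((GXY - GYX) * J - J * (GXY - GYX)) + (GY * JX - JX * GY)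
      - (GX * JY - JY * GX))
    (hR : R = GXY - GYX - GB + (GX * GY - GY * GX)) :
    -(DXY * J + DY * JX) + (DYX * J + DX * JY) - (GX * (DY * J) - DY * J * GX)
      + (GY * (DX * J) - DX * J * GY) - (DX * J * (DY * J) - DY * J * (DX * J))
      + (N + (GB * J - J * GB)) * J = R + J * R * J := by
  have hX' : JX * J = -(J * JX) := eq_neg_of_add_eq_zero_left hX
  have hY' : JY * J = -(J * JY) := eq_neg_of_add_eq_zero_left hY
  have hJ2 : ∀ a, J * (J * a) = -a := fun a ↦ by rw [← mul_assoc, hJ]; simp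
  have hX2 : ∀ a, JX * (J * a) = -(J * (JX * a)) := fun a ↦ by
    rw [← mul_assoc, hX']; simp [mul_assoc]
  have hY2 : ∀ a, JY * (J * a) = -(J * (JY * a)) := fun a ↦ by
    rw [← mul_assoc, hY']; simp [mul_assoc]
  have e : DXY = DYX + (N + ((GXY - GYX) * J - J * (GXY - GYX)) + (GY * JX - JX * GY)
      - (GX * JY - JY * GX)) := by rw [← hN]; abel
  subst e hDX hDY hR
  simp only [mul_add, add_mul, mul_sub, sub_mul, mul_assoc, hJ, hX', hY', hJ2, hX2, hY2, mul_neg,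
    neg_mul, mul_one, neg_neg]
  abel

theorem mvfderiv_anticommPart {E : Type*} [NormedAddCommGroup E] [NormedSpace ℝ E]
    {H : Type*} [TopologicalSpace H] {I : ModelWithCorners ℝ E H}
    {Z : Type*} [TopologicalSpace Z] [ChartedSpace H Z]
    {V : Type*} [NormedAddCommGroup V] [NormedSpace ℝ V] {D G J : Z → V →L[ℝ] V} {z : Z} (c : ℝ)
    (hD : MDifferentiableAt I 𝓘(ℝ, V →L[ℝ] V) D z) (hG : MDifferentiableAt I 𝓘(ℝ, V →L[ℝ] V) G z)
    (hJ : MDifferentiableAt I 𝓘(ℝ, V →L[ℝ] V) J z) :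
    MDifferentiableAt I 𝓘(ℝ, V →L[ℝ] V)
      (fun z ↦ c • ((D z + (G z ∘L J z - J z ∘L G z)) ∘L J z)) z ∧ ∀ ξ,
    mvfderiv I (fun z ↦ c • ((D z + (G z ∘L J z - J z ∘L G z)) ∘L J z)) z ξ =
      c • ((mvfderiv I D z ξ + ((mvfderiv I G z ξ ∘L J z + G z ∘L mvfderiv I J z ξ) -
        (mvfderiv I J z ξ ∘L G z + J z ∘L mvfderiv I G z ξ))) ∘L J z +
        (D z + (G z ∘L J z - J z ∘L G z)) ∘L mvfderiv I J z ξ) := by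
  have h1 := hG.clmComp hJ
  have h2 := hJ.clmComp hG
  have h3 := (hD.add (h1.sub h2)).clmComp hJ
  refine ⟨MDifferentiableAt.clm_const (F := V →L[ℝ] V) (G := V →L[ℝ] V)
    (c • ContinuousLinearMap.id ℝ (V →L[ℝ] V)) h3, fun ξ ↦ ?_⟩
  have h4 := mvfderiv_clm (F := V →L[ℝ] V) (G := V →L[ℝ] V)
    (c • ContinuousLinearMap.id ℝ (V →L[ℝ] V)) h3 ξ
  refine h4.trans ?_
  rw [mvfderiv_clmComp (hD.add (h1.sub h2)) hJ]
  simp only [smul_apply, ContinuousLinearMap.id_apply]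
  congr 3
  rw [mvfderiv_add hD (h1.sub h2), mvfderiv_sub h1 h2, add_apply, sub_apply, mvfderiv_clmComp hG hJ,
    mvfderiv_clmComp hJ hG]

/-! ### Derivatives of the components of vector fields on 𝒵⁰. -/

section FieldDerivatives

variable {n : ℕ} {M : Type*} [TopologicalSpace M]
  [ChartedSpace (EuclideanSpace ℝ (Fin (2 * n))) M] [IsManifold (𝓡 (2 * n)) ∞ M]
  {om : SymplecticForm n M}
  [ChartedSpace (EuclideanSpace ℝ (Fin (n * (n + 3)))) (TwistorSpace om)]

/-- The section `π_* Y` of `E` in the preferred trivialization at `x₀`. -/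
def fieldH (x₀ : M) (Y : Π z : TwistorSpace om, TZ z) (z : TwistorSpace om) : ModelR n :=
  frameL x₀ (twistorProj z) (dProj z (Y z))

/-- The section `P Y` of `End(E)` in the preferred trivialization at `x₀`. -/
def fieldV (nab : LinConnection n M) (x₀ : M) (Y : Π z : TwistorSpace om, TZ z)
    (z : TwistorSpace om) : ModelR n →L[ℝ] ModelR n :=
  conjL x₀ (twistorProj z) (twistorP nab z (Y z))

/-- The derivative of `Φ` along `Y` in the preferred trivialization at `x₀`. -/
def fieldJ (x₀ : M) (Y : Π z : TwistorSpace om, TZ z)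
    (z : TwistorSpace om) : ModelR n →L[ℝ] ModelR n :=
  mvfderiv (𝓡 (n * (n + 3))) (frameJ x₀) z (Y z)

/-- The endomorphism `Γ(π_* Y)` in the preferred trivialization at `x₀`. -/
def fieldG (nab : LinConnection n M) (x₀ : M) (Y : Π z : TwistorSpace om, TZ z)
    (z : TwistorSpace om) : ModelR n →L[ℝ] ModelR n :=
  frameGamma nab x₀ z (Y z)

/-- The connection form of `D = π^*∇ - P` in the preferred trivialization at `π(z)`. -/
def frameK (nab : LinConnection n M) (z : TwistorSpace om) (ξ : TZ z) :
    ModelR n →L[ℝ] ModelR n :=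
  frameGamma nab (twistorProj z) z ξ - conjL (twistorProj z) (twistorProj z) (twistorP nab z ξ)

variable {nab : LinConnection n M}

theorem conjL_connForm_self (x : M) (u : TM n x) :
    conjL x x (connForm nab x u) = christoffel nab x x (frameL x x u) := by
  ext1 w
  rw [conjL_apply, frameL_connForm_self, frameL_symm (mem_frameDom x)]

theorem frameL_twistorDE (s : Π z : TwistorSpace om, TM n (twistorProj z)) (z : TwistorSpace om)
    (ξ : TZ z) : frameL (twistorProj z) (twistorProj z) (twistorDE nab s z ξ) =
      mvfderiv (𝓡 (n * (n + 3))) (fun z' ↦ frameL (twistorProj z) (twistorProj z') (s z')) z ξ +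
      frameK nab z ξ (frameL (twistorProj z) (twistorProj z) (s z)) := by
  rw [twistorDE, pullCov, ContinuousLinearMap.map_sub, ContinuousLinearMap.map_add,
    frameL_coordDeriv, frameL_connForm_self, frameK,
    sub_apply, conjL_frameL (mem_frameDom _), frameGamma]
  abel

theorem conjL_twistorDEnd
    (A : Π z : TwistorSpace om, TM n (twistorProj z) →L[ℝ] TM n (twistorProj z))
    (z : TwistorSpace om) (ξ : TZ z) :
    conjL (twistorProj z) (twistorProj z) (twistorDEnd nab A z ξ) =
      mvfderiv (𝓡 (n * (n + 3))) (fun z' ↦ conjL (twistorProj z) (twistorProj z') (A z')) z ξ +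
      (frameK nab z ξ ∘L conjL (twistorProj z) (twistorProj z) (A z) -
        conjL (twistorProj z) (twistorProj z) (A z) ∘L frameK nab z ξ) := by
  have hx := mem_frameDom (n := n) (twistorProj z)
  rw [twistorDEnd, pullCovEnd, conjL_sub, conjL_add, conjL_sub, conjL_sub, conjL_comp hx,
    conjL_comp hx, conjL_comp hx, conjL_comp hx, conjL_coordDerivEnd, conjL_connForm_self, frameK,
    frameGamma, ContinuousLinearMap.sub_comp, ContinuousLinearMap.comp_sub]
  abel

variable [IsTwistorManifold om]

/-- The vector field `Y` is differentiable at `z`. -/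
abbrev IsDiffField (Y : Π z : TwistorSpace om, TZ z) (z : TwistorSpace om) : Prop :=
  MDifferentiableAt (𝓡 (n * (n + 3))) (𝓡 (n * (n + 3))).tangent (TZ.sec Y) z

theorem fieldH_eventuallyEq {x₀ : M} {z : TwistorSpace om} (hz : twistorProj z ∈ frameDom n x₀)
    (Y : Π z : TwistorSpace om, TZ z) : fieldH x₀ Y =ᶠ[𝓝 z]
      fun z' ↦ mvfderiv (𝓡 (n * (n + 3))) (projChart x₀) z' (Y z') := by
  filter_upwards [eventually_twistorProj_mem hz] with z' hz'
  exact frameL_dProj hz' _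

theorem fieldV_eventuallyEq {x₀ : M} {z : TwistorSpace om} (hz : twistorProj z ∈ frameDom n x₀)
    (Y : Π z : TwistorSpace om, TZ z) : fieldV nab x₀ Y =ᶠ[𝓝 z]
      fun z' ↦ -(1 / 2 : ℝ) • ((fieldJ x₀ Y z' + (fieldG nab x₀ Y z' ∘L frameJ x₀ z' -
        frameJ x₀ z' ∘L fieldG nab x₀ Y z')) ∘L frameJ x₀ z') := by
  filter_upwards [eventually_twistorProj_mem hz] with z' hz'
  exact conjL_twistorP' hz' _

variable {z : TwistorSpace om} {X Y : Π z : TwistorSpace om, TZ z}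

theorem mdifferentiableAt_frameJ {x₀ : M} {z : TwistorSpace om}
    (hz : twistorProj z ∈ frameDom n x₀) :
    MDifferentiableAt (𝓡 (n * (n + 3))) 𝓘(ℝ, ModelR n →L[ℝ] ModelR n) (frameJ (om := om) x₀) z :=
  (contMDiffAt_frameJ hz).mdifferentiableAt (by simp)

theorem mdifferentiableAt_fieldH {x₀ : M} (hz : twistorProj z ∈ frameDom n x₀)
    (hY : IsDiffField Y z) :
    MDifferentiableAt (𝓡 (n * (n + 3))) 𝓘(ℝ, ModelR n) (fieldH x₀ Y) z :=
  (mvfderiv_mvfderiv ((contMDiffAt_projChart hz).of_le two_le_infty) hY).1.congr_of_eventuallyEq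
    (fieldH_eventuallyEq hz Y)

/-- The components of π_*Y are the derivatives along Y of the coordinates of π, so the commutator
formula applies to them. -/
theorem mvfderiv_fieldH_sub {x₀ : M} (hz : twistorProj z ∈ frameDom n x₀)
    (hX : IsDiffField X z) (hY : IsDiffField Y z) :
    mvfderiv (𝓡 (n * (n + 3))) (fieldH x₀ Y) z (X z) -
      mvfderiv (𝓡 (n * (n + 3))) (fieldH x₀ X) z (Y z) =
      frameL x₀ (twistorProj z) (dProj z (mlieBracket (𝓡 (n * (n + 3))) X Y z)) := by
  rw [(fieldH_eventuallyEq hz Y).mvfderiv_eq, (fieldH_eventuallyEq hz X).mvfderiv_eq,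
    mvfderiv_mlieBracket ((contMDiffAt_projChart hz).of_le two_le_infty) hX hY, frameL_dProj hz]

theorem mdifferentiableAt_fieldJ {x₀ : M} (hz : twistorProj z ∈ frameDom n x₀)
    (hY : IsDiffField Y z) :
    MDifferentiableAt (𝓡 (n * (n + 3))) 𝓘(ℝ, ModelR n →L[ℝ] ModelR n) (fieldJ x₀ Y) z :=
  (mvfderiv_mvfderiv ((contMDiffAt_frameJ hz).of_le two_le_infty) hY).1

theorem mvfderiv_fieldJ_sub {x₀ : M} (hz : twistorProj z ∈ frameDom n x₀)
    (hX : IsDiffField X z) (hY : IsDiffField Y z) :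
    mvfderiv (𝓡 (n * (n + 3))) (fieldJ x₀ Y) z (X z) -
      mvfderiv (𝓡 (n * (n + 3))) (fieldJ x₀ X) z (Y z) =
      mvfderiv (𝓡 (n * (n + 3))) (frameJ x₀) z (mlieBracket (𝓡 (n * (n + 3))) X Y z) :=
  mvfderiv_mlieBracket ((contMDiffAt_frameJ hz).of_le two_le_infty) hX hY

variable [T2Space M]

theorem fieldG_deriv (hs : CovariantDerivative.ContMDiffCovariantDerivative nab ∞)
    (hY : IsDiffField Y z) :
    MDifferentiableAt (𝓡 (n * (n + 3))) 𝓘(ℝ, ModelR n →L[ℝ] ModelR n)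
      (fieldG nab (twistorProj z) Y) z ∧
    ∀ ξ, mvfderiv (𝓡 (n * (n + 3))) (fieldG nab (twistorProj z) Y) z ξ =
      mvfderiv (𝓡 (2 * n)) (christoffel nab (twistorProj z)) (twistorProj z) (dProj z ξ)
        (fieldH (twistorProj z) Y z) + christoffel nab (twistorProj z) (twistorProj z)
          (mvfderiv (𝓡 (n * (n + 3))) (fieldH (twistorProj z) Y) z ξ) := by
  have h1 := mdifferentiableAt_christoffel hs (twistorProj z)
  have h2 : MDifferentiableAt (𝓡 (n * (n + 3))) (𝓡 (2 * n)) (twistorProj (om := om)) z :=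
    (contMDiff_twistorProj z).mdifferentiableAt (by simp)
  have h3 : MDifferentiableAt (𝓡 (n * (n + 3))) 𝓘(ℝ, ModelR n →L[ℝ] ModelR n →L[ℝ] ModelR n)
      (fun z' : TwistorSpace om ↦ christoffel nab (twistorProj z) (twistorProj z')) z := h1.comp z h2
  have h4 := mdifferentiableAt_fieldH (mem_frameDom (n := n) (twistorProj z)) hY
  refine ⟨h3.clmApply h4, fun ξ ↦ (mvfderiv_clmApply h3 h4 ξ).trans ?_⟩
  rw [mvfderiv_comp_mfderiv h1 h2]
  rfl

/-- Near `z`, PY = -½(dJ(Y) + [Γ(π_*Y), J])J in the fixed frame, and the product rule applies. -/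
theorem fieldV_deriv (hs : CovariantDerivative.ContMDiffCovariantDerivative nab ∞)
    (hY : IsDiffField Y z) :
    MDifferentiableAt (𝓡 (n * (n + 3))) 𝓘(ℝ, ModelR n →L[ℝ] ModelR n)
      (fieldV nab (twistorProj z) Y) z ∧
    ∀ ξ, mvfderiv (𝓡 (n * (n + 3))) (fieldV nab (twistorProj z) Y) z ξ = -(1 / 2 : ℝ) •
      ((mvfderiv (𝓡 (n * (n + 3))) (fieldJ (twistorProj z) Y) z ξ +
      ((mvfderiv (𝓡 (n * (n + 3))) (fieldG nab (twistorProj z) Y) z ξ ∘L frameJ (twistorProj z) z +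
        fieldG nab (twistorProj z) Y z ∘L
          mvfderiv (𝓡 (n * (n + 3))) (frameJ (twistorProj z)) z ξ) -
        (mvfderiv (𝓡 (n * (n + 3))) (frameJ (twistorProj z)) z ξ ∘L fieldG nab (twistorProj z) Y z +
        frameJ (twistorProj z) z ∘L
          mvfderiv (𝓡 (n * (n + 3))) (fieldG nab (twistorProj z) Y) z ξ))) ∘L
          frameJ (twistorProj z) z +
        (fieldJ (twistorProj z) Y z + (fieldG nab (twistorProj z) Y z ∘L frameJ (twistorProj z) z -
          frameJ (twistorProj z) z ∘L fieldG nab (twistorProj z) Y z)) ∘L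
            mvfderiv (𝓡 (n * (n + 3))) (frameJ (twistorProj z)) z ξ) := by
  have hx := mem_frameDom (n := n) (twistorProj z)
  have h := mvfderiv_anticommPart (-(1 / 2 : ℝ)) (mdifferentiableAt_fieldJ hx hY)
    (fieldG_deriv hs hY).1 (mdifferentiableAt_frameJ hx)
  have he := fieldV_eventuallyEq (nab := nab) hx Y
  exact ⟨h.1.congr_of_eventuallyEq he, fun ξ ↦ (DFunLike.congr_fun he.mvfderiv_eq ξ).trans (h.2 ξ)⟩

end FieldDerivatives

theorem vertical_torsion_identity_half {A : Type*} [Ring A] [Algebra ℝ A]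
    {J DX DY GX GY JX JY N GXY GYX GB R : A}
    (hJ : J * J = -1) (hX : JX * J + J * JX = 0) (hY : JY * J + J * JY = 0)
    (hDX : DX = JX + (GX * J - J * GX)) (hDY : DY = JY + (GY * J - J * GY)) {DXY DYX : A}
    (hN : DXY - DYX = N + ((GXY - GYX) * J - J * (GXY - GYX)) + (GY * JX - JX * GY)
      - (GX * JY - JY * GX))
    (hR : R = GXY - GYX - GB + (GX * GY - GY * GX)) :
    (-(1 / 2 : ℝ) • (DXY * J + DY * JX) + ((GX - -(1 / 2 : ℝ) • (DX * J)) * (-(1 / 2 : ℝ) • (DY * J))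
      - (-(1 / 2 : ℝ) • (DY * J)) * (GX - -(1 / 2 : ℝ) • (DX * J)))) -
    (-(1 / 2 : ℝ) • (DYX * J + DX * JY) + ((GY - -(1 / 2 : ℝ) • (DY * J)) * (-(1 / 2 : ℝ) • (DX * J))
      - (-(1 / 2 : ℝ) • (DX * J)) * (GY - -(1 / 2 : ℝ) • (DY * J)))) -
      -(1 / 2 : ℝ) • ((N + (GB * J - J * GB)) * J) = (1 / 2 : ℝ) • (R + J * R * J) := by
  rw [← vertical_torsion_identity hJ hX hY hDX hDY hN hR]
  generalize DX * J = pX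
  generalize DY * J = pY
  simp only [mul_smul_comm, smul_mul_assoc, sub_mul, mul_sub]
  module

/-- The ring identity with every symbol spelled out in the form in which `fieldV_deriv` and
`conjL_twistorDEnd` produce it. -/
theorem vertical_torsion_clm {V : Type*} [NormedAddCommGroup V] [NormedSpace ℝ V]
    {J GX GY JX JY N GXY GYX GB R dJY dJX : V →L[ℝ] V}
    (hJ : J ∘L J = -ContinuousLinearMap.id ℝ V) (hX : JX ∘L J + J ∘L JX = 0)
    (hY : JY ∘L J + J ∘L JY = 0) (hN : dJY - dJX = N)
    (hR : R = GXY - GYX - GB + (GX ∘L GY - GY ∘L GX)) :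
    (-(1 / 2 : ℝ) • ((dJY + ((GXY ∘L J + GY ∘L JX) - (JX ∘L GY + J ∘L GXY))) ∘L J +
        (JY + (GY ∘L J - J ∘L GY)) ∘L JX) +
      ((GX - -(1 / 2 : ℝ) • ((JX + (GX ∘L J - J ∘L GX)) ∘L J)) ∘L
        (-(1 / 2 : ℝ) • ((JY + (GY ∘L J - J ∘L GY)) ∘L J))
      - (-(1 / 2 : ℝ) • ((JY + (GY ∘L J - J ∘L GY)) ∘L J)) ∘L
        (GX - -(1 / 2 : ℝ) • ((JX + (GX ∘L J - J ∘L GX)) ∘L J)))) -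
    (-(1 / 2 : ℝ) • ((dJX + ((GYX ∘L J + GX ∘L JY) - (JY ∘L GX + J ∘L GYX))) ∘L J +
        (JX + (GX ∘L J - J ∘L GX)) ∘L JY) +
      ((GY - -(1 / 2 : ℝ) • ((JY + (GY ∘L J - J ∘L GY)) ∘L J)) ∘L
        (-(1 / 2 : ℝ) • ((JX + (GX ∘L J - J ∘L GX)) ∘L J))
      - (-(1 / 2 : ℝ) • ((JX + (GX ∘L J - J ∘L GX)) ∘L J)) ∘L
        (GY - -(1 / 2 : ℝ) • ((JY + (GY ∘L J - J ∘L GY)) ∘L J)))) -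
      -(1 / 2 : ℝ) • ((N + (GB ∘L J - J ∘L GB)) ∘L J) = (1 / 2 : ℝ) • (R + J ∘L R ∘L J) := by
  simp only [← ContinuousLinearMap.mul_def] at *
  rw [← mul_assoc J R J]
  refine vertical_torsion_identity_half hJ hX hY rfl rfl ?_ hR
  rw [← hN]
  simp only [mul_sub, sub_mul]
  abel

/-! ### Parallel forms and complex structures for a connection d + K. -/

section CovariantDerivativeInCoordinates

variable {E : Type*} [NormedAddCommGroup E] [NormedSpace ℝ E]
  {H : Type*} [TopologicalSpace H] {I : ModelWithCorners ℝ E H}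
  {Z : Type*} [TopologicalSpace Z] [ChartedSpace H Z]
  {V : Type*} [NormedAddCommGroup V] [NormedSpace ℝ V]
  {A J : Z → V →L[ℝ] V} {Om : Z → V →L[ℝ] V →L[ℝ] ℝ} {z : Z} {ξ : TangentSpace I z}
  {K : V →L[ℝ] V}

/-- The hypothesis on `K` says that Ω is parallel for d + K. Differentiate the equation defining sp;
the terms with K on a or b are removed by the same equation at (Ka, b) and (a, Kb). -/
theorem covDeriv_mem_sp (hO : MDifferentiableAt I 𝓘(ℝ, V →L[ℝ] V →L[ℝ] ℝ) Om z)
    (hA : MDifferentiableAt I 𝓘(ℝ, V →L[ℝ] V) A z)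
    (hK : ∀ a b, mvfderiv I Om z ξ a b = Om z (K a) b + Om z a (K b))
    (hm : ∀ a b, ∀ᶠ z' in 𝓝 z, Om z' (A z' a) b + Om z' a (A z' b) = 0) (a b : V) :
    Om z ((mvfderiv I A z ξ + (K ∘L A z - A z ∘L K)) a) b +
      Om z a ((mvfderiv I A z ξ + (K ∘L A z - A z ∘L K)) b) = 0 := by
  have hc : ∀ c : V, MDifferentiableAt I 𝓘(ℝ, V) (fun _ : Z ↦ c) z := fun c ↦ mdifferentiableAt_const
  have hA1 := fun c ↦ hA.clmApply (hc c)
  have he : (fun z' ↦ Om z' (A z' a) b + Om z' a (A z' b)) =ᶠ[𝓝 z] fun _ ↦ (0 : ℝ) := hm a b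
  have h := DFunLike.congr_fun he.mvfderiv_eq ξ
  rw [mvfderiv_fun_add ((hO.clmApply (hA1 a)).clmApply (hc b))
    ((hO.clmApply (hc a)).clmApply (hA1 b)), add_apply,
    mvfderiv_clmApply (hO.clmApply (hA1 a)) (hc b), mvfderiv_clmApply hO (hA1 a),
    mvfderiv_clmApply (hO.clmApply (hc a)) (hA1 b), mvfderiv_clmApply hO (hc a),
    mvfderiv_clmApply hA (hc a), mvfderiv_clmApply hA (hc b),
    mvfderiv_const, mvfderiv_const, mvfderiv_const] at h
  simp only [zero_apply, ContinuousLinearMap.map_zero, add_zero, add_apply, hK] at h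
  have h1 := (hm (K a) b).self_of_nhds
  have h2 := (hm a (K b)).self_of_nhds
  simp only [add_apply, sub_apply, ContinuousLinearMap.comp_apply, ContinuousLinearMap.map_add,
    ContinuousLinearMap.map_sub]
  linarith

/-- The hypothesis on `K` says that J is parallel for d + K, so the relation AJ + JA = 0 passes to
the covariant derivative of A. -/
theorem covDeriv_anticomm (hJ : MDifferentiableAt I 𝓘(ℝ, V →L[ℝ] V) J z)
    (hA : MDifferentiableAt I 𝓘(ℝ, V →L[ℝ] V) A z)
    (hK : mvfderiv I J z ξ = J z ∘L K - K ∘L J z)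
    (hm : ∀ᶠ z' in 𝓝 z, ∀ a, A z' (J z' a) = -J z' (A z' a)) (a : V) :
    (mvfderiv I A z ξ + (K ∘L A z - A z ∘L K)) (J z a) =
      -J z ((mvfderiv I A z ξ + (K ∘L A z - A z ∘L K)) a) := by
  have he : (fun z' ↦ A z' ∘L J z' + J z' ∘L A z') =ᶠ[𝓝 z] fun _ ↦ (0 : V →L[ℝ] V) := by
    filter_upwards [hm] with z' hz'
    ext1 a
    simp [hz']
  have hm' := hm.self_of_nhds
  have h := DFunLike.congr_fun (DFunLike.congr_fun he.mvfderiv_eq ξ) a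
  rw [mvfderiv_fun_add (hA.clmComp hJ) (hJ.clmComp hA), add_apply, mvfderiv_clmComp hA hJ,
    mvfderiv_clmComp hJ hA, hK, mvfderiv_const] at h
  simp only [zero_apply, add_apply, sub_apply, ContinuousLinearMap.comp_apply,
    ContinuousLinearMap.map_sub, hm'] at h
  simp only [add_apply, sub_apply, ContinuousLinearMap.comp_apply, ContinuousLinearMap.map_add,
    ContinuousLinearMap.map_sub, hm', ContinuousLinearMap.map_neg]
  rw [← sub_eq_zero, ← h]
  abel

/-- As Ω and J are parallel for d + K, only the trace term needs an argument: the two commutators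
add up to Tr [K, AB] = 0. -/
theorem mvfderiv_metric [FiniteDimensional ℝ V] {B : Z → V →L[ℝ] V} {f g : Z → V} (t : ℝ)
    (hO : MDifferentiableAt I 𝓘(ℝ, V →L[ℝ] V →L[ℝ] ℝ) Om z)
    (hJ : MDifferentiableAt I 𝓘(ℝ, V →L[ℝ] V) J z)
    (hA : MDifferentiableAt I 𝓘(ℝ, V →L[ℝ] V) A z) (hB : MDifferentiableAt I 𝓘(ℝ, V →L[ℝ] V) B z)
    (hf : MDifferentiableAt I 𝓘(ℝ, V) f z) (hg : MDifferentiableAt I 𝓘(ℝ, V) g z)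
    (hKO : ∀ a b, mvfderiv I Om z ξ a b = Om z (K a) b + Om z a (K b))
    (hKJ : mvfderiv I J z ξ = J z ∘L K - K ∘L J z) :
    mvfderiv I (fun z ↦ t * Om z (f z) (J z (g z)) + 1 / 2 * traceL V (A z ∘L B z)) z ξ =
      (t * Om z (mvfderiv I f z ξ + K (f z)) (J z (g z)) +
        1 / 2 * traceL V ((mvfderiv I A z ξ + (K ∘L A z - A z ∘L K)) ∘L B z)) +
      (t * Om z (f z) (J z (mvfderiv I g z ξ + K (g z))) +
        1 / 2 * traceL V (A z ∘L (mvfderiv I B z ξ + (K ∘L B z - B z ∘L K)))) := by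
  have d1 := (hO.clmApply hf).clmApply (hJ.clmApply hg)
  have d2 := MDifferentiableAt.clm_const (traceL V) (hA.clmComp hB)
  have e1 := mvfderiv_clm (t • ContinuousLinearMap.id ℝ ℝ) d1 ξ
  have e2 := mvfderiv_clm ((1 / 2 : ℝ) • ContinuousLinearMap.id ℝ ℝ) d2 ξ
  have d1' := MDifferentiableAt.clm_const (t • ContinuousLinearMap.id ℝ ℝ) d1
  have d2' := MDifferentiableAt.clm_const ((1 / 2 : ℝ) • ContinuousLinearMap.id ℝ ℝ) d2
  simp only [smul_apply, ContinuousLinearMap.id_apply, smul_eq_mul] at e1 e2 d1' d2'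
  rw [mvfderiv_fun_add d1' d2', add_apply, e1, e2,
    mvfderiv_clmApply (hO.clmApply hf) (hJ.clmApply hg), mvfderiv_clmApply hO hf, add_apply,
    mvfderiv_clmApply hJ hg, hKO, mvfderiv_clm _ (hA.clmComp hB),
    mvfderiv_clmComp hA hB, hKJ]
  have etr : traceL V ((K ∘L A z - A z ∘L K) ∘L B z) +
      traceL V (A z ∘L (K ∘L B z - B z ∘L K)) = 0 := by
    have := traceL_comp_comm K (A z ∘L B z)
    simp only [← ContinuousLinearMap.mul_def, mul_sub, sub_mul, ContinuousLinearMap.map_sub,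
      mul_assoc] at this ⊢
    linarith
  simp only [ContinuousLinearMap.add_comp, ContinuousLinearMap.comp_add,
    ContinuousLinearMap.map_add, add_apply,
    sub_apply, ContinuousLinearMap.map_sub, ContinuousLinearMap.comp_apply] at etr ⊢
  linear_combination -(1 / 2) * etr

end CovariantDerivativeInCoordinates

/-! ### What D preserves, and its torsion. -/

section ParallelStructure

variable {n : ℕ} {M : Type*} [TopologicalSpace M]
  [ChartedSpace (EuclideanSpace ℝ (Fin (2 * n))) M] [IsManifold (𝓡 (2 * n)) ∞ M]
  {om : SymplecticForm n M}
  {nab : LinConnection n M}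

/-- The curvature as an endomorphism. -/
def curvEnd (nab : LinConnection n M) (x : M) (u v : TM n x) : TM n x →L[ℝ] TM n x :=
  conjSymmL x x (curvatureForm nab x (frameL x x u) (frameL x x v))

theorem conjL_curvEnd (x : M) (u v : TM n x) :
    conjL x x (curvEnd nab x u v) = curvatureForm nab x (frameL x x u) (frameL x x v) :=
  conjL_conjSymmL (mem_frameDom x) _

theorem curvEnd_apply [T2Space M]
    (hs : CovariantDerivative.ContMDiffCovariantDerivative nab ∞) (x : M) (u v w : TM n x) :
    curvEnd nab x u v w = curvature nab x u v w := by
  apply frameL_injective (mem_frameDom x)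
  rw [← conjL_frameL (mem_frameDom x), conjL_curvEnd, frameL_curvature hs]

variable
  [ChartedSpace (EuclideanSpace ℝ (Fin (n * (n + 3)))) (TwistorSpace om)] [IsTwistorManifold om]

/-- The vertical part of an endomorphism of `E`. -/
def vertEnd (z : TwistorSpace om) (B : TM n (twistorProj z) →L[ℝ] TM n (twistorProj z)) :
    TM n (twistorProj z) →L[ℝ] TM n (twistorProj z) :=
  (1 / 2 : ℝ) • (B + twistorPhi z ∘L B ∘L twistorPhi z)

omit [ChartedSpace (EuclideanSpace ℝ (Fin (n * (n + 3)))) (TwistorSpace om)]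
  [IsTwistorManifold om] in
theorem conjL_vertEnd (z : TwistorSpace om)
    (B : TM n (twistorProj z) →L[ℝ] TM n (twistorProj z)) :
    conjL (twistorProj z) (twistorProj z) (vertEnd z B) = (1 / 2 : ℝ) •
      (conjL (twistorProj z) (twistorProj z) B + frameJ (twistorProj z) z ∘L
        conjL (twistorProj z) (twistorProj z) B ∘L frameJ (twistorProj z) z) := by
  have hx := mem_frameDom (n := n) (twistorProj z)
  rw [vertEnd, conjL_smul, conjL_add, conjL_comp hx, conjL_comp hx]
  rfl

omit [ChartedSpace (EuclideanSpace ℝ (Fin (n * (n + 3)))) (TwistorSpace om)]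
  [IsTwistorManifold om] in
theorem vertEnd_curvEnd_mem [T2Space M] (hnab : IsSymplecticConnection om nab)
    (z : TwistorSpace om) (u v : TM n (twistorProj z)) :
    vertEnd z (curvEnd nab _ u v) ∈ vertSpace z := by
  have hx := mem_frameDom (n := n) (twistorProj z)
  rw [← conjL_mem_antiSp_iff hx, conjL_vertEnd, conjL_curvEnd]
  exact half_add_mem_antiSp (compatibleStr_frame hx) fun a b ↦
    frameForm_curvatureForm hnab _ _ _ a b

theorem vertCurvature_spec [T2Space M] (hnab : IsSymplecticConnection om nab)
    (z : TwistorSpace om) (ξ η : TZ z) :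
    dProj z (vertCurvature nab z ξ η) = 0 ∧ twistorP nab z (vertCurvature nab z ξ η) =
      vertEnd z (curvEnd nab _ (dProj z ξ) (dProj z η)) := by
  have h := twistorLift_spec hnab (v := 0)
    (vertEnd_curvEnd_mem hnab z (dProj z ξ) (dProj z η))
  have he : vertCurvature nab z ξ η =
      twistorLift nab z 0 (vertEnd z (curvEnd nab _ (dProj z ξ) (dProj z η))) := by
    rw [vertCurvature]
    congr 1
    funext w
    simp [vertEnd, curvEnd_apply hnab.smooth]
  rw [he]
  exact h

/-- This is DΦ = 0: as ∇Φ anticommutes with Φ, the choice P = -½(∇Φ)Φ gives [P, Φ] = ∇Φ. -/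
theorem mvfderiv_frameJ (z : TwistorSpace om) (ξ : TZ z) :
    mvfderiv (𝓡 (n * (n + 3))) (frameJ (twistorProj z)) z ξ =
      frameJ (twistorProj z) z ∘L frameK nab z ξ - frameK nab z ξ ∘L frameJ (twistorProj z) z := by
  have hx := mem_frameDom (n := n) (twistorProj z)
  rw [frameK, conjL_twistorP' hx]
  have hs := (compatibleStr_frame hx).sq
  have ha := frameDJ_anticomm (nab := nab) hx ξ
  have h : mvfderiv (𝓡 (n * (n + 3))) (frameJ (twistorProj z)) z ξ = frameDJ nab (twistorProj z) z ξ
    - (frameGamma nab (twistorProj z) z ξ ∘L frameJ (twistorProj z) z -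
        frameJ (twistorProj z) z ∘L frameGamma nab (twistorProj z) z ξ) :=
    (add_sub_cancel_right _ _).symm
  rw [h]
  ext1 a
  simp only [sub_apply, ContinuousLinearMap.comp_apply, smul_apply, ContinuousLinearMap.map_sub,
    ContinuousLinearMap.map_smul, hs, ContinuousLinearMap.map_neg, ha]
  module

/-- This is Dω = 0: ω is parallel for ∇, and subtracting P changes nothing because P takes values in
sp. -/
theorem mvfderiv_frameForm_frameK (hnab : IsSymplecticConnection om nab) (z : TwistorSpace om)
    (ξ : TZ z) (a b : ModelR n) :
    mvfderiv (𝓡 (n * (n + 3)))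
      (fun z' : TwistorSpace om ↦ frameForm om (twistorProj z) (twistorProj z')) z ξ a b =
      frameForm om (twistorProj z) (twistorProj z) (frameK nab z ξ a) b +
      frameForm om (twistorProj z) (twistorProj z) a (frameK nab z ξ b) := by
  have hx := mem_frameDom (n := n) (twistorProj z)
  have h := ((conjL_mem_antiSp_iff hx _).2 (twistorP_mem hnab z ξ)).1 a b
  rw [mvfderiv_frameForm_proj hnab hx]
  simp only [frameK, sub_apply, ContinuousLinearMap.map_sub]
  linarith

/-- The connection `D` preserves the vertical bundle. -/
theorem twistorDEnd_mem (hnab : IsSymplecticConnection om nab) {z : TwistorSpace om}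
    {A : Π z : TwistorSpace om, TM n (twistorProj z) →L[ℝ] TM n (twistorProj z)}
    (hA : MDifferentiableAt (𝓡 (n * (n + 3))) 𝓘(ℝ, ModelR n →L[ℝ] ModelR n)
      (fun z' ↦ conjL (twistorProj z) (twistorProj z') (A z')) z)
    (hmem : ∀ z, A z ∈ vertSpace z) (ξ : TZ z) : twistorDEnd nab A z ξ ∈ vertSpace z := by
  have hx := mem_frameDom (n := n) (twistorProj z)
  have hJ := mdifferentiableAt_frameJ hx
  have hO := mdifferentiableAt_frameForm_proj hx
  rw [← conjL_mem_antiSp_iff hx, conjL_twistorDEnd]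
  have h1 := covDeriv_mem_sp (A := fun z' ↦ conjL (twistorProj z) (twistorProj z') (A z'))
    (Om := fun z' ↦ frameForm om (twistorProj z) (twistorProj z')) (K := frameK nab z ξ) hO hA
    (mvfderiv_frameForm_frameK hnab z ξ) fun a b ↦ by
      filter_upwards [eventually_twistorProj_mem hx] with z' hz'
      exact ((conjL_mem_antiSp_iff hz' _).2 (hmem z')).1 a b
  have h2 := covDeriv_anticomm (A := fun z' ↦ conjL (twistorProj z) (twistorProj z') (A z'))
    (K := frameK nab z ξ) hJ hA (mvfderiv_frameJ z ξ) (by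
      filter_upwards [eventually_twistorProj_mem hx] with z' hz'
      exact ((conjL_mem_antiSp_iff hz' _).2 (hmem z')).2)
  exact ⟨h1, h2⟩

/-- Differentiability of `Y` guarantees that D(PY) is vertical, hence that the lift in the
definition of `twistorD` is the intended one. -/
theorem twistorD_spec [T2Space M] (hnab : IsSymplecticConnection om nab) {z : TwistorSpace om}
    {Y : Π z : TwistorSpace om, TZ z} (hY : IsDiffField Y z) (ξ : TZ z) :
    dProj z (twistorD nab Y z ξ) = twistorDE nab (fun z' ↦ dProj z' (Y z')) z ξ ∧
    twistorP nab z (twistorD nab Y z ξ) = twistorDEnd nab (fun z' ↦ twistorP nab z' (Y z')) z ξ :=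
  twistorLift_spec hnab (twistorDEnd_mem hnab (fieldV_deriv hnab.smooth hY).1
    (fun z' ↦ twistorP_mem hnab z' (Y z')) ξ)

-- The horizontal torsion of D: the derivatives of the components of π_*X and π_*Y give the bracket,
-- Γ cancels by symmetry, and the term -P of D leaves the right-hand side.
set_option maxHeartbeats 600000 in
theorem twistorDE_torsion (htor : nab.torsion = 0) {z : TwistorSpace om}
    {X Y : Π z : TwistorSpace om, TZ z} (hX : IsDiffField X z) (hY : IsDiffField Y z) :
    twistorDE nab (fun z' ↦ dProj z' (Y z')) z (X z) -
      twistorDE nab (fun z' ↦ dProj z' (X z')) z (Y z) -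
      dProj z (mlieBracket (𝓡 (n * (n + 3))) X Y z) =
    twistorP nab z (Y z) (dProj z (X z)) - twistorP nab z (X z) (dProj z (Y z)) := by
  have hx := mem_frameDom (n := n) (twistorProj z)
  apply frameL_injective hx
  rw [ContinuousLinearMap.map_sub, ContinuousLinearMap.map_sub, frameL_twistorDE, frameL_twistorDE,
    ← mvfderiv_fieldH_sub hx hX hY, ContinuousLinearMap.map_sub,
    ← conjL_frameL hx, ← conjL_frameL hx, frameK, frameK, sub_apply, sub_apply, frameGamma,
    frameGamma, christoffel_symm nab htor hx (frameL _ _ (dProj z (X z)))]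
  have e1 : (fun z' ↦ frameL (twistorProj z) (twistorProj z') (dProj z' (X z'))) =
    fieldH (twistorProj z) X := rfl
  have e2 : (fun z' ↦ frameL (twistorProj z) (twistorProj z') (dProj z' (Y z'))) =
    fieldH (twistorProj z) Y := rfl
  have key : ∀ p q r s g : ModelR n, (p + (g - q)) - (r + (g - s)) - (p - r) = s - q := by
    intros; abel
  rw [e1, e2]
  exact key _ _ _ _ _

-- The vertical torsion of D, that is d^D P. With P written through dJ and Γ, the derivatives of dJ
-- give dJ of the bracket, those of Γ together with [Γ, Γ] assemble to the curvature, and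
-- `vertical_torsion_clm` does the rest.
set_option maxHeartbeats 800000 in
theorem twistorDEnd_torsion [T2Space M]
    (hs : CovariantDerivative.ContMDiffCovariantDerivative nab ∞) {z : TwistorSpace om}
    {X Y : Π z : TwistorSpace om, TZ z} (hX : IsDiffField X z) (hY : IsDiffField Y z) :
    twistorDEnd nab (fun z' ↦ twistorP nab z' (Y z')) z (X z) -
      twistorDEnd nab (fun z' ↦ twistorP nab z' (X z')) z (Y z) -
      twistorP nab z (mlieBracket (𝓡 (n * (n + 3))) X Y z) =
    vertEnd z (curvEnd nab _ (dProj z (X z)) (dProj z (Y z))) := by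
  have hx := mem_frameDom (n := n) (twistorProj z)
  apply conjL_injective hx
  rw [conjL_vertEnd, conjL_curvEnd, conjL_sub, conjL_sub, conjL_twistorDEnd, conjL_twistorDEnd,
    frameK,
    frameK, conjL_twistorP' hx, conjL_twistorP' hx, conjL_twistorP' hx]
  have h1 := (fieldV_deriv hs hY).2 (X z)
  have h2 := (fieldV_deriv hs hX).2 (Y z)
  have hB := mvfderiv_fieldJ_sub hx hX hY
  have hGB := mvfderiv_fieldH_sub hx hX hY
  have hG1 := (fieldG_deriv hs hY).2 (X z)
  have hG2 := (fieldG_deriv hs hX).2 (Y z)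
  have e1 : (fun z' ↦ conjL (twistorProj z) (twistorProj z') (twistorP nab z' (X z'))) =
    fieldV nab (twistorProj z) X := rfl
  have e2 : (fun z' ↦ conjL (twistorProj z) (twistorProj z') (twistorP nab z' (Y z'))) =
    fieldV nab (twistorProj z) Y := rfl
  have eJX : mvfderiv (𝓡 (n * (n + 3))) (frameJ (twistorProj z)) z (X z) =
    fieldJ (twistorProj z) X z := rfl
  have eJY : mvfderiv (𝓡 (n * (n + 3))) (frameJ (twistorProj z)) z (Y z) =
    fieldJ (twistorProj z) Y z := rfl
  have eG : ∀ W : Π z : TwistorSpace om, TZ z, frameGamma nab (twistorProj z) z (W z) =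
    fieldG nab (twistorProj z) W z := fun _ ↦ rfl
  have eD : ∀ W : Π z : TwistorSpace om, TZ z, frameDJ nab (twistorProj z) z (W z) =
    fieldJ (twistorProj z) W z + (fieldG nab (twistorProj z) W z ∘L frameJ (twistorProj z) z -
      frameJ (twistorProj z) z ∘L fieldG nab (twistorProj z) W z) := fun _ ↦ rfl
  have eB : frameDJ nab (twistorProj z) z (mlieBracket (𝓡 (n * (n + 3))) X Y z) =
    mvfderiv (𝓡 (n * (n + 3))) (frameJ (twistorProj z)) z (mlieBracket (𝓡 (n * (n + 3))) X Y z) +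
      (frameGamma nab (twistorProj z) z (mlieBracket (𝓡 (n * (n + 3))) X Y z) ∘L
        frameJ (twistorProj z) z - frameJ (twistorProj z) z ∘L
        frameGamma nab (twistorProj z) z (mlieBracket (𝓡 (n * (n + 3))) X Y z)) := rfl
  have hJX := mvfderiv_frameJ_anticomm hx (X z)
  have hJY := mvfderiv_frameJ_anticomm hx (Y z)
  rw [eJX] at h1 hJX
  rw [eJY] at h2 hJY
  rw [e1, e2, h1, h2, eD, eD, eG, eG, eB]
  -- Differentiating Γ(π_*Y) along X gives dΓ and Γ of the derivative of the components of π_*Y; the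
  -- difference of the latter terms is Γ(π_*[X, Y]).
  have hR : curvatureForm nab (twistorProj z) (frameL (twistorProj z) (twistorProj z) (dProj z (X z)))
      (frameL (twistorProj z) (twistorProj z) (dProj z (Y z))) =
      mvfderiv (𝓡 (n * (n + 3))) (fieldG nab (twistorProj z) Y) z (X z) -
      mvfderiv (𝓡 (n * (n + 3))) (fieldG nab (twistorProj z) X) z (Y z) -
      frameGamma nab (twistorProj z) z (mlieBracket (𝓡 (n * (n + 3))) X Y z) +
      (fieldG nab (twistorProj z) X z ∘L fieldG nab (twistorProj z) Y z -
        fieldG nab (twistorProj z) Y z ∘L fieldG nab (twistorProj z) X z) := by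
    rw [hG1, hG2, frameGamma, ← hGB, ContinuousLinearMap.map_sub, curvatureForm]
    simp only [fieldH, frameSymmL_frameL hx, fieldG, frameGamma]
    abel
  exact vertical_torsion_clm (frameJ_comp_frameJ hx) hJX hJY hB hR

theorem twistorJ_spec (hnab : IsSymplecticConnection om nab) (z : TwistorSpace om) (ξ : TZ z) :
    dProj z (twistorJ nab z ξ) = twistorPhi z (dProj z ξ) ∧
    twistorP nab z (twistorJ nab z ξ) = twistorPhi z ∘L twistorP nab z ξ := by
  have hx := mem_frameDom (n := n) (twistorProj z)
  refine twistorLift_spec hnab (A := twistorPhi z ∘L twistorP nab z ξ) ?_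
  rw [← conjL_mem_antiSp_iff hx, conjL_comp hx]
  exact mul_left_mem_antiSp (compatibleStr_frame hx)
    ((conjL_mem_antiSp_iff hx _).2 (twistorP_mem hnab z ξ))

theorem twistorMetric_eq (hnab : IsSymplecticConnection om nab) (t : ℝ) {x₀ : M}
    {z : TwistorSpace om} (hz : twistorProj z ∈ frameDom n x₀) (ξ η : TZ z) :
    twistorMetric nab t z ξ η =
      t * frameForm om x₀ (twistorProj z) (frameL x₀ _ (dProj z ξ))
        (frameJ x₀ z (frameL x₀ _ (dProj z η))) +
      (1 / 2) * traceL (ModelR n) (conjL x₀ (twistorProj z) (twistorP nab z ξ) ∘L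
        conjL x₀ (twistorProj z) (twistorP nab z η)) := by
  rw [twistorMetric, (twistorJ_spec hnab z η).1, ← trace_conjL hz, conjL_comp hz, frameJ,
    conjL_frameL hz, frameForm_frameL hz, traceL_apply]

set_option maxHeartbeats 600000 in
/-- The metric is parallel for `D`. -/
theorem mvfderiv_twistorMetric [T2Space M] (hnab : IsSymplecticConnection om nab) (t : ℝ)
    {z : TwistorSpace om} {Y W : Π z : TwistorSpace om, TZ z} (hY : IsDiffField Y z)
    (hW : IsDiffField W z) (ξ : TZ z) :
    mvfderiv (𝓡 (n * (n + 3))) (fun z' ↦ twistorMetric nab t z' (Y z') (W z')) z ξ =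
      twistorMetric nab t z (twistorD nab Y z ξ) (W z) +
      twistorMetric nab t z (Y z) (twistorD nab W z ξ) := by
  have hx := mem_frameDom (n := n) (twistorProj z)
  have he : (fun z' ↦ twistorMetric nab t z' (Y z') (W z')) =ᶠ[𝓝 z] fun z' ↦
      t * frameForm om (twistorProj z) (twistorProj z') (fieldH (twistorProj z) Y z')
        (frameJ (twistorProj z) z' (fieldH (twistorProj z) W z')) + 1 / 2 *
        traceL (ModelR n) (fieldV nab (twistorProj z) Y z' ∘L fieldV nab (twistorProj z) W z') := by
    filter_upwards [eventually_twistorProj_mem hx] with z' hz'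
    exact twistorMetric_eq hnab t hz' _ _
  have hJ := mdifferentiableAt_frameJ hx
  have hO := mdifferentiableAt_frameForm_proj hx
  have hHY := mdifferentiableAt_fieldH hx hY
  have hHW := mdifferentiableAt_fieldH hx hW
  have hVY := (fieldV_deriv hnab.smooth hY).1
  have hVW := (fieldV_deriv hnab.smooth hW).1
  have h := mvfderiv_metric (K := frameK nab z ξ) (ξ := ξ)
    (Om := fun z' ↦ frameForm om (twistorProj z) (twistorProj z')) (J := frameJ (twistorProj z))
    (A := fieldV nab (twistorProj z) Y) (B := fieldV nab (twistorProj z) W)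
    (f := fieldH (twistorProj z) Y) (g := fieldH (twistorProj z) W) t hO hJ hVY hVW hHY hHW
    (mvfderiv_frameForm_frameK hnab z ξ) (mvfderiv_frameJ z ξ)
  rw [he.mvfderiv_eq, twistorMetric_eq hnab t hx,
    twistorMetric_eq hnab t hx, (twistorD_spec hnab hY ξ).1, (twistorD_spec hnab hW ξ).1,
    (twistorD_spec hnab hY ξ).2, (twistorD_spec hnab hW ξ).2, frameL_twistorDE, frameL_twistorDE,
    conjL_twistorDEnd, conjL_twistorDEnd]
  exact h

end ParallelStructure

/-- Riesz representation in finite dimension: each functional T(a, b, ·) is g(ξ, ·) for a unique ξ,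
and uniqueness makes ξ bilinear in (a, b). -/
theorem exists_bilin_of_nondegenerate {V : Type*} [AddCommGroup V] [Module ℝ V]
    [TopologicalSpace V] [IsTopologicalAddGroup V] [ContinuousSMul ℝ V] [T2Space V]
    [FiniteDimensional ℝ V] {g : V → V → ℝ}
    (g1 : ∀ a b c, g (a + b) c = g a c + g b c) (g2 : ∀ (r : ℝ) a b, g (r • a) b = r * g a b)
    (g3 : ∀ a b c, g a (b + c) = g a b + g a c) (g4 : ∀ (r : ℝ) a b, g a (r • b) = r * g a b)
    (hg : ∀ a, (∀ b, g a b = 0) → a = 0) {T : V → V → V → ℝ}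
    (t1 : ∀ a b c d, T (a + b) c d = T a c d + T b c d)
    (t2 : ∀ (r : ℝ) a b c, T (r • a) b c = r * T a b c)
    (t3 : ∀ a b c d, T a (b + c) d = T a b d + T a c d)
    (t4 : ∀ (r : ℝ) a b c, T a (r • b) c = r * T a b c)
    (t5 : ∀ a b c d, T a b (c + d) = T a b c + T a b d)
    (t6 : ∀ (r : ℝ) a b c, T a b (r • c) = r * T a b c) :
    ∃ S : V →L[ℝ] V →L[ℝ] V, ∀ a b c, g (S a b) c = T a b c := by
  let G : V →ₗ[ℝ] Dual ℝ V := LinearMap.mk₂ ℝ g g1 g2 g3 g4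
  have hinj : Function.Injective G := by
    rw [injective_iff_map_eq_zero]
    exact fun a ha ↦ hg a fun b ↦ DFunLike.congr_fun ha b
  have hsurj := (LinearMap.injective_iff_surjective_of_finrank_eq_finrank
    (Subspace.dual_finrank_eq (K := ℝ) (V := V)).symm).1 hinj
  have hs : ∀ a b, ∃ ξ, ∀ c, g ξ c = T a b c := fun a b ↦ by
    obtain ⟨ξ, hξ⟩ := hsurj
      { toFun := T a b
        map_add' := t5 a b
        map_smul' := fun r c ↦ t6 r a b c }
    exact ⟨ξ, fun c ↦ DFunLike.congr_fun hξ c⟩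
  choose s hs using hs
  have hext : ∀ ξ η, (∀ c, g ξ c = g η c) → ξ = η := fun ξ η h ↦ hinj (LinearMap.ext h)
  refine ⟨(LinearMap.mk₂ ℝ s ?_ ?_ ?_ ?_).toContinuousBilinearMap, hs⟩
  · exact fun a b c ↦ hext _ _ fun d ↦ by rw [g1, hs, hs, hs, t1]
  · exact fun r a b ↦ hext _ _ fun d ↦ by rw [g2, hs, hs, t2]
  · exact fun a b c ↦ hext _ _ fun d ↦ by rw [g1, hs, hs, hs, t3]
  · exact fun r a b ↦ hext _ _ fun d ↦ by rw [g2, hs, hs, t4]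

theorem bilin_split {V : Type*} [AddCommGroup V] [Module ℝ V] [TopologicalSpace V]
    [IsTopologicalAddGroup V] [ContinuousSMul ℝ V] (B : V →L[ℝ] V →L[ℝ] V)
    {a a₁ a₂ b b₁ b₂ : V} (ha : a₁ + a₂ = a) (hb : b₁ + b₂ = b) :
    B a b = B a₁ b₁ + B a₂ b₁ + B a b₂ := by
  rw [← ha, ← hb]
  simp only [map_add, add_apply]

/-! ### The metric and the tensor S, pointwise. -/

section FibreAlgebra

variable {n : ℕ} {M : Type*} [TopologicalSpace M]
  [ChartedSpace (EuclideanSpace ℝ (Fin (2 * n))) M] [IsManifold (𝓡 (2 * n)) ∞ M]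
  {om : SymplecticForm n M} {nab : LinConnection n M} {t : ℝ} {z : TwistorSpace om}

theorem SymplecticForm.skew (x : M) (u v : TM n x) : om.form x u v = -om.form x v u := by
  have h := om.alt x (u + v)
  simp only [ContinuousLinearMap.map_add, add_apply, om.alt] at h
  linarith

theorem metricE_symm (u v : TM n (twistorProj z)) : metricE t z u v = metricE t z v u := by
  have h1 : om.form (twistorProj z) (twistorPhi z u) (twistorPhi z (twistorPhi z v)) =
    om.form (twistorProj z) u (twistorPhi z v) := z.2.inv _ _
  have h2 : twistorPhi z (twistorPhi z v) = -v := z.2.sq v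
  rw [h2, ContinuousLinearMap.map_neg, SymplecticForm.skew, neg_neg] at h1
  rw [metricE, metricE, h1]

theorem metricE_add_left (u v w : TM n (twistorProj z)) :
    metricE t z (u + v) w = metricE t z u w + metricE t z v w := by
  simp only [metricE, ContinuousLinearMap.map_add, add_apply]; ring

theorem metricE_smul_left (r : ℝ) (u v : TM n (twistorProj z)) :
    metricE t z (r • u) v = r * metricE t z u v := by
  simp only [metricE, ContinuousLinearMap.map_smul, smul_apply, smul_eq_mul]; ring

theorem metricE_add_right (u v w : TM n (twistorProj z)) :
    metricE t z u (v + w) = metricE t z u v + metricE t z u w := by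
  simp only [metricE, ContinuousLinearMap.map_add]; ring

theorem metricE_smul_right (r : ℝ) (u v : TM n (twistorProj z)) :
    metricE t z u (r • v) = r * metricE t z u v := by
  simp only [metricE, ContinuousLinearMap.map_smul, smul_eq_mul]; ring

theorem metricE_zero_left (u : TM n (twistorProj z)) : metricE t z 0 u = 0 := by
  simp [metricE]

theorem metricE_zero_right (u : TM n (twistorProj z)) : metricE t z u 0 = 0 := by
  simp [metricE]

/-- The form `½ Tr (A B)` on endomorphisms of `E`. -/
def vertForm (z : TwistorSpace om) (A B : TM n (twistorProj z) →L[ℝ] TM n (twistorProj z)) : ℝ :=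
  1 / 2 * traceL (ModelR n) (conjL (twistorProj z) (twistorProj z) A ∘L
    conjL (twistorProj z) (twistorProj z) B)

theorem vertForm_symm (A B : TM n (twistorProj z) →L[ℝ] TM n (twistorProj z)) :
    vertForm z A B = vertForm z B A := by
  rw [vertForm, traceL_comp_comm, vertForm]

theorem vertForm_add_left (A B C : TM n (twistorProj z) →L[ℝ] TM n (twistorProj z)) :
    vertForm z (A + B) C = vertForm z A C + vertForm z B C := by
  rw [vertForm, conjL_add, ContinuousLinearMap.add_comp, ContinuousLinearMap.map_add, mul_add]; rfl

theorem vertForm_smul_left (r : ℝ) (A B : TM n (twistorProj z) →L[ℝ] TM n (twistorProj z)) :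
    vertForm z (r • A) B = r * vertForm z A B := by
  rw [vertForm, conjL_smul, ContinuousLinearMap.smul_comp, ContinuousLinearMap.map_smul,
    smul_eq_mul, vertForm]; ring

theorem vertForm_add_right (A B C : TM n (twistorProj z) →L[ℝ] TM n (twistorProj z)) :
    vertForm z A (B + C) = vertForm z A B + vertForm z A C := by
  rw [vertForm_symm, vertForm_add_left, vertForm_symm B, vertForm_symm C]

theorem vertForm_smul_right (r : ℝ) (A B : TM n (twistorProj z) →L[ℝ] TM n (twistorProj z)) :
    vertForm z A (r • B) = r * vertForm z A B := by
  rw [vertForm_symm, vertForm_smul_left, vertForm_symm B]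

theorem vertForm_zero_left (A : TM n (twistorProj z) →L[ℝ] TM n (twistorProj z)) :
    vertForm z 0 A = 0 := by
  simpa using vertForm_smul_left (z := z) 0 0 A

theorem vertForm_zero_right (A : TM n (twistorProj z) →L[ℝ] TM n (twistorProj z)) :
    vertForm z A 0 = 0 := by
  rw [vertForm_symm, vertForm_zero_left]

theorem eq_zero_of_vertForm {A : TM n (twistorProj z) →L[ℝ] TM n (twistorProj z)}
    (hA : A ∈ vertSpace z) (h : vertForm z A A = 0) : A = 0 := by
  have hx := mem_frameDom (n := n) (twistorProj z)
  have h1 : conjL (twistorProj z) (twistorProj z) A = 0 :=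
    eq_zero_of_traceL_comp_self (compatibleStr_frame hx) ((conjL_mem_antiSp_iff hx _).2 hA)
      (by rw [vertForm] at h; linarith)
  apply conjL_injective hx
  rw [h1]
  ext1 w; simp [conjL_apply]

/-- An element of sp anticommuting with j is self-adjoint for ω(·, j·). This is why the condition
imposed on S^v is compatible with the symmetry of S. -/
theorem metricE_vertSpace_symm {A : TM n (twistorProj z) →L[ℝ] TM n (twistorProj z)}
    (hA : A ∈ vertSpace z) (u v : TM n (twistorProj z)) :
    metricE t z (A u) v = metricE t z (A v) u := by
  have h1 := hA.1 u (twistorPhi z v)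
  rw [hA.2, ContinuousLinearMap.map_neg] at h1
  have h2 : metricE t z u (A v) = t * om.form (twistorProj z) u (twistorPhi z (A v)) := rfl
  rw [metricE_symm (A v), h2, metricE]
  linear_combination t * h1

/-- The vertical part of the curvature endomorphism. -/
def vertCurv (nab : LinConnection n M) (z : TwistorSpace om) (u v : TM n (twistorProj z)) :
    TM n (twistorProj z) →L[ℝ] TM n (twistorProj z) := vertEnd z (curvEnd nab _ u v)

theorem vertEnd_add (A B : TM n (twistorProj z) →L[ℝ] TM n (twistorProj z)) :
    vertEnd z (A + B) = vertEnd z A + vertEnd z B := by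
  ext1 w; simp only [vertEnd, add_apply, smul_apply, ContinuousLinearMap.comp_apply,
    ContinuousLinearMap.map_add]; module

theorem vertEnd_smul (r : ℝ) (A : TM n (twistorProj z) →L[ℝ] TM n (twistorProj z)) :
    vertEnd z (r • A) = r • vertEnd z A := by
  ext1 w; simp only [vertEnd, add_apply, smul_apply, ContinuousLinearMap.comp_apply,
    ContinuousLinearMap.map_smul]; module

theorem curvatureForm_add_left (x : M) (u v w : ModelR n) :
    curvatureForm nab x (u + v) w = curvatureForm nab x u w + curvatureForm nab x v w := by
  simp only [curvatureForm, ContinuousLinearMap.map_add, add_apply, ContinuousLinearMap.add_comp,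
    ContinuousLinearMap.comp_add]
  abel

theorem curvatureForm_smul_left (x : M) (r : ℝ) (u w : ModelR n) :
    curvatureForm nab x (r • u) w = r • curvatureForm nab x u w := by
  simp only [curvatureForm, ContinuousLinearMap.map_smul, smul_apply, ContinuousLinearMap.smul_comp,
    ContinuousLinearMap.comp_smul, smul_add, smul_sub]

theorem curvatureForm_swap (x : M) (u w : ModelR n) :
    curvatureForm nab x u w = -curvatureForm nab x w u := by
  simp only [curvatureForm]
  abel

theorem vertCurv_add_left (u v w : TM n (twistorProj z)) :
    vertCurv nab z (u + v) w = vertCurv nab z u w + vertCurv nab z v w := by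
  rw [vertCurv, vertCurv, vertCurv, ← vertEnd_add]
  congr 1
  apply conjL_injective (mem_frameDom (twistorProj z))
  rw [conjL_add, conjL_curvEnd, conjL_curvEnd, conjL_curvEnd, ContinuousLinearMap.map_add,
    curvatureForm_add_left]

theorem vertCurv_smul_left (r : ℝ) (u w : TM n (twistorProj z)) :
    vertCurv nab z (r • u) w = r • vertCurv nab z u w := by
  rw [vertCurv, vertCurv, ← vertEnd_smul]
  congr 1
  apply conjL_injective (mem_frameDom (twistorProj z))
  rw [conjL_smul, conjL_curvEnd, conjL_curvEnd, ContinuousLinearMap.map_smul,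
    curvatureForm_smul_left]

theorem vertCurv_swap (u w : TM n (twistorProj z)) :
    vertCurv nab z u w = -vertCurv nab z w u := by
  rw [← neg_one_smul ℝ, vertCurv, vertCurv, ← vertEnd_smul]
  congr 1
  apply conjL_injective (mem_frameDom (twistorProj z))
  rw [conjL_smul, conjL_curvEnd, conjL_curvEnd, curvatureForm_swap]
  exact (neg_one_smul ℝ _).symm

theorem vertCurv_add_right (u v w : TM n (twistorProj z)) :
    vertCurv nab z u (v + w) = vertCurv nab z u v + vertCurv nab z u w := by
  rw [vertCurv_swap, vertCurv_add_left, vertCurv_swap v, vertCurv_swap w]; abel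

theorem vertCurv_smul_right (r : ℝ) (u w : TM n (twistorProj z)) :
    vertCurv nab z u (r • w) = r • vertCurv nab z u w := by
  rw [vertCurv_swap, vertCurv_smul_left, vertCurv_swap w, smul_neg, neg_neg]

theorem vertCurv_zero_left (w : TM n (twistorProj z)) : vertCurv nab z 0 w = 0 := by
  simpa using vertCurv_smul_left (nab := nab) 0 0 w

theorem vertCurv_zero_right (w : TM n (twistorProj z)) : vertCurv nab z w 0 = 0 := by
  rw [vertCurv_swap, vertCurv_zero_left, neg_zero]

variable
  [ChartedSpace (EuclideanSpace ℝ (Fin (n * (n + 3)))) (TwistorSpace om)] [IsTwistorManifold om]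

/-- Horizontal and vertical spaces are orthogonal; this form depends only on the pairs (π_*, P) of
the two vectors. -/
theorem twistorMetric_split (hnab : IsSymplecticConnection om nab) (ξ η : TZ z) :
    twistorMetric nab t z ξ η =
      metricE t z (dProj z ξ) (dProj z η) + vertForm z (twistorP nab z ξ) (twistorP nab z η) := by
  have hx := mem_frameDom (n := n) (twistorProj z)
  rw [twistorMetric_eq hnab t hx, frameJ, conjL_frameL hx, frameForm_frameL hx]
  rfl

theorem twistorMetric_symm (hnab : IsSymplecticConnection om nab) (ξ η : TZ z) :
    twistorMetric nab t z ξ η = twistorMetric nab t z η ξ := by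
  rw [twistorMetric_split hnab, twistorMetric_split hnab, metricE_symm, vertForm_symm]

theorem twistorMetric_add_left (hnab : IsSymplecticConnection om nab) (ξ η ζ : TZ z) :
    twistorMetric nab t z (ξ + η) ζ = twistorMetric nab t z ξ ζ + twistorMetric nab t z η ζ := by
  simp only [twistorMetric_split hnab, ContinuousLinearMap.map_add, twistorP_add, metricE_add_left,
    vertForm_add_left]
  ring

theorem twistorMetric_smul_left (hnab : IsSymplecticConnection om nab) (r : ℝ) (ξ η : TZ z) :
    twistorMetric nab t z (r • ξ) η = r * twistorMetric nab t z ξ η := by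
  simp only [twistorMetric_split hnab, ContinuousLinearMap.map_smul, twistorP_smul,
    metricE_smul_left, vertForm_smul_left]
  ring

theorem twistorMetric_add_right (hnab : IsSymplecticConnection om nab) (ξ η ζ : TZ z) :
    twistorMetric nab t z ξ (η + ζ) = twistorMetric nab t z ξ η + twistorMetric nab t z ξ ζ := by
  simp only [twistorMetric_symm hnab ξ, twistorMetric_add_left hnab]

theorem twistorMetric_smul_right (hnab : IsSymplecticConnection om nab) (r : ℝ) (ξ η : TZ z) :
    twistorMetric nab t z ξ (r • η) = r * twistorMetric nab t z ξ η := by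
  simp only [twistorMetric_symm hnab ξ, twistorMetric_smul_left hnab]

theorem twistorMetric_sub_left (hnab : IsSymplecticConnection om nab) (ξ η ζ : TZ z) :
    twistorMetric nab t z (ξ - η) ζ = twistorMetric nab t z ξ ζ - twistorMetric nab t z η ζ := by
  rw [sub_eq_add_neg, ← neg_one_smul ℝ, twistorMetric_add_left hnab, twistorMetric_smul_left hnab]
  ring

/-- Pairing with the horizontal lift of π_*ξ uses t > 0 and the positivity of ω(·, j·); pairing with
the vertical part of ξ uses that Tr A² vanishes only for A = 0. -/
theorem eq_zero_of_twistorMetric (hnab : IsSymplecticConnection om nab) (ht : 0 < t) {ξ : TZ z}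
    (h : ∀ η, twistorMetric nab t z ξ η = 0) : ξ = 0 := by
  apply eq_zero_of_dProj_of_twistorP (nab := nab)
  · obtain ⟨η, h1, h2⟩ := exists_tangent hnab z (dProj z ξ) (vertSpace z).zero_mem
    have h3 := h η
    rw [twistorMetric_split hnab, h1, h2, vertForm_zero_right, add_zero, metricE] at h3
    by_contra hne
    have h4 : 0 < om.form (twistorProj z) (dProj z ξ) (twistorPhi z (dProj z ξ)) := z.2.pos _ hne
    exact (mul_pos ht h4).ne' h3
  · obtain ⟨η, h1, h2⟩ := exists_tangent hnab z 0 (twistorP_mem hnab z ξ)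
    have h3 := h η
    rw [twistorMetric_split hnab, h1, h2, metricE_zero_right, zero_add] at h3
    exact eq_zero_of_vertForm (twistorP_mem hnab z ξ) h3

theorem eq_of_twistorMetric (hnab : IsSymplecticConnection om nab) (ht : 0 < t) {ξ η : TZ z}
    (h : ∀ ζ, twistorMetric nab t z ξ ζ = twistorMetric nab t z η ζ) : ξ = η := by
  rw [← sub_eq_zero]
  refine eq_zero_of_twistorMetric hnab ht fun ζ ↦ ?_
  rw [twistorMetric_sub_left hnab, h, sub_self]

theorem vertPart_spec (hnab : IsSymplecticConnection om nab) (ξ : TZ z) :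
    dProj z (vertPart nab z ξ) = 0 ∧ twistorP nab z (vertPart nab z ξ) = twistorP nab z ξ :=
  twistorLift_spec hnab (twistorP_mem hnab z ξ)

theorem horLift_spec (hnab : IsSymplecticConnection om nab) (v : TM n (twistorProj z)) :
    dProj z (horLift nab z v) = v ∧ twistorP nab z (horLift nab z v) = 0 :=
  twistorLift_spec hnab (vertSpace z).zero_mem

theorem horPart_spec (hnab : IsSymplecticConnection om nab) (ξ : TZ z) :
    dProj z (horPart nab z ξ) = dProj z ξ ∧ twistorP nab z (horPart nab z ξ) = 0 :=
  twistorLift_spec hnab (vertSpace z).zero_mem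

omit [IsTwistorManifold om] in
theorem isHorizontal_iff (ξ : TZ z) : IsHorizontal nab z ξ ↔ twistorP nab z ξ = 0 := by
  rw [IsHorizontal, twistorP]
  constructor
  · intro h
    rw [h, ContinuousLinearMap.zero_comp, smul_zero]
  · intro h
    ext1 v
    have h1 := DFunLike.congr_fun h (twistorPhi z v)
    have h2 : twistorPhi z (twistorPhi z v) = -v := z.2.sq v
    simp only [smul_apply, ContinuousLinearMap.comp_apply, h2, ContinuousLinearMap.map_neg,
      zero_apply] at h1
    simpa using h1

/-- The trilinear form `⟨S(X, Y), W⟩` that determines the tensor `S`. -/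
def tensorForm (nab : LinConnection n M) (t : ℝ) (z : TwistorSpace om) (X Y W : TZ z) : ℝ :=
  metricE t z (twistorP nab z W (dProj z X)) (dProj z Y) +
    1 / 2 * vertForm z (vertCurv nab z (dProj z X) (dProj z W)) (twistorP nab z Y) +
    1 / 2 * vertForm z (vertCurv nab z (dProj z Y) (dProj z W)) (twistorP nab z X)

theorem exists_tensorForm (hnab : IsSymplecticConnection om nab) (ht : 0 < t)
    (z : TwistorSpace om) : ∃ S : TZ z →L[ℝ] TZ z →L[ℝ] TZ z, ∀ X Y W,
      twistorMetric nab t z (S X Y) W = tensorForm nab t z X Y W := by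
  have : T2Space (TZ z) := inferInstanceAs (T2Space (EuclideanSpace ℝ (Fin (n * (n + 3)))))
  apply exists_bilin_of_nondegenerate (twistorMetric_add_left hnab) (twistorMetric_smul_left hnab)
    (twistorMetric_add_right hnab) (twistorMetric_smul_right hnab)
    fun _ ↦ eq_zero_of_twistorMetric hnab ht
  all_goals
    intros
    simp only [tensorForm, ContinuousLinearMap.map_add, ContinuousLinearMap.map_smul, twistorP_add,
      twistorP_smul, add_apply, smul_apply,
      metricE_add_left, metricE_add_right, metricE_smul_left, metricE_smul_right, vertCurv_add_left,
      vertCurv_add_right, vertCurv_smul_left, vertCurv_smul_right, vertForm_add_left,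
      vertForm_add_right, vertForm_smul_left, vertForm_smul_right]
    ring

theorem tensorForm_symm (hnab : IsSymplecticConnection om nab) (X Y W : TZ z) :
    tensorForm nab t z X Y W = tensorForm nab t z Y X W := by
  rw [tensorForm, tensorForm, metricE_vertSpace_symm (twistorP_mem hnab z W)]
  ring

theorem twistorMetric_vertPart (hnab : IsSymplecticConnection om nab) (ξ η : TZ z) :
    twistorMetric nab t z (vertPart nab z ξ) η = twistorMetric nab t z ξ (vertPart nab z η) := by
  simp only [twistorMetric_split hnab, (vertPart_spec hnab _).1, (vertPart_spec hnab _).2,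
    metricE_zero_left, metricE_zero_right]

theorem twistorMetric_horPart (hnab : IsSymplecticConnection om nab) (ξ η : TZ z) :
    twistorMetric nab t z (horPart nab z ξ) η = twistorMetric nab t z ξ (horPart nab z η) := by
  simp only [twistorMetric_split hnab, (horPart_spec hnab _).1, (horPart_spec hnab _).2,
    vertForm_zero_left, vertForm_zero_right]

theorem horPart_add_vertPart (hnab : IsSymplecticConnection om nab) (ξ : TZ z) :
    horPart nab z ξ + vertPart nab z ξ = ξ := by
  apply tangent_ext (nab := nab)
  · rw [ContinuousLinearMap.map_add, (horPart_spec hnab _).1, (vertPart_spec hnab _).1, add_zero]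
  · rw [twistorP_add, (horPart_spec hnab _).2, (vertPart_spec hnab _).2, zero_add]

theorem twistorMetric_vertCurvature [T2Space M] (hnab : IsSymplecticConnection om nab)
    (X Y B : TZ z) : twistorMetric nab t z (vertCurvature nab z X Y) B =
      vertForm z (vertCurv nab z (dProj z X) (dProj z Y)) (twistorP nab z B) := by
  rw [twistorMetric_split hnab, (vertCurvature_spec hnab z X Y).1,
    (vertCurvature_spec hnab z X Y).2,
    metricE_zero_left, zero_add]
  rfl

-- Split X, Y and W into horizontal and vertical parts: the conditions on S prescribe every pairing,
-- and the values add up to one trilinear expression. This gives the uniqueness of S.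
set_option maxHeartbeats 600000 in
theorem IsTensorS.eq_tensorForm [T2Space M] (hnab : IsSymplecticConnection om nab)
    {S : Π z : TwistorSpace om, TZ z →L[ℝ] TZ z →L[ℝ] TZ z} (hS : IsTensorS nab t S)
    (z : TwistorSpace om) (X Y W : TZ z) :
    twistorMetric nab t z (S z X Y) W = tensorForm nab t z X Y W := by
  have hh : ∀ ξ : TZ z, IsHorizontal nab z (horPart nab z ξ) := fun ξ ↦
    (isHorizontal_iff _).2 (horPart_spec hnab ξ).2
  have hv : ∀ ξ : TZ z, IsVertical z (vertPart nab z ξ) := fun ξ ↦ (vertPart_spec hnab ξ).1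
  have e1 := hS.vert z X Y _ (hv W)
  rw [(vertPart_spec hnab _).2, twistorMetric_vertPart hnab, ] at e1
  have e1' : twistorMetric nab t z (S z X Y) (vertPart nab z W) =
      metricE t z (twistorP nab z W (dProj z X)) (dProj z Y) := by
    rw [← e1]
    simp only [twistorMetric_split hnab, (vertPart_spec hnab _).1, (vertPart_spec hnab _).2]
  have e2 := hS.hor z X _ _ (hv Y) (hh W)
  have e3 := hS.hor z (horPart nab z Y) _ _ (hv X) (hh W)
  have e4 := hS.hor_hor z _ _ (hh X) (hh Y)
  rw [twistorMetric_horPart hnab, twistorMetric_vertCurvature hnab] at e2 e3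
  rw [(vertPart_spec hnab _).2, (horPart_spec hnab _).1] at e2 e3
  rw [(horPart_spec hnab _).1] at e3
  have e4' : twistorMetric nab t z (S z (horPart nab z X) (horPart nab z Y))
      (horPart nab z W) = 0 := by
    rw [← twistorMetric_horPart hnab, e4, twistorMetric_split hnab, ContinuousLinearMap.map_zero,
      twistorP_zero,
      metricE_zero_left, vertForm_zero_left, add_zero]
  have hhW : horPart nab z (horPart nab z W) = horPart nab z W :=
    tangent_ext (nab := nab) (horPart_spec hnab _).1
      ((horPart_spec hnab _).2.trans (horPart_spec hnab _).2.symm)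
  rw [hhW] at e2 e3
  -- Three terms are enough instead of four, because the condition on S^h leaves the other argument
  -- arbitrary when one is vertical.
  have e5 : S z X Y = S z (horPart nab z X) (horPart nab z Y) +
      S z (horPart nab z Y) (vertPart nab z X) + S z X (vertPart nab z Y) := by
    rw [hS.symm z (horPart nab z Y) (vertPart nab z X)]
    exact bilin_split _ (horPart_add_vertPart hnab X) (horPart_add_vertPart hnab Y)
  have e6 : twistorMetric nab t z (S z X Y) (horPart nab z W) =
      1 / 2 * vertForm z (vertCurv nab z (dProj z Y) (dProj z W)) (twistorP nab z X) +
      1 / 2 * vertForm z (vertCurv nab z (dProj z X) (dProj z W)) (twistorP nab z Y) := by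
    rw [e5, twistorMetric_add_left hnab, twistorMetric_add_left hnab, e2, e3, e4', zero_add]
  have e7 := twistorMetric_add_right (t := t) hnab (S z X Y) (horPart nab z W) (vertPart nab z W)
  rw [horPart_add_vertPart hnab] at e7
  rw [e7, e1', e6, tensorForm]
  ring

set_option maxHeartbeats 600000 in
theorem isTensorS_of_eq_tensorForm [T2Space M] (hnab : IsSymplecticConnection om nab) (ht : 0 < t)
    {S : Π z : TwistorSpace om, TZ z →L[ℝ] TZ z →L[ℝ] TZ z}
    (hS : ∀ z X Y W, twistorMetric nab t z (S z X Y) W = tensorForm nab t z X Y W) :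
    IsTensorS nab t S := by
  refine ⟨fun z X Y ↦ ?_, fun z X Y A hA ↦ ?_, fun z X B Y hB hY ↦ ?_, fun z X Y hX hY ↦ ?_⟩
  · refine eq_of_twistorMetric hnab ht fun W ↦ ?_
    rw [hS, hS, tensorForm_symm hnab]
  · have hA' : vertPart nab z A = A := tangent_ext (nab := nab)
      ((vertPart_spec hnab _).1.trans hA.symm) (vertPart_spec hnab _).2
    rw [twistorMetric_vertPart hnab, hA', hS, tensorForm, show dProj z A = 0 from hA,
      vertCurv_zero_right, vertCurv_zero_right, vertForm_zero_left, vertForm_zero_left]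
    ring
  · rw [isHorizontal_iff] at hY
    have hY' : horPart nab z Y = Y := tangent_ext (nab := nab)
      (horPart_spec hnab _).1 ((horPart_spec hnab _).2.trans hY.symm)
    rw [twistorMetric_horPart hnab, hY', hS, twistorMetric_vertCurvature hnab, tensorForm, hY,
      show dProj z B = 0 from hB, vertCurv_zero_left, vertForm_zero_left, metricE_zero_right]
    ring
  · rw [isHorizontal_iff] at hX hY
    refine eq_zero_of_twistorMetric hnab ht fun W ↦ ?_
    rw [twistorMetric_horPart hnab, hS, tensorForm, hX, hY, (horPart_spec hnab _).2, zero_apply,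
      vertForm_zero_right, vertForm_zero_right, metricE_zero_left]
    ring

theorem existsUnique_tensorS [T2Space M] (hnab : IsSymplecticConnection om nab) (ht : 0 < t) :
    ∃! S : Π z : TwistorSpace om, TZ z →L[ℝ] TZ z →L[ℝ] TZ z, IsTensorS nab t S := by
  choose S hS using exists_tensorForm (om := om) hnab ht
  refine ⟨S, isTensorS_of_eq_tensorForm hnab ht hS, fun S' hS' ↦ ?_⟩
  funext z
  ext1 X
  ext1 Y
  exact eq_of_twistorMetric hnab ht fun W ↦ by
    rw [hS, IsTensorS.eq_tensorForm hnab hS']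

/-- Apart from S^h(X, Y), which is a defining condition, everything is read off from `tensorForm`:
in the relevant pairings each of its terms contains π_* of a vertical vector. -/
theorem IsTensorS.vanishing [T2Space M] (hnab : IsSymplecticConnection om nab) (ht : 0 < t)
    {S : Π z : TwistorSpace om, TZ z →L[ℝ] TZ z →L[ℝ] TZ z} (hS : IsTensorS nab t S)
    {X Y A B : TZ z} (hX : IsHorizontal nab z X) (hY : IsHorizontal nab z Y) (hA : IsVertical z A)
    (hB : IsVertical z B) : vertPart nab z (S z X A) = 0 ∧ vertPart nab z (S z A B) = 0 ∧
      horPart nab z (S z X Y) = 0 ∧ horPart nab z (S z A B) = 0 := by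
  have hT := hS.eq_tensorForm hnab
  have hv : ∀ C : TZ z, vertPart nab z (S z C A) = 0 := fun C ↦ by
    refine eq_zero_of_twistorMetric hnab ht fun W ↦ ?_
    rw [twistorMetric_vertPart hnab, hT, tensorForm, show dProj z A = 0 from hA,
      (vertPart_spec hnab _).1, vertCurv_zero_right, vertCurv_zero_right, vertForm_zero_left,
      vertForm_zero_left, metricE_zero_right]
    ring
  refine ⟨hv X, ?_, hS.hor_hor z X Y hX hY, ?_⟩
  · rw [hS.symm, hv]
  · refine eq_zero_of_twistorMetric hnab ht fun W ↦ ?_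
    rw [twistorMetric_horPart hnab, hT, tensorForm, show dProj z A = 0 from hA,
      show dProj z B = 0 from hB, vertCurv_zero_left, vertForm_zero_left,
      vertForm_zero_left, metricE_zero_right]
    ring

end FibreAlgebra

/-- The implicit function parametrizes the fibre of `p` through `a` by the kernel of p', with the
inclusion as derivative at 0; `f` is constant along it. Differentiability of `f` at `a` alone is
enough. -/
theorem fderiv_eq_zero_of_const_on_fibre {E F G : Type*} [NormedAddCommGroup E] [NormedSpace ℝ E]
    [CompleteSpace E] [NormedAddCommGroup F] [NormedSpace ℝ F] [FiniteDimensional ℝ F]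
    [NormedAddCommGroup G] [NormedSpace ℝ G] {p : E → F} {p' : E →L[ℝ] F} {f : E → G} {a : E}
    (hp : HasStrictFDerivAt p p' a) (hsurj : p'.range = ⊤) (hf : DifferentiableAt ℝ f a)
    (hconst : ∀ᶠ y in 𝓝 a, p y = p a → f y = f a) {v : E} (hv : p' v = 0) :
    fderiv ℝ f a v = 0 := by
  have h0 : hp.implicitFunction p p' hsurj (p a) 0 = a := hp.implicitFunction_apply_image hsurj
  have ht : Filter.Tendsto (hp.implicitFunction p p' hsurj (p a)) (𝓝 0) (𝓝 a) :=
    hp.tendsto_implicitFunction hsurj tendsto_const_nhds Filter.tendsto_id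
  have h1 : ∀ᶠ w in 𝓝 (0 : p'.ker), p (hp.implicitFunction p p' hsurj (p a) w) = p a :=
    (Continuous.prodMk_right (p a)).tendsto (0 : p'.ker) |>.eventually
      (hp.map_implicitFunction_eq hsurj)
  have h2 : (fun w ↦ f (hp.implicitFunction p p' hsurj (p a) w)) =ᶠ[𝓝 0] fun _ ↦ f a := by
    filter_upwards [h1, ht.eventually hconst] with w hw hw' using hw' hw
  have h3 : HasFDerivAt (fun w ↦ f (hp.implicitFunction p p' hsurj (p a) w))
      (fderiv ℝ f a ∘L p'.ker.subtypeL) 0 := by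
    refine HasFDerivAt.comp (f := hp.implicitFunction p p' hsurj (p a)) 0 ?_
      (hp.to_implicitFunction hsurj).hasFDerivAt
    rw [h0]
    exact hf.hasFDerivAt
  have h4 := (h3.congr_of_eventuallyEq h2.symm).unique (hasFDerivAt_const (f a) (0 : p'.ker))
  exact DFunLike.congr_fun h4 ⟨v, hv⟩

theorem mvfderiv_eq_zero_of_const_on_fibre {E F G : Type*} [NormedAddCommGroup E] [NormedSpace ℝ E]
    [CompleteSpace E] [NormedAddCommGroup F] [NormedSpace ℝ F] [FiniteDimensional ℝ F]
    [NormedAddCommGroup G] [NormedSpace ℝ G] {H : Type*} [TopologicalSpace H]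
    {I : ModelWithCorners ℝ E H} [I.Boundaryless] {Z : Type*} [TopologicalSpace Z]
    [ChartedSpace H Z] [IsManifold I ∞ Z] {p : Z → F} {f : Z → G} {z : Z}
    (hp : ContMDiffAt I 𝓘(ℝ, F) 1 p z) (hsurj : ∀ w, ∃ ξ, mvfderiv I p z ξ = w)
    (hf : MDifferentiableAt I 𝓘(ℝ, G) f z) (hconst : ∀ᶠ y in 𝓝 z, p y = p z → f y = f z)
    {ξ : TangentSpace I z} (hξ : mvfderiv I p z ξ = 0) : mvfderiv I f z ξ = 0 := by
  have hpd := hp.mdifferentiableAt one_ne_zero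
  have h1 : ContDiffAt ℝ 1 (p ∘ (extChartAt I z).symm) (extChartAt I z z) := by
    have := contMDiffAt_iff.1 hp |>.2
    rw [I.range_eq_univ] at this
    exact this.contDiffAt Filter.univ_mem
  have hs : p ((extChartAt I z).symm (extChartAt I z z)) = p z := congrArg p (extChartAt_to_inv z)
  have hs' : f ((extChartAt I z).symm (extChartAt I z z)) = f z := congrArg f (extChartAt_to_inv z)
  rw [hf.mvfderiv_eq_fderiv]
  refine fderiv_eq_zero_of_const_on_fibre (h1.hasStrictFDerivAt one_ne_zero)
    (LinearMap.range_eq_top.2 fun w ↦ ?_) hf.differentiableAt_comp_symm ?_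
    ((hpd.mvfderiv_eq_fderiv ξ).symm.trans hξ)
  · obtain ⟨η, hη⟩ := hsurj w
    exact ⟨η, (hpd.mvfderiv_eq_fderiv η).symm.trans hη⟩
  · have hc : Filter.Tendsto (extChartAt I z).symm (𝓝 (extChartAt I z z)) (𝓝 z) := by
      have := continuousAt_extChartAt_symm (I := I) z
      rwa [ContinuousAt, extChartAt_to_inv] at this
    filter_upwards [hc.eventually hconst] with y hy h
    simp only [Function.comp_apply, hs, hs'] at h ⊢
    exact hy h

/-- A field defined by pointwise choice, such as 𝒥Y, shows no regularity by itself; it is recovered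
here from its image under an injective family `G`. Composing the matrix of G with a left inverse R'
of its value at z gives K with K(z) = 1, and near z the components of Y are K⁻¹R'(GY). -/
theorem mdifferentiableAt_of_injective_family {E : Type*} [NormedAddCommGroup E] [NormedSpace ℝ E]
    [FiniteDimensional ℝ E]
    {H : Type*} [TopologicalSpace H] {I : ModelWithCorners ℝ E H}
    {Z : Type*} [TopologicalSpace Z] [ChartedSpace H Z] [IsManifold I ∞ Z]
    {W : Type*} [NormedAddCommGroup W] [NormedSpace ℝ W] [FiniteDimensional ℝ W]
    {z : Z} (G : Π z : Z, TangentSpace I z →ₗ[ℝ] W) (hinj : Function.Injective (G z))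
    (hG : ∀ Y : Π z : Z, TangentSpace I z,
      MDifferentiableAt I I.tangent (fun z ↦ (⟨z, Y z⟩ : TangentBundle I Z)) z →
      MDifferentiableAt I 𝓘(ℝ, W) (fun z ↦ G z (Y z)) z)
    {Y : Π z : Z, TangentSpace I z} (hY : MDifferentiableAt I 𝓘(ℝ, W) (fun z ↦ G z (Y z)) z) :
    MDifferentiableAt I I.tangent (fun z ↦ (⟨z, Y z⟩ : TangentBundle I Z)) z := by
  set t := trivializationAt E (TangentSpace I : Z → Type _) z with ht
  have hz : z ∈ t.baseSet := FiberBundle.mem_baseSet_trivializationAt' z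
  let b := Module.finBasis ℝ E
  let e : Fin (finrank ℝ E) → Π z : Z, TangentSpace I z := fun i z' ↦ t.symmL ℝ z' (b i)
  have he : ∀ i, MDifferentiableAt I I.tangent
      (fun z ↦ (⟨z, e i z⟩ : TangentBundle I Z)) z := fun i ↦ by
    refine (t.mdifferentiableAt_section_iff I _ hz).2
      ((mdifferentiableAt_const (c := b i)).congr_of_eventuallyEq ?_)
    filter_upwards [t.open_baseSet.mem_nhds hz] with z' hz'
    exact (t.continuousLinearMapAt_apply_of_mem ℝ hz' _).symm.trans
      (t.continuousLinearMapAt_symmL hz' _)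
  let C : Z → E := fun z' ↦ t.continuousLinearMapAt ℝ z' (Y z')
  let F : Z → E →L[ℝ] W := fun z' ↦
    ∑ i, (LinearMap.toContinuousLinearMap (b.coord i)).smulRight (G z' (e i z'))
  have hFapp : ∀ z' c, F z' c = G z' (t.symmL ℝ z' c) := fun z' c ↦ by
    have h1 : t.symmL ℝ z' c = ∑ i, b.repr c i • t.symmL ℝ z' (b i) := by
      conv_lhs => rw [← b.sum_repr c]
      rw [map_sum]
      simp only [map_smul]
    rw [h1, map_sum]
    simp [F, e]
  have hF : MDifferentiableAt I 𝓘(ℝ, E →L[ℝ] W) F z := by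
    have h1 : ∀ i ∈ Finset.univ, MDifferentiableAt I 𝓘(ℝ, E →L[ℝ] W) (fun z' ↦
      (LinearMap.toContinuousLinearMap (b.coord i)).smulRight (G z' (e i z'))) z := fun i _ ↦
      MDifferentiableAt.clm_const (F := W) (G := E →L[ℝ] W)
        (ContinuousLinearMap.smulRightL ℝ E W (LinearMap.toContinuousLinearMap (b.coord i)))
        (hG (e i) (he i))
    refine (MDifferentiableAt.sum (t := Finset.univ) (f := fun (i : Fin (finrank ℝ E)) (z' : Z) ↦
      (LinearMap.toContinuousLinearMap (b.coord i)).smulRight (G z' (e i z'))) h1).congr_of_eventuallyEq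
      (Filter.Eventually.of_forall fun y ↦ ?_)
    simp [F, Finset.sum_apply]
  have hFinj : Function.Injective (F z) := fun c d h ↦ by
    rw [hFapp, hFapp] at h
    have := congrArg (t.continuousLinearMapAt ℝ z) (hinj h)
    rwa [t.continuousLinearMapAt_symmL hz, t.continuousLinearMapAt_symmL hz] at this
  obtain ⟨R, hR⟩ := LinearMap.exists_leftInverse_of_injective (F z : E →ₗ[ℝ] W)
    (LinearMap.ker_eq_bot.2 hFinj)
  let R' : W →L[ℝ] E := LinearMap.toContinuousLinearMap R
  let K : Z → E →L[ℝ] E := fun z' ↦ R' ∘L F z'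
  have hK : MDifferentiableAt I 𝓘(ℝ, E →L[ℝ] E) K z :=
    (mdifferentiableAt_const (c := R')).clmComp hF
  have hKz : K z = 1 := by
    ext c
    exact LinearMap.congr_fun hR c
  have hinv : MDifferentiableAt I 𝓘(ℝ, E →L[ℝ] E) (fun z' ↦ Ring.inverse (K z')) z := by
    refine MDifferentiableAt.comp_differentiableAt (f := K) (h := Ring.inverse) ?_ hK
    rw [hKz]
    exact differentiableAt_inverse isUnit_one
  have hunit : ∀ᶠ z' in 𝓝 z, IsUnit (K z') := by
    refine hK.continuousAt.eventually_mem (Units.isOpen.mem_nhds ?_)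
    rw [hKz]
    exact isUnit_one
  rw [t.mdifferentiableAt_section_iff I _ hz]
  refine (hinv.clmApply (MDifferentiableAt.clm_const R' hY)).congr_of_eventuallyEq ?_
  filter_upwards [hunit, t.open_baseSet.mem_nhds hz] with z' hu hz'
  have h1 : R' (G z' (Y z')) = K z' (C z') := by
    simp only [K, C, ContinuousLinearMap.comp_apply, hFapp]
    rw [t.symmL_continuousLinearMapAt hz']
  have h2 : Ring.inverse (K z') (K z' (C z')) = C z' :=
    DFunLike.congr_fun (Ring.inverse_mul_cancel _ hu) (C z')
  rw [h1, h2]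
  exact (t.continuousLinearMapAt_apply_of_mem ℝ hz' _).symm

/-! ### The connection D plus the tensorial correction. -/

section TwistorConnections

variable {n : ℕ} {M : Type*} [TopologicalSpace M]
  [ChartedSpace (EuclideanSpace ℝ (Fin (2 * n))) M] [IsManifold (𝓡 (2 * n)) ∞ M]
  {om : SymplecticForm n M} {nab : LinConnection n M} {t : ℝ} {z : TwistorSpace om}
  [ChartedSpace (EuclideanSpace ℝ (Fin (n * (n + 3)))) (TwistorSpace om)]

variable [IsTwistorManifold om]

theorem frameK_add (ξ η : TZ z) : frameK nab z (ξ + η) = frameK nab z ξ + frameK nab z η := by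
  rw [frameK, frameK, frameK, twistorP_add, conjL_add, frameGamma, frameGamma, frameGamma,
    ContinuousLinearMap.map_add,
    ContinuousLinearMap.map_add, ContinuousLinearMap.map_add]
  abel

theorem frameK_smul (r : ℝ) (ξ : TZ z) : frameK nab z (r • ξ) = r • frameK nab z ξ := by
  rw [frameK, frameK, twistorP_smul, conjL_smul, frameGamma, frameGamma,
    ContinuousLinearMap.map_smul, ContinuousLinearMap.map_smul,
    ContinuousLinearMap.map_smul, smul_sub]

omit [IsTwistorManifold om] in
theorem fieldH_add (x₀ : M) (Y W : Π z : TwistorSpace om, TZ z) :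
    fieldH x₀ (Y + W) = fieldH x₀ Y + fieldH x₀ W :=
  funext fun z ↦ by simp only [fieldH, Pi.add_apply, ContinuousLinearMap.map_add]

theorem fieldV_add (x₀ : M) (Y W : Π z : TwistorSpace om, TZ z) :
    fieldV nab x₀ (Y + W) = fieldV nab x₀ Y + fieldV nab x₀ W :=
  funext fun z ↦ by simp only [fieldV, Pi.add_apply, twistorP_add, conjL_add]

omit [IsTwistorManifold om] in
theorem fieldH_smul (x₀ : M) (f : TwistorSpace om → ℝ) (Y : Π z : TwistorSpace om, TZ z) :
    fieldH x₀ (f • Y) = fun z ↦ f z • fieldH x₀ Y z :=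
  funext fun z ↦ by simp only [fieldH, Pi.smul_apply', ContinuousLinearMap.map_smul]

theorem fieldV_smul (x₀ : M) (f : TwistorSpace om → ℝ) (Y : Π z : TwistorSpace om, TZ z) :
    fieldV nab x₀ (f • Y) = fun z ↦ f z • fieldV nab x₀ Y z :=
  funext fun z ↦ by simp only [fieldV, Pi.smul_apply', twistorP_smul, conjL_smul]

theorem tangent_ext_frame {ξ η : TZ z}
    (h1 : frameL (twistorProj z) (twistorProj z) (dProj z ξ) =
      frameL (twistorProj z) (twistorProj z) (dProj z η))
    (h2 : conjL (twistorProj z) (twistorProj z) (twistorP nab z ξ) =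
      conjL (twistorProj z) (twistorProj z) (twistorP nab z η)) : ξ = η :=
  tangent_ext (nab := nab) (frameL_injective (mem_frameDom _) h1)
    (conjL_injective (mem_frameDom _) h2)

variable [T2Space M] {Y W : Π z : TwistorSpace om, TZ z}

theorem frameL_twistorD (hnab : IsSymplecticConnection om nab) (hY : IsDiffField Y z) (ξ : TZ z) :
    frameL (twistorProj z) (twistorProj z) (dProj z (twistorD nab Y z ξ)) =
      mvfderiv (𝓡 (n * (n + 3))) (fieldH (twistorProj z) Y) z ξ +
        frameK nab z ξ (fieldH (twistorProj z) Y z) := by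
  rw [(twistorD_spec hnab hY ξ).1, frameL_twistorDE]
  rfl

theorem conjL_twistorD (hnab : IsSymplecticConnection om nab) (hY : IsDiffField Y z) (ξ : TZ z) :
    conjL (twistorProj z) (twistorProj z) (twistorP nab z (twistorD nab Y z ξ)) =
      mvfderiv (𝓡 (n * (n + 3))) (fieldV nab (twistorProj z) Y) z ξ +
        (frameK nab z ξ ∘L fieldV nab (twistorProj z) Y z -
          fieldV nab (twistorProj z) Y z ∘L frameK nab z ξ) := by
  rw [(twistorD_spec hnab hY ξ).2, conjL_twistorDEnd]
  rfl

theorem twistorD_add_right (hnab : IsSymplecticConnection om nab) (hY : IsDiffField Y z)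
    (ξ η : TZ z) : twistorD nab Y z (ξ + η) = twistorD nab Y z ξ + twistorD nab Y z η := by
  apply tangent_ext_frame (nab := nab)
  · rw [ContinuousLinearMap.map_add, ContinuousLinearMap.map_add, frameL_twistorD hnab hY,
    frameL_twistorD hnab hY, frameL_twistorD hnab hY,
      frameK_add, ContinuousLinearMap.map_add, add_apply]
    abel
  · rw [twistorP_add, conjL_add, conjL_twistorD hnab hY, conjL_twistorD hnab hY,
      conjL_twistorD hnab hY, frameK_add, ContinuousLinearMap.map_add, ContinuousLinearMap.add_comp,
      ContinuousLinearMap.comp_add]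
    abel

theorem twistorD_smul_right (hnab : IsSymplecticConnection om nab) (hY : IsDiffField Y z)
    (r : ℝ) (ξ : TZ z) : twistorD nab Y z (r • ξ) = r • twistorD nab Y z ξ := by
  apply tangent_ext_frame (nab := nab)
  · rw [ContinuousLinearMap.map_smul, ContinuousLinearMap.map_smul, frameL_twistorD hnab hY,
    frameL_twistorD hnab hY,
      frameK_smul, ContinuousLinearMap.map_smul, smul_apply, smul_add]
  · rw [twistorP_smul, conjL_smul, conjL_twistorD hnab hY, conjL_twistorD hnab hY, frameK_smul,
      ContinuousLinearMap.map_smul, ContinuousLinearMap.smul_comp, ContinuousLinearMap.comp_smul,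
        smul_add, smul_sub]

theorem twistorD_add (hnab : IsSymplecticConnection om nab) (hY : IsDiffField Y z)
    (hW : IsDiffField W z) (hYW : IsDiffField (Y + W) z) (ξ : TZ z) :
    twistorD nab (Y + W) z ξ = twistorD nab Y z ξ + twistorD nab W z ξ := by
  have hx := mem_frameDom (n := n) (twistorProj z)
  apply tangent_ext_frame (nab := nab)
  · rw [ContinuousLinearMap.map_add, ContinuousLinearMap.map_add, frameL_twistorD hnab hY,
    frameL_twistorD hnab hW, frameL_twistorD hnab hYW,
      fieldH_add, Pi.add_apply, ContinuousLinearMap.map_add,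
      mvfderiv_add (mdifferentiableAt_fieldH hx hY) (mdifferentiableAt_fieldH hx hW), add_apply]
    abel
  · rw [twistorP_add, conjL_add, conjL_twistorD hnab hY, conjL_twistorD hnab hW,
      conjL_twistorD hnab hYW, fieldV_add, Pi.add_apply, ContinuousLinearMap.add_comp,
      ContinuousLinearMap.comp_add, mvfderiv_add (fieldV_deriv hnab.smooth hY).1
      (fieldV_deriv hnab.smooth hW).1, add_apply]
    abel

theorem twistorD_smul (hnab : IsSymplecticConnection om nab) {f : TwistorSpace om → ℝ}
    (hf : MDifferentiableAt (𝓡 (n * (n + 3))) 𝓘(ℝ, ℝ) f z) (hY : IsDiffField Y z)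
    (hfY : IsDiffField (f • Y) z) (ξ : TZ z) : twistorD nab (f • Y) z ξ =
      f z • twistorD nab Y z ξ + mvfderiv (𝓡 (n * (n + 3))) f z ξ • Y z := by
  have hx := mem_frameDom (n := n) (twistorProj z)
  have h1 := mvfderiv_bilin (ContinuousLinearMap.lsmul ℝ ℝ) hf (mdifferentiableAt_fieldH hx hY) ξ
  have h2 := mvfderiv_bilin (ContinuousLinearMap.lsmul ℝ ℝ) hf (fieldV_deriv hnab.smooth hY).1 ξ
  simp only [ContinuousLinearMap.lsmul_apply] at h1 h2
  have e1 : frameL (twistorProj z) (twistorProj z) (dProj z (Y z)) = fieldH (twistorProj z) Y z := rfl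
  have e2 : conjL (twistorProj z) (twistorProj z) (twistorP nab z (Y z)) =
    fieldV nab (twistorProj z) Y z := rfl
  apply tangent_ext_frame (nab := nab)
  · rw [ContinuousLinearMap.map_add, ContinuousLinearMap.map_smul, ContinuousLinearMap.map_smul,
    ContinuousLinearMap.map_add, ContinuousLinearMap.map_smul, ContinuousLinearMap.map_smul,
    frameL_twistorD hnab hY,
      frameL_twistorD hnab hfY, fieldH_smul, ContinuousLinearMap.map_smul, h1, e1]
    module
  · rw [twistorP_add, twistorP_smul, twistorP_smul, conjL_add, conjL_smul, conjL_smul,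
      conjL_twistorD hnab hY, conjL_twistorD hnab hfY, fieldV_smul, h2, e2,
      ContinuousLinearMap.smul_comp, ContinuousLinearMap.comp_smul]
    module

/-- The tensorial part of the Levi-Civita connection. -/
def lcTensor (nab : LinConnection n M) (S : Π z : TwistorSpace om, TZ z →L[ℝ] TZ z →L[ℝ] TZ z)
    (z : TwistorSpace om) (ξ η : TZ z) : TZ z :=
  -horLift nab z (twistorP nab z η (dProj z ξ)) - (1 / 2 : ℝ) • vertCurvature nab z ξ η + S z ξ η

variable {S : Π z : TwistorSpace om, TZ z →L[ℝ] TZ z →L[ℝ] TZ z}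

theorem dProj_lcTensor (hnab : IsSymplecticConnection om nab) (ξ η : TZ z) :
    dProj z (lcTensor nab S z ξ η) =
      -twistorP nab z η (dProj z ξ) + dProj z (S z ξ η) := by
  rw [lcTensor, ContinuousLinearMap.map_add, ContinuousLinearMap.map_sub,
    ContinuousLinearMap.map_neg, ContinuousLinearMap.map_smul, (horLift_spec hnab _).1,
    (vertCurvature_spec hnab z ξ η).1, smul_zero, sub_zero]

theorem twistorP_lcTensor (hnab : IsSymplecticConnection om nab) (ξ η : TZ z) :
    twistorP nab z (lcTensor nab S z ξ η) =
      -((1 / 2 : ℝ) • vertCurv nab z (dProj z ξ) (dProj z η)) + twistorP nab z (S z ξ η) := by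
  rw [lcTensor, twistorP_add, twistorP_sub, twistorP_neg, twistorP_smul, (horLift_spec hnab _).2,
    (vertCurvature_spec hnab z ξ η).2, neg_zero, zero_sub]
  rfl

theorem lcTensor_add_left (hnab : IsSymplecticConnection om nab) (ξ ξ' η : TZ z) :
    lcTensor nab S z (ξ + ξ') η = lcTensor nab S z ξ η + lcTensor nab S z ξ' η := by
  apply tangent_ext (nab := nab)
  · simp only [dProj_lcTensor hnab, ContinuousLinearMap.map_add, add_apply]
    abel
  · simp only [twistorP_lcTensor hnab, twistorP_add, ContinuousLinearMap.map_add, add_apply,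
    vertCurv_add_left, smul_add]
    abel

theorem lcTensor_smul_left (hnab : IsSymplecticConnection om nab) (r : ℝ) (ξ η : TZ z) :
    lcTensor nab S z (r • ξ) η = r • lcTensor nab S z ξ η := by
  apply tangent_ext (nab := nab)
  · simp only [dProj_lcTensor hnab, ContinuousLinearMap.map_smul, smul_apply, smul_add, smul_neg]
  · simp only [twistorP_lcTensor hnab, twistorP_smul, ContinuousLinearMap.map_smul, smul_apply,
    vertCurv_smul_left,
      smul_add, smul_neg, smul_comm r]

theorem lcTensor_add_right (hnab : IsSymplecticConnection om nab) (ξ η η' : TZ z) :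
    lcTensor nab S z ξ (η + η') = lcTensor nab S z ξ η + lcTensor nab S z ξ η' := by
  apply tangent_ext (nab := nab)
  · simp only [dProj_lcTensor hnab, ContinuousLinearMap.map_add, add_apply, twistorP_add]
    abel
  · simp only [twistorP_lcTensor hnab, twistorP_add, ContinuousLinearMap.map_add,
    vertCurv_add_right, smul_add]
    abel

theorem lcTensor_smul_right (hnab : IsSymplecticConnection om nab) (r : ℝ) (ξ η : TZ z) :
    lcTensor nab S z ξ (r • η) = r • lcTensor nab S z ξ η := by
  apply tangent_ext (nab := nab)
  · simp only [dProj_lcTensor hnab, ContinuousLinearMap.map_smul, smul_apply, smul_add, smul_neg,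
    twistorP_smul]
  · simp only [twistorP_lcTensor hnab, twistorP_smul, ContinuousLinearMap.map_smul,
    vertCurv_smul_right,
      smul_add, smul_neg, smul_comm r]

open Classical in
/-- The Levi-Civita connection, as a function on vector fields. -/
def lcFun (hnab : IsSymplecticConnection om nab)
    (S : Π z : TwistorSpace om, TZ z →L[ℝ] TZ z →L[ℝ] TZ z) (Y : Π z : TwistorSpace om, TZ z)
    (z : TwistorSpace om) : TZ z →L[ℝ] TZ z :=
  haveI : T2Space (TZ z) := inferInstanceAs (T2Space (EuclideanSpace ℝ (Fin (n * (n + 3)))))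
  -- Where `Y` is not differentiable, linearity of `twistorD` in ξ is not available and the value is
  -- set to zero; the axioms of a covariant derivative concern only differentiable fields.
  if hY : IsDiffField Y z then LinearMap.toContinuousLinearMap
    { toFun := fun ξ ↦ twistorD nab Y z ξ + lcTensor nab S z ξ (Y z)
      map_add' := fun ξ η ↦ by
        rw [twistorD_add_right hnab hY, lcTensor_add_left hnab, add_add_add_comm]
      map_smul' := fun r ξ ↦ by
        rw [twistorD_smul_right hnab hY, lcTensor_smul_left hnab, RingHom.id_apply, smul_add] }
  else 0

theorem lcFun_apply (hnab : IsSymplecticConnection om nab) (hY : IsDiffField Y z) (ξ : TZ z) :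
    lcFun hnab S Y z ξ = twistorD nab Y z ξ + lcTensor nab S z ξ (Y z) := by
  rw [lcFun, dif_pos hY]
  rfl

/-- The Levi-Civita connection given by the tensor `S`. -/
def lcConnection (hnab : IsSymplecticConnection om nab)
    (S : Π z : TwistorSpace om, TZ z →L[ℝ] TZ z →L[ℝ] TZ z) : TwistorConnection om where
  toFun := lcFun hnab S
  isCovariantDerivativeOnUniv :=
    { add := fun {Y W z} hY hW _ ↦ by
        have hYW : IsDiffField (Y + W) z := mdifferentiableAt_add_section hY hW
        ext1 ξ
        rw [add_apply, lcFun_apply hnab hYW, lcFun_apply hnab hY, lcFun_apply hnab hW,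
          twistorD_add hnab hY hW hYW, Pi.add_apply, lcTensor_add_right hnab, add_add_add_comm]
      leibniz := fun {Y f z} hY hf _ ↦ by
        have hfY : IsDiffField (f • Y) z := hf.smul_section hY
        ext1 ξ
        rw [add_apply, smul_apply, ContinuousLinearMap.smulRight_apply,
          lcFun_apply hnab hfY, lcFun_apply hnab hY,
          twistorD_smul hnab hf hY hfY, Pi.smul_apply', lcTensor_smul_right hnab, smul_add]
        abel }

end TwistorConnections

/-- The algebra behind the uniqueness of the Levi-Civita connection. -/
theorem eq_zero_of_symm_of_skew {V : Type*} {b : V → V → V → ℝ}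
    (h1 : ∀ x y w, b x y w = b y x w) (h2 : ∀ x y w, b x y w = -b x w y) (x y w : V) :
    b x y w = 0 := by
  have := h1 x y w
  have := h2 y x w
  have := h1 y w x
  have := h2 w y x
  have := h1 w x y
  have := h2 x w y
  linarith

/-! ### The Levi-Civita connection: formula, fibres, and the flat case. -/

section LeviCivita

variable {n : ℕ} {M : Type*} [TopologicalSpace M]
  [ChartedSpace (EuclideanSpace ℝ (Fin (2 * n))) M] [IsManifold (𝓡 (2 * n)) ∞ M]
  {om : SymplecticForm n M} {nab : LinConnection n M} {t : ℝ} {z : TwistorSpace om}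
  [ChartedSpace (EuclideanSpace ℝ (Fin (n * (n + 3)))) (TwistorSpace om)]
  [IsTwistorManifold om] [T2Space M] {Y W : Π z : TwistorSpace om, TZ z}
  {S : Π z : TwistorSpace om, TZ z →L[ℝ] TZ z →L[ℝ] TZ z}

theorem lcConnection_apply (hnab : IsSymplecticConnection om nab) (hY : IsDiffField Y z)
    (ξ : TZ z) : lcConnection hnab S Y z ξ = twistorD nab Y z ξ + lcTensor nab S z ξ (Y z) :=
  lcFun_apply hnab hY ξ

theorem twistorMetric_lcTensor (hnab : IsSymplecticConnection om nab) (hS : IsTensorS nab t S)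
    (ξ η ζ : TZ z) : twistorMetric nab t z (lcTensor nab S z ξ η) ζ =
      -metricE t z (twistorP nab z η (dProj z ξ)) (dProj z ζ) -
      1 / 2 * vertForm z (vertCurv nab z (dProj z ξ) (dProj z η)) (twistorP nab z ζ) +
      tensorForm nab t z ξ η ζ := by
  rw [← hS.eq_tensorForm hnab]
  simp only [twistorMetric_split hnab, dProj_lcTensor hnab, twistorP_lcTensor hnab,
    metricE_add_left,
    vertForm_add_left]
  rw [← neg_one_smul ℝ (twistorP nab z η (dProj z ξ)), ← neg_smul, metricE_smul_left,
    vertForm_smul_left]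
  ring

/-- After inserting `tensorForm`, the two terms in the metric of E are exchanged with opposite sign
under η ↔ ζ, so are the curvature terms containing ξ, and the remaining term is skew because R is.
-/
theorem lcTensor_skew (hnab : IsSymplecticConnection om nab) (hS : IsTensorS nab t S)
    (ξ η ζ : TZ z) : twistorMetric nab t z (lcTensor nab S z ξ η) ζ +
      twistorMetric nab t z η (lcTensor nab S z ξ ζ) = 0 := by
  rw [twistorMetric_symm hnab η, twistorMetric_lcTensor hnab hS, twistorMetric_lcTensor hnab hS,
    tensorForm, tensorForm, vertCurv_swap (dProj z ζ) (dProj z η), ← neg_one_smul ℝ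
    (vertCurv nab z (dProj z η) (dProj z ζ)), vertForm_smul_left]
  ring

/-- Antisymmetrizing the correction gives minus the torsion of D in both components; S drops out by
symmetry. -/
theorem torsion_lcConnection (hnab : IsSymplecticConnection om nab) (hS : IsTensorS nab t S) :
    (lcConnection hnab S).torsion = 0 := by
  rw [CovariantDerivative.torsion_eq_zero_iff]
  intro X Y z hX hY
  rw [lcConnection_apply hnab hY, lcConnection_apply hnab hX]
  apply tangent_ext (nab := nab)
  · have h := twistorDE_torsion hnab.torsion_free hX hY
    rw [ContinuousLinearMap.map_sub, ContinuousLinearMap.map_add, ContinuousLinearMap.map_add,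
      (twistorD_spec hnab hY _).1, (twistorD_spec hnab hX _).1,
      dProj_lcTensor hnab, dProj_lcTensor hnab, hS.symm z (X z) (Y z)]
    rw [sub_eq_iff_eq_add'] at h
    rw [sub_eq_iff_eq_add'] at h
    rw [h]
    abel
  · have h := twistorDEnd_torsion hnab.smooth hX hY
    rw [twistorP_sub, twistorP_add, twistorP_add, (twistorD_spec hnab hY _).2,
      (twistorD_spec hnab hX _).2, twistorP_lcTensor hnab, twistorP_lcTensor hnab,
      hS.symm z (X z) (Y z), vertCurv_swap (dProj z (Y z))]
    rw [sub_eq_iff_eq_add', sub_eq_iff_eq_add'] at h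
    rw [h, ← vertCurv]
    module

theorem isLeviCivita_lcConnection (hnab : IsSymplecticConnection om nab)
    (hS : IsTensorS nab t S) : IsLeviCivita nab t (lcConnection hnab S) := by
  refine ⟨torsion_lcConnection hnab hS, fun z Y W ξ hY hW ↦ ?_⟩
  rw [mvfderiv_twistorMetric hnab t hY hW, lcConnection_apply hnab hY, lcConnection_apply hnab hW,
    twistorMetric_add_left hnab, twistorMetric_add_right hnab]
  linear_combination -lcTensor_skew hnab hS ξ (Y z) (W z)

omit [T2Space M] in
theorem isDiffField_extend (v : TZ z) :
    IsDiffField (FiberBundle.extend (EuclideanSpace ℝ (Fin (n * (n + 3))))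
      (E := fun z : TwistorSpace om ↦ TZ z) v) z :=
  FiberBundle.mdifferentiableAt_extend (𝓡 (n * (n + 3))) (EuclideanSpace ℝ (Fin (n * (n + 3))))
    (V := fun z : TwistorSpace om ↦ TZ z) v

omit [T2Space M] in
theorem IsLeviCivita.unique (hnab : IsSymplecticConnection om nab) (ht : 0 < t)
    {con con' : TwistorConnection om} (h : IsLeviCivita nab t con) (h' : IsLeviCivita nab t con')
    (hY : IsDiffField Y z) (ξ : TZ z) : con Y z ξ = con' Y z ξ := by
  have htor := fun (X Y : Π z : TwistorSpace om, TZ z) (hX : IsDiffField X z) (hY : IsDiffField Y z) ↦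
    (CovariantDerivative.torsion_eq_zero_iff con).1 h.torsion_free hX hY
  have htor' := fun (X Y : Π z : TwistorSpace om, TZ z) (hX : IsDiffField X z) (hY : IsDiffField Y z) ↦
    (CovariantDerivative.torsion_eq_zero_iff con').1 h'.torsion_free hX hY
  let F : Set (Π z : TwistorSpace om, TZ z) := {Y | IsDiffField Y z}
  -- The difference of the connections is taken on fields differentiable at `z`, not on vectors: the
  -- algebraic lemma needs no linearity, so tensoriality does not have to be established.
  let b : F → F → F → ℝ := fun X Y W ↦
    twistorMetric nab t z (con Y.1 z (X.1 z) - con' Y.1 z (X.1 z)) (W.1 z)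
  have h1 : ∀ X Y W, b X Y W = b Y X W := fun X Y W ↦ by
    have e1 := htor X.1 Y.1 X.2 Y.2
    have e2 := htor' X.1 Y.1 X.2 Y.2
    have e3 : con Y.1 z (X.1 z) - con' Y.1 z (X.1 z) = con X.1 z (Y.1 z) - con' X.1 z (Y.1 z) := by
      rw [sub_eq_sub_iff_sub_eq_sub, e1, e2]
    exact congrArg (fun v ↦ twistorMetric nab t z v (W.1 z)) e3
  have h2 : ∀ X Y W, b X Y W = -b X W Y := fun X Y W ↦ by
    have e1 := h.metric z Y.1 W.1 (X.1 z) Y.2 W.2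
    have e2 := h'.metric z Y.1 W.1 (X.1 z) Y.2 W.2
    simp only [b, twistorMetric_sub_left hnab]
    rw [twistorMetric_symm hnab (Y.1 z)] at e1 e2
    linarith
  refine eq_of_twistorMetric hnab ht fun ζ ↦ ?_
  have h3 := eq_zero_of_symm_of_skew h1 h2 ⟨_, isDiffField_extend ξ⟩ ⟨Y, hY⟩ ⟨_, isDiffField_extend ζ⟩
  simp only [b, twistorMetric_sub_left hnab, FiberBundle.extend_apply_self] at h3
  linarith

theorem IsLeviCivita.apply (hnab : IsSymplecticConnection om nab) (ht : 0 < t)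
    {con : TwistorConnection om} (h : IsLeviCivita nab t con) (hS : IsTensorS nab t S)
    (hY : IsDiffField Y z) (ξ : TZ z) :
    con Y z ξ = twistorD nab Y z ξ + lcTensor nab S z ξ (Y z) :=
  (h.unique hnab ht (isLeviCivita_lcConnection hnab hS) hY ξ).trans (lcConnection_apply hnab hY ξ)

omit [IsTwistorManifold om] [T2Space M] in
theorem frameK_apply_eq_zero {Y : Π z : TwistorSpace om, TZ z} (hv : dProj z (Y z) = 0) (ξ : TZ z) :
    frameK nab z ξ (fieldH (twistorProj z) Y z) = 0 := by
  rw [fieldH, hv, ContinuousLinearMap.map_zero, ContinuousLinearMap.map_zero]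

/-- The fibres are totally geodesic. -/
theorem IsLeviCivita.isTotallyGeodesicFibre (hnab : IsSymplecticConnection om nab) (ht : 0 < t)
    {con : TwistorConnection om} (h : IsLeviCivita nab t con) (x : M) :
    IsTotallyGeodesicFibre con x := by
  obtain ⟨S, hS, -⟩ := existsUnique_tensorS (om := om) hnab ht
  rintro Y hYv z ξ rfl hY hξ
  have hx := mem_frameDom (n := n) (twistorProj z)
  have hYz : dProj z (Y z) = 0 := hYv z rfl
  have hξ' : dProj z ξ = 0 := hξ
  have hSz : dProj z (S z ξ (Y z)) = 0 := by
    -- The vanishing statement also asks for two horizontal vectors; the zero vector is supplied.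
    rw [← (horPart_spec hnab _).1, (hS.vanishing hnab ht
      ((isHorizontal_iff (nab := nab) (0 : TZ z)).2 (twistorP_zero z))
      ((isHorizontal_iff (nab := nab) (0 : TZ z)).2 (twistorP_zero z)) hξ (hYv z rfl)).2.2.2, ContinuousLinearMap.map_zero]
  -- π_*Y vanishes along the fibre, which near `z` is a level set of the submersion `projChart`, and
  -- ξ is in the kernel of its differential.
  have hd : mvfderiv (𝓡 (n * (n + 3))) (fieldH (twistorProj z) Y) z ξ = 0 := by
    refine mvfderiv_eq_zero_of_const_on_fibre (p := projChart (twistorProj z))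
      ((contMDiffAt_projChart hx).of_le (by simp)) (fun w ↦ ?_) (mdifferentiableAt_fieldH hx hY) ?_ ?_
    · obtain ⟨η, h1, -⟩ := exists_tangent hnab z (frameSymmL (twistorProj z) (twistorProj z) w)
        (vertSpace z).zero_mem
      exact ⟨η, by rw [← frameL_dProj hx, h1, frameL_symm hx]⟩
    · filter_upwards [eventually_twistorProj_mem hx] with y hy hyz
      have hxy : twistorProj y = twistorProj z := by
        exact (extChartAt (𝓡 (2 * n)) (twistorProj z)).injOn (by rwa [extChartAt_source])
          (by rw [extChartAt_source]; exact hx) hyz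
      rw [fieldH, fieldH, hYz, (show dProj y (Y y) = 0 from hYv y hxy),
        ContinuousLinearMap.map_zero, ContinuousLinearMap.map_zero]
    · rw [← frameL_dProj hx, hξ', ContinuousLinearMap.map_zero]
  apply frameL_injective hx
  rw [h.apply hnab ht hS hY, ContinuousLinearMap.map_add, ContinuousLinearMap.map_add,
    frameL_twistorD hnab hY, hd,
    frameK_apply_eq_zero hYz, dProj_lcTensor hnab, hξ', hSz]
  simp

omit [IsTwistorManifold om] [ChartedSpace (EuclideanSpace ℝ (Fin (n * (n + 3)))) (TwistorSpace om)]
  [T2Space M] in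
theorem metricE_phi_left (u v : TM n (twistorProj z)) :
    metricE t z (twistorPhi z u) v = -metricE t z u (twistorPhi z v) := by
  have h1 : om.form (twistorProj z) (twistorPhi z u) (twistorPhi z v) =
    om.form (twistorProj z) u v := z.2.inv _ _
  have h2 : twistorPhi z (twistorPhi z v) = -v := z.2.sq v
  rw [metricE, metricE, h1, h2, ContinuousLinearMap.map_neg]
  ring

omit [IsTwistorManifold om] [ChartedSpace (EuclideanSpace ℝ (Fin (n * (n + 3)))) (TwistorSpace om)]
  [T2Space M] in
theorem vertForm_phi_left {A : TM n (twistorProj z) →L[ℝ] TM n (twistorProj z)}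
    (hA : A ∈ vertSpace z) (B : TM n (twistorProj z) →L[ℝ] TM n (twistorProj z)) :
    vertForm z (twistorPhi z ∘L A) B = -vertForm z A (twistorPhi z ∘L B) := by
  have hx := mem_frameDom (n := n) (twistorProj z)
  have h1 : twistorPhi z ∘L A = (-1 : ℝ) • (A ∘L twistorPhi z) := by
    ext1 w
    have h2 := hA.2 w
    simp only [ContinuousLinearMap.comp_apply, smul_apply, h2]
    module
  rw [h1, vertForm_smul_left, neg_one_mul, vertForm, vertForm, conjL_comp hx, conjL_comp hx]
  rfl

omit [T2Space M] in
theorem twistorMetric_twistorJ (hnab : IsSymplecticConnection om nab) (ξ η : TZ z) :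
    twistorMetric nab t z (twistorJ nab z ξ) η = -twistorMetric nab t z ξ (twistorJ nab z η) := by
  rw [twistorMetric_split hnab, twistorMetric_split hnab, (twistorJ_spec hnab z ξ).1,
    (twistorJ_spec hnab z ξ).2, (twistorJ_spec hnab z η).1, (twistorJ_spec hnab z η).2,
    metricE_phi_left, vertForm_phi_left (twistorP_mem hnab z ξ)]
  ring

omit [T2Space M] in
theorem fieldH_twistorJ (hnab : IsSymplecticConnection om nab) {x₀ : M} {z : TwistorSpace om}
    (hz : twistorProj z ∈ frameDom n x₀) (Y : Π z : TwistorSpace om, TZ z) :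
    fieldH x₀ (fun z ↦ twistorJ nab z (Y z)) z = frameJ x₀ z (fieldH x₀ Y z) := by
  rw [fieldH, (twistorJ_spec hnab z _).1, ← conjL_frameL hz]
  rfl

omit [T2Space M] in
theorem fieldV_twistorJ (hnab : IsSymplecticConnection om nab) {x₀ : M} {z : TwistorSpace om}
    (hz : twistorProj z ∈ frameDom n x₀) (Y : Π z : TwistorSpace om, TZ z) :
    fieldV nab x₀ (fun z ↦ twistorJ nab z (Y z)) z = frameJ x₀ z ∘L fieldV nab x₀ Y z := by
  rw [fieldV, (twistorJ_spec hnab z _).2, conjL_comp hz]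
  rfl

omit [T2Space M] in
theorem eventually_fieldH_twistorJ (hnab : IsSymplecticConnection om nab) (z : TwistorSpace om)
    (Y : Π z : TwistorSpace om, TZ z) :
    fieldH (twistorProj z) (fun z ↦ twistorJ nab z (Y z)) =ᶠ[𝓝 z]
      fun z' ↦ frameJ (twistorProj z) z' (fieldH (twistorProj z) Y z') := by
  filter_upwards [eventually_twistorProj_mem (mem_frameDom (n := n) (twistorProj z))] with z' hz'
  exact fieldH_twistorJ hnab hz' Y

omit [T2Space M] in
theorem eventually_fieldV_twistorJ (hnab : IsSymplecticConnection om nab) (z : TwistorSpace om)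
    (Y : Π z : TwistorSpace om, TZ z) :
    fieldV nab (twistorProj z) (fun z ↦ twistorJ nab z (Y z)) =ᶠ[𝓝 z]
      fun z' ↦ frameJ (twistorProj z) z' ∘L fieldV nab (twistorProj z) Y z' := by
  filter_upwards [eventually_twistorProj_mem (mem_frameDom (n := n) (twistorProj z))] with z' hz'
  exact fieldV_twistorJ hnab hz' Y

/-- A tangent vector of the twistor space in the preferred trivialization at `x₀`. -/
def tangentFrame (nab : LinConnection n M) (x₀ : M) (z : TwistorSpace om) :
    TZ z →ₗ[ℝ] ModelR n × (ModelR n →L[ℝ] ModelR n) where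
  toFun ξ := (frameL x₀ (twistorProj z) (dProj z ξ), conjL x₀ (twistorProj z) (twistorP nab z ξ))
  map_add' ξ η := by
    rw [ContinuousLinearMap.map_add, ContinuousLinearMap.map_add, twistorP_add, conjL_add]
    rfl
  map_smul' r ξ := by
    rw [ContinuousLinearMap.map_smul, ContinuousLinearMap.map_smul, twistorP_smul, conjL_smul]
    rfl

/-- In the frame, 𝒥 multiplies both components by the differentiable matrix function J, and the pair
(π_*, P) is an injective family. -/
theorem isDiffField_twistorJ (hnab : IsSymplecticConnection om nab) (hY : IsDiffField Y z) :
    IsDiffField (fun z ↦ twistorJ nab z (Y z)) z := by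
  have hx := mem_frameDom (n := n) (twistorProj z)
  refine mdifferentiableAt_of_injective_family (tangentFrame nab (twistorProj z)) ?_ ?_ ?_
  · intro ξ η h
    have h' := Prod.ext_iff.1 h
    exact tangent_ext_frame (nab := nab) h'.1 h'.2
  · intro W hW
    exact (mdifferentiableAt_fieldH hx hW).prodMk_space (fieldV_deriv hnab.smooth hW).1
  · have h1 := ((mdifferentiableAt_frameJ hx).clmApply
      (mdifferentiableAt_fieldH hx hY)).congr_of_eventuallyEq (eventually_fieldH_twistorJ hnab z Y)
    have h2 := ((mdifferentiableAt_frameJ hx).clmComp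
      (fieldV_deriv hnab.smooth hY).1).congr_of_eventuallyEq (eventually_fieldV_twistorJ hnab z Y)
    exact h1.prodMk_space h2

/-- Since DΦ = 0, multiplication by Φ commutes with D on E and on 𝒱. Flatness plays no role here. -/
theorem twistorD_twistorJ (hnab : IsSymplecticConnection om nab) (hY : IsDiffField Y z)
    (ξ : TZ z) : twistorD nab (fun z ↦ twistorJ nab z (Y z)) z ξ =
      twistorJ nab z (twistorD nab Y z ξ) := by
  have hx := mem_frameDom (n := n) (twistorProj z)
  have hJY := isDiffField_twistorJ hnab hY
  apply tangent_ext_frame (nab := nab)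
  · rw [frameL_twistorD hnab hJY, (eventually_fieldH_twistorJ hnab z Y).mvfderiv_eq,
      fieldH_twistorJ hnab hx, mvfderiv_clmApply (mdifferentiableAt_frameJ hx)
        (mdifferentiableAt_fieldH hx hY), mvfderiv_frameJ, (twistorJ_spec hnab z _).1,
      ← conjL_frameL hx, frameL_twistorD hnab hY]
    simp only [frameJ, ContinuousLinearMap.map_add, sub_apply, ContinuousLinearMap.comp_apply]
    abel
  · rw [conjL_twistorD hnab hJY, (eventually_fieldV_twistorJ hnab z Y).mvfderiv_eq,
      fieldV_twistorJ hnab hx, mvfderiv_clmComp (mdifferentiableAt_frameJ hx)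
        (fieldV_deriv hnab.smooth hY).1, mvfderiv_frameJ, (twistorJ_spec hnab z _).2,
      conjL_comp hx, conjL_twistorD hnab hY]
    ext1 w
    simp only [frameJ, ContinuousLinearMap.map_add, ContinuousLinearMap.map_sub, add_apply,
      sub_apply, ContinuousLinearMap.comp_apply]
    abel

omit [ChartedSpace (EuclideanSpace ℝ (Fin (n * (n + 3)))) (TwistorSpace om)]
  [IsTwistorManifold om] in
theorem IsFlat.vertCurv_eq_zero (hnab : IsSymplecticConnection om nab) (hf : IsFlat nab)
    (u v : TM n (twistorProj z)) : vertCurv nab z u v = 0 := by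
  have h : curvEnd nab (twistorProj z) u v = 0 := by
    ext1 w
    rw [curvEnd_apply hnab.smooth, hf]
    rfl
  rw [vertCurv, h, vertEnd, ContinuousLinearMap.zero_comp, ContinuousLinearMap.comp_zero, add_zero,
    smul_zero]

/-- Without curvature the correction pairs with ζ to -⟨Pη(π_*ξ), π_*ζ⟩ + ⟨Pζ(π_*ξ), π_*η⟩. As P𝒥 =
jP and j is skew for the metric of E, replacing η by 𝒥η amounts to replacing ζ by -𝒥ζ. -/
theorem lcTensor_twistorJ (hnab : IsSymplecticConnection om nab) (ht : 0 < t)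
    (hS : IsTensorS nab t S) (hf : IsFlat nab) (ξ η : TZ z) :
    lcTensor nab S z ξ (twistorJ nab z η) = twistorJ nab z (lcTensor nab S z ξ η) := by
  refine eq_of_twistorMetric hnab ht fun ζ ↦ ?_
  rw [twistorMetric_twistorJ hnab, twistorMetric_lcTensor hnab hS, twistorMetric_lcTensor hnab hS,
    tensorForm, tensorForm]
  simp only [hf.vertCurv_eq_zero hnab, vertForm_zero_left, (twistorJ_spec hnab z _).1,
    (twistorJ_spec hnab z _).2, ContinuousLinearMap.comp_apply, metricE_phi_left]
  ring

/-- For a flat connection, the almost complex structure is parallel. -/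
theorem IsLeviCivita.apply_twistorJ (hnab : IsSymplecticConnection om nab) (ht : 0 < t)
    {con : TwistorConnection om} (h : IsLeviCivita nab t con) (hf : IsFlat nab)
    (hY : IsDiffField Y z) (ξ : TZ z) :
    con (fun z' ↦ twistorJ nab z' (Y z')) z ξ = twistorJ nab z (con Y z ξ) := by
  obtain ⟨S, hS, -⟩ := existsUnique_tensorS (om := om) hnab ht
  rw [h.apply hnab ht hS hY, h.apply hnab ht hS (isDiffField_twistorJ hnab hY),
    twistorD_twistorJ hnab hY, lcTensor_twistorJ hnab ht hS hf]
  apply tangent_ext (nab := nab)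
  · simp only [ContinuousLinearMap.map_add, (twistorJ_spec hnab z _).1]
  · simp only [twistorP_add, (twistorJ_spec hnab z _).2, ContinuousLinearMap.comp_add]

end LeviCivita

/-! ### Square roots near 1 and local triviality of families of symplectic forms. -/

theorem exists_local_sqrt (R : Type*) [NormedRing R] [NormedAlgebra ℝ R] [CompleteSpace R] :
    ∃ r : R → R, ContDiffAt ℝ ω r 1 ∧ r 1 = 1 ∧ (∀ᶠ b in 𝓝 (1 : R), r b * r b = b) ∧
      ∃ N ∈ 𝓝 (1 : R), ∀ x ∈ N, ∀ y ∈ N, x * x = y * y → x = y := by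
  let q : R → R := fun x ↦ x * x
  have hq : ContDiffAt ℝ ω q 1 := contDiffAt_id.mul contDiffAt_id
  -- Squaring has derivative x ↦ 2x at 1. The inverse function theorem gives the smooth root, and
  -- the domain of the local inverse gives its uniqueness near 1.
  let e : R ≃L[ℝ] R := ContinuousLinearEquiv.smulLeft (Units.mk0 (2 : ℝ) two_ne_zero)
  have hd : HasFDerivAt q (e : R →L[ℝ] R) 1 := by
    refine ((hasFDerivAt_id (𝕜 := ℝ) (1 : R)).mul' (hasFDerivAt_id (𝕜 := ℝ) (1 : R))).congr_fderiv ?_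
    ext x
    simp [e, two_smul, Units.smul_def]
  have hn : (ω : WithTop ℕ∞) ≠ 0 := by simp
  have h1 : q 1 = 1 := one_mul 1
  have hs := hq.to_localInverse hd hn
  have hi := hq.localInverse_apply_image hd hn
  have he := (hq.hasStrictFDerivAt' hd hn).eventually_right_inverse
  rw [h1] at hs hi he
  refine ⟨hq.localInverse hd hn, hs, hi, he,
    (hq.toOpenPartialHomeomorph q hd hn).source,
    (hq.toOpenPartialHomeomorph q hd hn).open_source.mem_nhds
      (hq.mem_toOpenPartialHomeomorph_source hd hn),
    fun x hx y hy h ↦ (hq.toOpenPartialHomeomorph q hd hn).injOn hx hy h⟩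

/-- A smooth family of symplectic forms is locally trivial. -/
theorem exists_symplectic_trivialization {E V : Type*} [NormedAddCommGroup E] [NormedSpace ℝ E]
    [NormedAddCommGroup V] [NormedSpace ℝ V] [FiniteDimensional ℝ V]
    {Om : E → V →L[ℝ] V →L[ℝ] ℝ} {D : Set E} (hD : IsOpen D) (hO : ContDiffOn ℝ ∞ Om D)
    (halt : ∀ y ∈ D, ∀ a, Om y a a = 0) {y₀ : E} (hy₀ : y₀ ∈ D)
    (hnd : ∀ a, (∀ b, Om y₀ a b = 0) → a = 0) :
    ∃ D₁ ⊆ D, IsOpen D₁ ∧ y₀ ∈ D₁ ∧ ∃ h : E → V →L[ℝ] V, ContDiffOn ℝ ∞ h D₁ ∧ h y₀ = 1 ∧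
      ∀ y ∈ D₁, IsUnit (h y) ∧ ∀ a b, Om y₀ (h y a) (h y b) = Om y a b := by
  have : CompleteSpace V := FiniteDimensional.complete ℝ V
  have hinj : Function.Injective (Om y₀) := (injective_iff_map_eq_zero _).2 fun a ha ↦
    hnd a fun b ↦ DFunLike.congr_fun ha b
  have hfr : finrank ℝ V = finrank ℝ (V →L[ℝ] ℝ) :=
    (Subspace.dual_finrank_eq (K := ℝ) (V := V)).symm.trans
      (LinearMap.toContinuousLinearMap (𝕜 := ℝ) (E := V) (F' := ℝ)).finrank_eq
  let e : V ≃L[ℝ] (V →L[ℝ] ℝ) := (LinearEquiv.ofInjectiveOfFinrankEq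
    (Om y₀ : V →ₗ[ℝ] (V →L[ℝ] ℝ)) hinj hfr).toContinuousLinearEquiv
  have he : ∀ a b, e a b = Om y₀ a b := fun a b ↦ rfl
  have hes : ∀ (f : V →L[ℝ] ℝ) b, Om y₀ (e.symm f) b = f b := fun f b ↦ by
    rw [← he, e.apply_symm_apply]
  have hext : ∀ {A A' : V →L[ℝ] V}, (∀ a b, Om y₀ (A a) b = Om y₀ (A' a) b) → A = A' := fun h ↦ by
    ext1 a
    exact hinj (ContinuousLinearMap.ext (h a))
  -- `B y` satisfies Ω_{y₀}(Ba, b) = Ω_y(a, b), and σ below is the adjoint for Ω_{y₀}. The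
  -- trivialization will be the square root of B near 1.
  let B : E → V →L[ℝ] V := fun y ↦ (e.symm : (V →L[ℝ] ℝ) →L[ℝ] V) ∘L Om y
  have hB : ∀ y a b, Om y₀ (B y a) b = Om y a b := fun y a b ↦ hes _ _
  have hB0 : B y₀ = 1 := hext fun a b ↦ hB y₀ a b
  have hBs : ContDiffOn ℝ ∞ B D := contDiffOn_const.clm_comp hO
  have hBc : ContinuousAt B y₀ := (hBs.contDiffAt (hD.mem_nhds hy₀)).continuousAt
  let σ : (V →L[ℝ] V) → V →L[ℝ] V := fun A ↦
    (e.symm : (V →L[ℝ] ℝ) →L[ℝ] V) ∘L (((ContinuousLinearMap.compL ℝ V V ℝ).flip A) ∘L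
      (e : V →L[ℝ] (V →L[ℝ] ℝ)))
  have hσ : ∀ A a b, Om y₀ (σ A a) b = Om y₀ a (A b) := fun A a b ↦ hes _ _
  have hσ1 : σ 1 = 1 := hext fun a b ↦ hσ 1 a b
  have hσc : Continuous σ := continuous_const.clm_comp
    (((ContinuousLinearMap.compL ℝ V V ℝ).flip.continuous).clm_comp continuous_const)
  obtain ⟨r, hr, hr1, hrr, N, hN, hNinj⟩ := exists_local_sqrt (V →L[ℝ] V)
  have hr_cont : ContinuousAt r 1 := hr.continuousAt
  have hev : ∀ᶠ b in 𝓝 (1 : V →L[ℝ] V), ContDiffAt ℝ ω r b ∧ r b * r b = b ∧ r b ∈ N ∧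
      σ (r b) ∈ N ∧ IsUnit (r b) := by
    have c1 : ∀ᶠ b in 𝓝 (1 : V →L[ℝ] V), r b ∈ N :=
      hr_cont.eventually_mem (by rwa [hr1])
    have c2 : ∀ᶠ b in 𝓝 (1 : V →L[ℝ] V), σ (r b) ∈ N :=
      (hσc.continuousAt.comp hr_cont).eventually_mem (by
        simpa only [Function.comp_apply, hr1, hσ1] using hN)
    have c3 : ∀ᶠ b in 𝓝 (1 : V →L[ℝ] V), IsUnit (r b) :=
      hr_cont.eventually_mem (Units.isOpen.mem_nhds (by rw [hr1]; exact isUnit_one))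
    filter_upwards [hr.eventually (by simp), hrr, c1, c2, c3] with b h1 h2 h3 h4 h5
    exact ⟨h1, h2, h3, h4, h5⟩
  have hev' : ∀ᶠ y in 𝓝 y₀, y ∈ D ∧ ContDiffAt ℝ ω r (B y) ∧ r (B y) * r (B y) = B y ∧
      r (B y) ∈ N ∧ σ (r (B y)) ∈ N ∧ IsUnit (r (B y)) :=
    (hD.eventually_mem hy₀).and (hBc.eventually (by rwa [hB0]))
  obtain ⟨D₁, hD₁, hopen, hmem⟩ := eventually_nhds_iff.1 hev'
  refine ⟨D₁, fun y hy ↦ (hD₁ y hy).1, hopen, hmem, fun y ↦ r (B y), fun y hy ↦ ?_, (congrArg r hB0).trans hr1, fun y hy ↦ ?_⟩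
  · obtain ⟨h1, h2, -⟩ := hD₁ y hy
    exact ((h2.of_le le_top).comp y (hBs.contDiffAt (hD.mem_nhds h1))).contDiffWithinAt
  · obtain ⟨h1, -, h3, h4, h5, h6⟩ := hD₁ y hy
    refine ⟨h6, fun a b ↦ ?_⟩
    have hskew : ∀ a b, Om y a b = -Om y b a := fun a b ↦ by
      have h := halt y h1 (a + b)
      simp only [ContinuousLinearMap.map_add, add_apply, halt y h1] at h
      linarith
    have hskew0 : ∀ a b, Om y₀ a b = -Om y₀ b a := fun a b ↦ by
      have h := halt y₀ hy₀ (a + b)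
      simp only [ContinuousLinearMap.map_add, add_apply, halt y₀ hy₀] at h
      linarith
    have hsq : ∀ a, r (B y) (r (B y) a) = B y a := fun a ↦ DFunLike.congr_fun h3 a
    -- Both forms being skew, `B y` is self-adjoint, so the adjoint of its root is again a root
    -- close to 1, hence equal to it. With h self-adjoint and h² = B, Ω_{y₀}(ha, hb) = Ω_{y₀}(h²a,
    -- b) = Ω_y(a, b).
    have h7 : σ (r (B y)) = r (B y) := by
      refine hNinj _ h5 _ h4 (hext fun a b ↦ ?_)
      rw [h3]
      refine (hσ _ _ _).trans ((hσ _ _ _).trans ?_)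
      rw [hsq, hskew0, hB, hB, hskew a b]
    rw [← hB y a b, ← hsq, ← hσ, h7]

/-! ### The Cayley transform of complex structures. -/

section Cayley

variable {R : Type*} [Ring R] [Algebra ℝ R] {J J₀ A : R}

omit [Algebra ℝ R] in
theorem cayley_aux (hJ : J * J = -1) (hJ₀ : J₀ * J₀ = -1) :
    (J + J₀) * J = J₀ * (J + J₀) ∧ (J + J₀) * J₀ = J * (J + J₀) := by
  constructor
  · rw [add_mul, mul_add, hJ, hJ₀, add_comm]
  · rw [add_mul, mul_add, hJ, hJ₀, add_comm]

/-- J + J₀ intertwines J and J₀, hence so does its inverse u. The Cayley transform A = u(J₀ - J)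
then anticommutes with J₀; the second identity makes 1 + A invertible, and the last recovers J as
the conjugate of J₀ by 1 + A. -/
theorem cayley_left (hJ : J * J = -1) (hJ₀ : J₀ * J₀ = -1) {u : R} (hu : u * (J + J₀) = 1)
    (hu' : (J + J₀) * u = 1) : u * (J₀ - J) * J₀ = -(J₀ * (u * (J₀ - J))) ∧
      1 + u * (J₀ - J) = (2 : ℝ) • (u * J₀) ∧
      u * (J₀ - J) = -((J₀ - J) * u) ∧
      J * (1 + u * (J₀ - J)) = (1 + u * (J₀ - J)) * J₀ := by
  obtain ⟨h1, h2⟩ := cayley_aux hJ hJ₀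
  have h3 : J₀ * u = u * J := by
    calc J₀ * u = u * (J + J₀) * (J₀ * u) := by rw [hu, one_mul]
      _ = u * J * ((J + J₀) * u) := by
        rw [mul_assoc u, ← mul_assoc (J + J₀), h2]; simp only [mul_assoc]
      _ = u * J := by rw [hu', mul_one]
  have h4 : J * u = u * J₀ := by
    calc J * u = u * (J + J₀) * (J * u) := by rw [hu, one_mul]
      _ = u * J₀ * ((J + J₀) * u) := by
        rw [mul_assoc u, ← mul_assoc (J + J₀), h1]; simp only [mul_assoc]
      _ = u * J₀ := by rw [hu', mul_one]
  have h5 : 1 + u * (J₀ - J) = (2 : ℝ) • (u * J₀) := by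
    rw [← hu, ← mul_add, two_smul, ← mul_add]
    congr 1
    abel
  refine ⟨?_, h5, ?_, ?_⟩
  · rw [← mul_assoc J₀, h3, mul_assoc, mul_assoc u J, ← mul_neg]
    congr 1
    rw [sub_mul, mul_sub, hJ, hJ₀]
    abel
  · rw [mul_sub, sub_mul, h3, h4]
    abel
  · rw [h5, mul_smul_comm, smul_mul_assoc, ← mul_assoc, h4]

/-- The opposite direction: J = (1 + A)J₀(1 + A)⁻¹ squares to -1, and the last two identities give
J₀ - J = (J + J₀)A, so the Cayley transform of J is A again. -/
theorem cayley_right (hJ₀ : J₀ * J₀ = -1) (hA : A * J₀ = -(J₀ * A)) {w : R}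
    (hw : w * (1 + A) = 1) (hw' : (1 + A) * w = 1) :
    (1 + A) * J₀ * w * ((1 + A) * J₀ * w) = -1 ∧ (1 + A) * J₀ * w + J₀ = (2 : ℝ) • (J₀ * w) ∧
      J₀ - (1 + A) * J₀ * w = (2 : ℝ) • (J₀ * w * A) := by
  have hwA : w * A = A * w := by
    have h1 : w * A = w * (1 + A) - w := by rw [mul_add, mul_one]; abel
    have h2 : A * w = (1 + A) * w - w := by rw [add_mul, one_mul]; abel
    rw [h1, h2, hw, hw']
  have hJw : J₀ = J₀ * (1 + A) * w := by rw [mul_assoc, hw', mul_one]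
  refine ⟨?_, ?_, ?_⟩
  · calc (1 + A) * J₀ * w * ((1 + A) * J₀ * w) = (1 + A) * J₀ * (w * (1 + A)) * J₀ * w := by
          simp only [mul_assoc]
      _ = (1 + A) * (J₀ * J₀) * w := by rw [hw, mul_one]; simp only [mul_assoc]
      _ = -1 := by rw [hJ₀, mul_neg, mul_one, neg_mul, hw']
  · nth_rw 2 [hJw]
    rw [add_mul, mul_add, hA, one_mul, mul_one, ← add_mul, two_smul, ← add_mul]
    congr 1
    abel
  · nth_rw 1 [hJw]
    rw [mul_assoc J₀ w, hwA, ← mul_assoc, ← smul_mul_assoc, ← sub_mul, two_smul]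
    congr 1
    rw [mul_add, add_mul, hA, mul_one, one_mul]
    abel

end Cayley

/-! ### Charts for the compatible structures of a family of symplectic forms. -/

section CompatibleFamily

variable {V : Type*} [NormedAddCommGroup V] [NormedSpace ℝ V] {Om : V →L[ℝ] V →L[ℝ] ℝ}
  {J J₀ : V →L[ℝ] V}

theorem CompatibleStr.mul_self (h : CompatibleStr Om J) : J * J = -1 :=
  ContinuousLinearMap.ext h.sq

/-- Every vector is (J + J₀)c, and the Cayley transform sends it to -(J₀ - J)c; after this
substitution the invariance of Ω under J and J₀ makes all terms cancel. -/
theorem inverse_mul_sub_mem_antiSp (h₀ : CompatibleStr Om J₀) (h : CompatibleStr Om J)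
    (hu : IsUnit (J + J₀)) : Ring.inverse (J + J₀) * (J₀ - J) ∈ antiSp Om J₀ := by
  have hu1 := Ring.inverse_mul_cancel _ hu
  have hu2 := Ring.mul_inverse_cancel _ hu
  obtain ⟨h1, -, h3, -⟩ := cayley_left h.mul_self h₀.mul_self hu1 hu2
  refine ⟨fun a b ↦ ?_, fun a ↦ DFunLike.congr_fun h1 a⟩
  have hs : ∀ c, ∃ c', c = (J + J₀) c' := fun c ↦
    ⟨Ring.inverse (J + J₀) c, (DFunLike.congr_fun hu2 c).symm⟩
  have hA : ∀ c, (Ring.inverse (J + J₀) * (J₀ - J)) ((J + J₀) c) = -((J₀ - J) c) := fun c ↦ by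
    rw [h3]
    exact congrArg (fun d ↦ -((J₀ - J) d)) (DFunLike.congr_fun hu1 c)
  obtain ⟨a', rfl⟩ := hs a
  obtain ⟨b', rfl⟩ := hs b
  rw [hA, hA]
  simp only [add_apply, sub_apply, ContinuousLinearMap.map_neg, neg_apply,
    ContinuousLinearMap.map_sub, ContinuousLinearMap.map_add, h.inv, h₀.inv]
  ring

/-- The conjugated structure takes (1 + A)a to (1 + A)J₀a. As A is in sp, Ω((1 + A)a, (1 + A)b) =
Ω(a, b) + Ω(Aa, Ab), and this is invariant under J₀ since A anticommutes with J₀. -/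
theorem cayley_inv (h₀ : CompatibleStr Om J₀) {A : V →L[ℝ] V} (hA : A ∈ antiSp Om J₀)
    (hu : IsUnit (1 + A)) (u v : V) :
    Om (((1 + A) * J₀ * Ring.inverse (1 + A)) u) (((1 + A) * J₀ * Ring.inverse (1 + A)) v) =
      Om u v := by
  have hu1 := Ring.inverse_mul_cancel _ hu
  have hu2 := Ring.mul_inverse_cancel _ hu
  have hs : ∀ c, ∃ c', c = (1 + A) c' := fun c ↦
    ⟨Ring.inverse (1 + A) c, (DFunLike.congr_fun hu2 c).symm⟩
  have hc : ∀ c, ((1 + A) * J₀ * Ring.inverse (1 + A)) ((1 + A) c) = (1 + A) (J₀ c) := fun c ↦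
    congrArg (fun d ↦ (1 + A) (J₀ d)) (DFunLike.congr_fun hu1 c)
  obtain ⟨a, rfl⟩ := hs u
  obtain ⟨b, rfl⟩ := hs v
  have h1 := hA.1 (J₀ a) (J₀ b)
  have h2 := hA.1 a b
  rw [hc, hc]
  simp only [add_apply, one_apply_eq_self, ContinuousLinearMap.map_add, hA.2, h₀.inv,
    ContinuousLinearMap.map_neg,
    neg_apply] at h1 h2 ⊢
  linear_combination h1 - h2

/-- By homogeneity positivity can be tested on the unit sphere, which is compact. -/
theorem isOpen_setOf_pos [FiniteDimensional ℝ V] (Om : V →L[ℝ] V →L[ℝ] ℝ) :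
    IsOpen {J : V →L[ℝ] V | ∀ v, v ≠ 0 → 0 < Om v (J v)} := by
  have h : {J : V →L[ℝ] V | ∀ v, v ≠ 0 → 0 < Om v (J v)} =
      {J | ∀ v ∈ Metric.sphere (0 : V) 1, 0 < Om v (J v)} := by
    ext J
    refine ⟨fun hJ v hv ↦ hJ v fun h0 ↦ by simp [h0] at hv, fun hJ v hv ↦ ?_⟩
    have h1 := hJ (‖v‖⁻¹ • v) (by simp [norm_smul, hv])
    simp only [ContinuousLinearMap.map_smul, smul_apply, smul_eq_mul] at h1
    have h2 : 0 < ‖v‖⁻¹ := by positivity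
    exact (mul_pos_iff_of_pos_left h2).1 ((mul_pos_iff_of_pos_left h2).1 h1)
  rw [h, isOpen_iff_eventually]
  refine fun J hJ ↦ (isCompact_sphere (0 : V) 1).eventually_forall_of_forall_eventually fun v hv ↦ ?_
  have hc : Continuous fun p : (V →L[ℝ] V) × V ↦ Om p.2 (p.1 p.2) := by fun_prop
  exact hc.continuousAt.eventually (lt_mem_nhds (hJ v hv))

theorem CompatibleStr.conj {Om' : V →L[ℝ] V →L[ℝ] ℝ} {h : V →L[ℝ] V} (hh : IsUnit h)
    (hO : ∀ a b, Om (h a) (h b) = Om' a b) :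
    CompatibleStr Om' J ↔ CompatibleStr Om (h * J * Ring.inverse h) := by
  have hu1 := Ring.inverse_mul_cancel _ hh
  have hu2 := Ring.mul_inverse_cancel _ hh
  have hs : ∀ c, ∃ c', c = h c' := fun c ↦ ⟨Ring.inverse h c, (DFunLike.congr_fun hu2 c).symm⟩
  have hi : ∀ c, Ring.inverse h (h c) = c := fun c ↦ DFunLike.congr_fun hu1 c
  have hc : ∀ c, (h * J * Ring.inverse h) (h c) = h (J c) := fun c ↦
    congrArg (fun d ↦ h (J d)) (hi c)
  constructor
  · intro hJ
    refine ⟨fun a ↦ ?_, fun a ↦ ?_, fun a b ↦ ?_, fun a ha ↦ ?_⟩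
    · obtain ⟨a, rfl⟩ := hs a
      rw [hO, hJ.alt]
    · obtain ⟨a, rfl⟩ := hs a
      rw [hc, hc, hJ.sq, ContinuousLinearMap.map_neg]
    · obtain ⟨a, rfl⟩ := hs a
      obtain ⟨b, rfl⟩ := hs b
      rw [hc, hc, hO, hO, hJ.inv]
    · obtain ⟨a, rfl⟩ := hs a
      rw [hc, hO]
      exact hJ.pos a fun h0 ↦ ha (by rw [h0, ContinuousLinearMap.map_zero])
  · intro hJ
    refine ⟨fun a ↦ by rw [← hO, hJ.alt], fun a ↦ ?_, fun a b ↦ ?_, fun a ha ↦ ?_⟩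
    · rw [← hi (J (J a)), ← hc, ← hc, hJ.sq, ContinuousLinearMap.map_neg, hi]
    · rw [← hO, ← hc, ← hc, hJ.inv, hO]
    · rw [← hO, ← hc]
      exact hJ.pos _ fun h0 ↦ ha (by rw [← hi a, h0, ContinuousLinearMap.map_zero])

end CompatibleFamily

theorem ContDiffOn.ringInverse {E R : Type*} [NormedAddCommGroup E] [NormedSpace ℝ E] [NormedRing R]
    [NormedAlgebra ℝ R] [CompleteSpace R] {f : E → R} {s : Set E} {k : WithTop ℕ∞}
    (hf : ContDiffOn ℝ k f s) (hu : ∀ x ∈ s, IsUnit (f x)) :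
    ContDiffOn ℝ k (fun x ↦ Ring.inverse (f x)) s := fun x hx ↦ by
  obtain ⟨u, hu⟩ := hu x hx
  have h : ContDiffAt ℝ k Ring.inverse (f x) := hu ▸ contDiffAt_ringInverse ℝ u
  exact h.comp_contDiffWithinAt x (hf x hx)

set_option maxHeartbeats 1000000 in
/-- Charts, by a Cayley transform, of the set of pairs `(y, J)` with `J` a complex structure
compatible with the form `Ω_y`. -/
theorem exists_compatible_chart {E V X : Type*} [NormedAddCommGroup E] [NormedSpace ℝ E]
    [NormedAddCommGroup V] [NormedSpace ℝ V] [FiniteDimensional ℝ V] [NormedAddCommGroup X]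
    [NormedSpace ℝ X] {Om : E → V →L[ℝ] V →L[ℝ] ℝ} {D : Set E} (hD : IsOpen D)
    (hO : ContDiffOn ℝ ∞ Om D) (halt : ∀ y ∈ D, ∀ a, Om y a a = 0) {W : Set (E × (V →L[ℝ] V))}
    (hW : IsOpen W) {y₀ : E} (hy₀ : y₀ ∈ D) {J₀ : V →L[ℝ] V} (hq₀ : (y₀, J₀) ∈ W)
    (h₀ : CompatibleStr (Om y₀) J₀) (L : X ≃L[ℝ] E × antiSp (Om y₀) J₀) :
    ∃ U ⊆ W, IsOpen U ∧ (y₀, J₀) ∈ U ∧ ∃ V' : Set X, IsOpen V' ∧ ∃ F : E × (V →L[ℝ] V) → X,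
      ∃ G : X → E × (V →L[ℝ] V), ContDiffOn ℝ ∞ F U ∧ ContDiffOn ℝ ∞ G V' ∧
      (∀ v ∈ V', G v ∈ U ∧ CompatibleStr (Om (G v).1) (G v).2 ∧ F (G v) = v) ∧
      ∀ q ∈ U, CompatibleStr (Om q.1) q.2 → F q ∈ V' ∧ G (F q) = q := by
  have : CompleteSpace V := FiniteDimensional.complete ℝ V
  obtain ⟨D₁, hD₁, hopen, hmem, h, hh, hh1, hunit⟩ := exists_symplectic_trivialization hD hO halt hy₀
    fun a ha ↦ h₀.nondegenerate fun b ↦ ha _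
  -- A linear retraction onto `antiSp` lets the chart map be defined and smooth on an open set of
  -- endomorphisms, compatible or not.
  obtain ⟨p, hp⟩ := LinearMap.exists_leftInverse_of_injective (antiSp (Om y₀) J₀).subtype
    (Submodule.ker_subtype _)
  let pr : (V →L[ℝ] V) →L[ℝ] antiSp (Om y₀) J₀ := LinearMap.toContinuousLinearMap p
  have hpr : ∀ A : antiSp (Om y₀) J₀, pr A = A := fun A ↦ LinearMap.congr_fun hp A
  -- Conjugation by the trivialization turns compatibility with Ω_y into compatibility with the
  -- fixed form at y₀, to which the Cayley transform based at J₀ applies.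
  let K : E × (V →L[ℝ] V) → V →L[ℝ] V := fun q ↦ h q.1 * q.2 * Ring.inverse (h q.1)
  have hK : ContDiffOn ℝ ∞ K (Prod.fst ⁻¹' D₁) := by
    have h1 : ContDiffOn ℝ ∞ (fun q : E × (V →L[ℝ] V) ↦ h q.1) (Prod.fst ⁻¹' D₁) :=
      hh.comp contDiffOn_fst fun _ hq ↦ hq
    exact (h1.mul contDiffOn_snd).mul (h1.ringInverse fun q hq ↦ (hunit q.1 hq).1)
  have hD₁o : IsOpen (Prod.fst ⁻¹' D₁ : Set (E × (V →L[ℝ] V))) := hopen.preimage continuous_fst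
  let U : Set (E × (V →L[ℝ] V)) := W ∩ (Prod.fst ⁻¹' D₁ ∩ (fun q ↦ K q + J₀) ⁻¹' {a | IsUnit a})
  have hU : IsOpen U := hW.inter ((hK.continuousOn.add continuousOn_const).isOpen_inter_preimage
    hD₁o Units.isOpen)
  let C : X → V →L[ℝ] V := fun x ↦
    (1 + ((L x).2 : V →L[ℝ] V)) * J₀ * Ring.inverse (1 + ((L x).2 : V →L[ℝ] V))
  let G : X → E × (V →L[ℝ] V) := fun x ↦
    ((L x).1, Ring.inverse (h (L x).1) * C x * h (L x).1)
  let Q : Set X := {x | (L x).1 ∈ D₁ ∧ IsUnit (1 + ((L x).2 : V →L[ℝ] V))}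
  have hL : ContDiff ℝ ∞ L :=
    ContinuousLinearEquiv.contDiff (𝕜 := ℝ) (E := X) (F := E × antiSp (Om y₀) J₀) (n := ∞) L
  have hc1 : ContDiff ℝ ∞ fun x ↦ (L x).1 := contDiff_fst.comp hL
  have hι : ContDiff ℝ ∞ (antiSp (Om y₀) J₀).subtypeL := ContinuousLinearMap.contDiff (𝕜 := ℝ)
    (E := antiSp (Om y₀) J₀) (F := V →L[ℝ] V) (n := ∞) (antiSp (Om y₀) J₀).subtypeL
  have hprs : ContDiff ℝ ∞ pr := ContinuousLinearMap.contDiff (𝕜 := ℝ)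
    (E := V →L[ℝ] V) (F := antiSp (Om y₀) J₀) (n := ∞) pr
  have hJu : IsUnit J₀ := ⟨⟨J₀, -J₀, by rw [mul_neg, h₀.mul_self, neg_neg],
    by rw [neg_mul, h₀.mul_self, neg_neg]⟩, rfl⟩
  have hc2 : ContDiff ℝ ∞ fun x ↦ (1 + ((L x).2 : V →L[ℝ] V)) :=
    contDiff_const.add (hι.comp (contDiff_snd.comp hL))
  have hLs : ContDiff ℝ ∞ L.symm :=
    ContinuousLinearEquiv.contDiff (𝕜 := ℝ) (E := E × antiSp (Om y₀) J₀) (F := X) (n := ∞) L.symm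
  have hQ : IsOpen Q := (hopen.preimage hc1.continuous).inter (Units.isOpen.preimage hc2.continuous)
  have hC : ContDiffOn ℝ ∞ C Q :=
    (hc2.contDiffOn.mul contDiffOn_const).mul (hc2.contDiffOn.ringInverse fun x hx ↦ hx.2)
  have hG : ContDiffOn ℝ ∞ G Q := by
    have h1 : ContDiffOn ℝ ∞ (fun x ↦ h (L x).1) Q := hh.comp hc1.contDiffOn fun x hx ↦ hx.1
    exact hc1.contDiffOn.prodMk
      (((h1.ringInverse fun x hx ↦ (hunit _ hx.1).1).mul hC).mul h1)
  let P : Set (V →L[ℝ] V) := {J | ∀ v, v ≠ 0 → 0 < Om y₀ v (J v)}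
  -- Positivity is the one compatibility condition that the inverse Cayley transform does not
  -- provide; it is open, so it is put into the domain.
  let V' : Set X := (Q ∩ C ⁻¹' P) ∩ (Q ∩ G ⁻¹' W)
  have hV' : IsOpen V' := (hC.continuousOn.isOpen_inter_preimage hQ (isOpen_setOf_pos _)).inter
    (hG.continuousOn.isOpen_inter_preimage hQ hW)
  let F : E × (V →L[ℝ] V) → X := fun q ↦
    L.symm (q.1, pr (Ring.inverse (K q + J₀) * (J₀ - K q)))
  have hF : ContDiffOn ℝ ∞ F U := by
    have h1 : ContDiffOn ℝ ∞ K U := hK.mono fun q hq ↦ hq.2.1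
    exact hLs.comp_contDiffOn (contDiffOn_fst.prodMk (hprs.comp_contDiffOn
      (((h1.add contDiffOn_const).ringInverse fun q hq ↦ hq.2.2).mul (contDiffOn_const.sub h1))))
  have hKG : ∀ x ∈ Q, K (G x) = C x := fun x hx ↦ by
    have h1 := Ring.mul_inverse_cancel _ (hunit _ hx.1).1
    calc K (G x) = h (L x).1 * Ring.inverse (h (L x).1) * C x *
          (h (L x).1 * Ring.inverse (h (L x).1)) := by simp only [K, G, mul_assoc]
      _ = C x := by rw [h1, one_mul, mul_one]
  refine ⟨U, fun q hq ↦ hq.1, hU, ⟨hq₀, hmem, ?_⟩, V', hV', F, G, hF,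
    hG.mono fun x hx ↦ hx.1.1, fun x hx ↦ ?_, fun q hq hcomp ↦ ?_⟩
  · have h1 : K (y₀, J₀) + J₀ = (2 : ℝ) • J₀ := by
      simp only [K, hh1, Ring.inverse_one, one_mul, mul_one, two_smul]
    change IsUnit (K (y₀, J₀) + J₀)
    rw [h1]
    exact hJu.smul (Units.mk0 (2 : ℝ) two_ne_zero)
  · obtain ⟨⟨hxQ, hxP⟩, -, hxW⟩ := hx
    have hA : ((L x).2 : V →L[ℝ] V) ∈ antiSp (Om y₀) J₀ := (L x).2.2
    have hA' : ((L x).2 : V →L[ℝ] V) * J₀ = -(J₀ * ((L x).2 : V →L[ℝ] V)) :=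
      ContinuousLinearMap.ext hA.2
    have hw := Ring.inverse_mul_cancel _ hxQ.2
    have hw' := Ring.mul_inverse_cancel _ hxQ.2
    obtain ⟨e1, e2, e3⟩ := cayley_right h₀.mul_self hA' hw hw'
    have hCc : CompatibleStr (Om y₀) (C x) :=
      ⟨h₀.alt, fun v ↦ DFunLike.congr_fun e1 v, cayley_inv h₀ hA hxQ.2, hxP⟩
    -- From C + J₀ = 2J₀(1 + A)⁻¹ the inverse of C + J₀ is -½(1 + A)J₀.
    have hcan : (1 + ((L x).2 : V →L[ℝ] V)) * ((-(1 / 2 : ℝ)) • J₀) * (C x + J₀) = 1 := by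
      rw [e2, mul_assoc, smul_mul_smul_comm, ← mul_assoc J₀, h₀.mul_self, neg_one_mul]
      norm_num
      exact hw'
    have hcan' : (C x + J₀) * ((1 + ((L x).2 : V →L[ℝ] V)) * ((-(1 / 2 : ℝ)) • J₀)) = 1 := by
      rw [e2, smul_mul_assoc, mul_assoc J₀, ← mul_assoc _ _ ((-(1 / 2 : ℝ)) • J₀), hw, one_mul,
        mul_smul_comm, smul_smul, h₀.mul_self]
      norm_num
    have hCu : IsUnit (C x + J₀) := ⟨⟨_, _, hcan', hcan⟩, rfl⟩
    refine ⟨⟨hxW, hxQ.1, ?_⟩, ?_, ?_⟩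
    · change IsUnit (K (G x) + J₀)
      rwa [hKG x hxQ]
    · rw [CompatibleStr.conj (hunit _ hxQ.1).1 (hunit _ hxQ.1).2]
      have : h (L x).1 * (G x).2 * Ring.inverse (h (L x).1) = C x := hKG x hxQ
      exact this ▸ hCc
    · have e4 : Ring.inverse (C x + J₀) * (J₀ - C x) = ((L x).2 : V →L[ℝ] V) := by
        have e5 : J₀ - C x = (C x + J₀) * ((L x).2 : V →L[ℝ] V) := by
          rw [e2, e3, smul_mul_assoc]
        rw [e5, ← mul_assoc, Ring.inverse_mul_cancel _ hCu, one_mul]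
      change L.symm ((L x).1, pr (Ring.inverse (K (G x) + J₀) * (J₀ - K (G x)))) = x
      rw [hKG x hxQ, e4, hpr]
      exact L.symm_apply_apply x
  · obtain ⟨hqW, hqD, hqu⟩ := hq
    have hKc := (CompatibleStr.conj (hunit _ hqD).1 (hunit _ hqD).2).1 hcomp
    have hqu' : IsUnit (K q + J₀) := hqu
    have hA := inverse_mul_sub_mem_antiSp h₀ hKc hqu'
    obtain ⟨-, e2, -, e4⟩ := cayley_left hKc.mul_self h₀.mul_self (Ring.inverse_mul_cancel _ hqu')
      (Ring.mul_inverse_cancel _ hqu')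
    have hL : L (F q) = (q.1, ⟨_, hA⟩) := by
      have h1 : pr (Ring.inverse (K q + J₀) * (J₀ - K q)) = ⟨_, hA⟩ := hpr ⟨_, hA⟩
      change L (L.symm _) = _
      rw [h1, L.apply_symm_apply]
    have hL1 : (L (F q)).1 = q.1 := congrArg Prod.fst hL
    have hL2 : ((L (F q)).2 : V →L[ℝ] V) = Ring.inverse (K q + J₀) * (J₀ - K q) :=
      congrArg (fun r ↦ (r.2 : V →L[ℝ] V)) hL
    have hu1 : IsUnit (1 + ((L (F q)).2 : V →L[ℝ] V)) := by
      rw [hL2, e2]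
      have h3 : IsUnit (Ring.inverse (K q + J₀)) := by
        obtain ⟨u, hu⟩ := hqu'
        rw [← hu, Ring.inverse_unit]
        exact u⁻¹.isUnit
      exact (h3.mul hJu).smul (Units.mk0 (2 : ℝ) two_ne_zero)
    have hxQ : F q ∈ Q := ⟨by rw [hL1]; exact hqD, hu1⟩
    have hC : C (F q) = K q := by
      have h5 : K q * (1 + ((L (F q)).2 : V →L[ℝ] V)) = (1 + ((L (F q)).2 : V →L[ℝ] V)) * J₀ := by
        rw [hL2]
        exact e4
      change (1 + ((L (F q)).2 : V →L[ℝ] V)) * J₀ * _ = _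
      rw [← h5, mul_assoc, Ring.mul_inverse_cancel _ hu1, mul_one]
    have hG : G (F q) = q := by
      refine Prod.ext hL1 ?_
      change Ring.inverse (h (L (F q)).1) * C (F q) * h (L (F q)).1 = q.2
      have h1 := Ring.inverse_mul_cancel _ (hunit _ hqD).1
      rw [hC, hL1]
      calc Ring.inverse (h q.1) * K q * h q.1 = Ring.inverse (h q.1) * h q.1 * q.2 *
            (Ring.inverse (h q.1) * h q.1) := by simp only [K, mul_assoc]
        _ = q.2 := by rw [h1, one_mul, mul_one]
    refine ⟨⟨⟨hxQ, ?_⟩, hxQ, ?_⟩, hG⟩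
    · change C (F q) ∈ P
      rw [hC]
      exact hKc.pos
    · change G (F q) ∈ W
      rwa [hG]

/-! ### Submanifold structures from local slices. -/

section Submanifold

variable {N X : Type*} [TopologicalSpace N] [NormedAddCommGroup X] [NormedSpace ℝ X]
  {S : N → Prop} {U : Set N} {V : Set X} {F : N → X} {G : X → N}

open Classical in
/-- The chart of a subspace given by maps `F` and `G` which are inverse to each other on it. -/
def sliceChart (z : {p // S p}) (hU : IsOpen U) (hV : IsOpen V)
    (hF : ContinuousOn F U) (hG : ContinuousOn G V)
    (h1 : ∀ v ∈ V, G v ∈ U ∧ S (G v) ∧ F (G v) = v)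
    (h2 : ∀ q ∈ U, S q → F q ∈ V ∧ G (F q) = q) : OpenPartialHomeomorph {p // S p} X where
  toFun p := F p.1
  -- On the target `G v` always satisfies `S`; the point `z` is only a default value elsewhere.
  invFun v := if h : S (G v) then ⟨G v, h⟩ else z
  source := Subtype.val ⁻¹' U
  target := V
  map_source' p hp := (h2 p.1 hp p.2).1
  map_target' v hv := by
    rw [dif_pos (h1 v hv).2.1]
    exact (h1 v hv).1
  left_inv' p hp := by
    have h := (h2 p.1 hp p.2).2
    have h' : S (G (F p.1)) := h.symm ▸ p.2
    rw [dif_pos h']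
    exact Subtype.ext h
  right_inv' v hv := by
    rw [dif_pos (h1 v hv).2.1]
    exact (h1 v hv).2.2
  open_source := hU.preimage continuous_subtype_val
  open_target := hV
  continuousOn_toFun := hF.comp continuous_subtype_val.continuousOn fun _ hp ↦ hp
  continuousOn_invFun := by
    refine (Topology.IsInducing.subtypeVal (t := {p | S p})).continuousOn_iff.2 ?_
    refine hG.congr fun v hv ↦ ?_
    simp only [Function.comp_apply]
    rw [dif_pos (h1 v hv).2.1]

omit [NormedSpace ℝ X] in
theorem sliceChart_symm_val (z : {p // S p}) (hU : IsOpen U) (hV : IsOpen V)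
    (hF : ContinuousOn F U) (hG : ContinuousOn G V)
    (h1 : ∀ v ∈ V, G v ∈ U ∧ S (G v) ∧ F (G v) = v)
    (h2 : ∀ q ∈ U, S q → F q ∈ V ∧ G (F q) = q) {v : X} (hv : v ∈ V) :
    ((sliceChart z hU hV hF hG h1 h2).symm v).1 = G v := by
  exact congrArg Subtype.val (dif_pos (h1 v hv).2.1)

/-- Transition maps are compositions F ∘ G of smooth ambient maps. Near each point the inclusion is
G after the chart, and the inverse chart after F is a differentiable left inverse of it, so its
differential is injective. -/
theorem exists_submanifold_structure {E' H' : Type*} [NormedAddCommGroup E'] [NormedSpace ℝ E']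
    [TopologicalSpace H'] (I' : ModelWithCorners ℝ E' H') [ChartedSpace H' N]
    (hloc : ∀ z : {p // S p}, ∃ U : Set N, IsOpen U ∧ z.1 ∈ U ∧ ∃ V : Set X, IsOpen V ∧
      ∃ F : N → X, ∃ G : X → N, ContMDiffOn I' 𝓘(ℝ, X) ∞ F U ∧ ContMDiffOn 𝓘(ℝ, X) I' ∞ G V ∧
      (∀ v ∈ V, G v ∈ U ∧ S (G v) ∧ F (G v) = v) ∧ ∀ q ∈ U, S q → F q ∈ V ∧ G (F q) = q) :
    ∃ _ : ChartedSpace X {p // S p}, IsManifold 𝓘(ℝ, X) ∞ {p // S p} ∧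
      ContMDiff 𝓘(ℝ, X) I' ∞ (Subtype.val : {p // S p} → N) ∧
      ∀ z : {p // S p}, Function.Injective
        (mfderiv 𝓘(ℝ, X) I' (Subtype.val : {p // S p} → N) z) := by
  choose U hU hzU V hV F G hF hG h1 h2 using hloc
  let e : {p // S p} → OpenPartialHomeomorph {p // S p} X := fun z ↦
    sliceChart z (hU z) (hV z) (hF z).continuousOn (hG z).continuousOn (h1 z) (h2 z)
  let _cs : ChartedSpace X {p // S p} :=
    { atlas := Set.range e
      chartAt := e
      mem_chart_source := hzU
      chart_mem_atlas := fun z ↦ ⟨z, rfl⟩ }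
  have hman : IsManifold 𝓘(ℝ, X) ∞ {p // S p} := by
    refine isManifold_of_contDiffOn _ _ _ ?_
    rintro _ _ ⟨z, rfl⟩ ⟨z', rfl⟩
    have hsub : ∀ v ∈ ((e z).symm ≫ₕ e z').source, v ∈ V z ∧ G z v ∈ U z' := fun v hv ↦ by
      have hv' : v ∈ V z ∧ ((e z).symm v).1 ∈ U z' := hv
      have h := sliceChart_symm_val z (hU z) (hV z) (hF z).continuousOn (hG z).continuousOn (h1 z)
        (h2 z) hv'.1
      exact ⟨hv'.1, h ▸ hv'.2⟩
    have h : ContDiffOn ℝ ∞ (F z' ∘ G z) ((e z).symm ≫ₕ e z').source :=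
      ((hF z').comp ((hG z).mono fun v hv ↦ (hsub v hv).1) fun v hv ↦ (hsub v hv).2).contDiffOn
    have h' : ContDiffOn ℝ ∞ ((e z).symm ≫ₕ e z') ((e z).symm ≫ₕ e z').source :=
      h.congr fun v hv ↦ congrArg (F z') (sliceChart_symm_val z (hU z) (hV z) (hF z).continuousOn
        (hG z).continuousOn (h1 z) (h2 z) (hsub v hv).1)
    simpa using h'
  have hchart : ∀ z, ContMDiffAt 𝓘(ℝ, X) 𝓘(ℝ, X) ∞ (e z) z := fun z ↦
    contMDiffAt_of_mem_maximalAtlas (IsManifold.chart_mem_maximalAtlas z) (hzU z)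
  have hincl : ContMDiff 𝓘(ℝ, X) I' ∞ (Subtype.val : {p // S p} → N) := fun z ↦ by
    have hz := (h2 z z.1 (hzU z) z.2)
    have hGz : ContMDiffAt 𝓘(ℝ, X) I' ∞ (G z) (e z z) :=
      (hG z).contMDiffAt ((hV z).mem_nhds hz.1)
    refine (hGz.comp z (hchart z)).congr_of_eventuallyEq ?_
    filter_upwards [(e z).open_source.mem_nhds (hzU z)] with y hy
    exact (h2 z y.1 hy y.2).2.symm
  refine ⟨_cs, hman, hincl, fun z ↦ ?_⟩
  have hsymm : MDifferentiableAt 𝓘(ℝ, X) 𝓘(ℝ, X) (e z).symm (e z z) :=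
    (contMDiffAt_symm_of_mem_maximalAtlas (n := ∞) (IsManifold.chart_mem_maximalAtlas z)
      ((e z).map_source (hzU z))).mdifferentiableAt (by simp)
  have hFz : MDifferentiableAt I' 𝓘(ℝ, X) (F z) z.1 :=
    ((hF z).contMDiffAt ((hU z).mem_nhds (hzU z))).mdifferentiableAt (by simp)
  have hi : MDifferentiableAt 𝓘(ℝ, X) I' (Subtype.val : {p // S p} → N) z :=
    (hincl z).mdifferentiableAt (by simp)
  have hcomp : ((e z).symm ∘ F z) ∘ (Subtype.val : {p // S p} → N) =ᶠ[𝓝 z] id := by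
    filter_upwards [(e z).open_source.mem_nhds (hzU z)] with y hy
    exact (e z).left_inv hy
  have hd := hcomp.mfderiv_eq (I := 𝓘(ℝ, X)) (I' := 𝓘(ℝ, X))
  rw [mfderiv_id, mfderiv_comp (I' := I') z (hsymm.comp z.1 hFz) hi] at hd
  intro ξ η h
  have hξ := DFunLike.congr_fun hd ξ
  have hη := DFunLike.congr_fun hd η
  rw [ContinuousLinearMap.comp_apply, h] at hξ
  exact hξ.symm.trans hη

end Submanifold

/-! ### The twistor space as a submanifold of End(TM). -/

section TwistorCharts

variable {n : ℕ} {M : Type*} [TopologicalSpace M]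
  [ChartedSpace (EuclideanSpace ℝ (Fin (2 * n))) M] [IsManifold (𝓡 (2 * n)) ∞ M]
  {om : SymplecticForm n M}

theorem isCompatible_iff_compatibleStr {x₀ y : M} (hy : y ∈ frameDom n x₀)
    (j : TM n y →L[ℝ] TM n y) :
    IsCompatible om y j ↔ CompatibleStr (frameForm om x₀ y) (conjL x₀ y j) := by
  constructor
  · intro h
    exact compatibleStr_frame (z := ⟨⟨y, j⟩, h⟩) hy
  · intro h
    refine ⟨fun v ↦ ?_, fun u v ↦ ?_, fun v hv ↦ ?_⟩
    · apply frameL_injective hy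
      rw [← conjL_frameL hy, ← conjL_frameL hy, h.sq, ContinuousLinearMap.map_neg]
    · rw [← frameForm_frameL hy, ← conjL_frameL hy, ← conjL_frameL hy, h.inv, frameForm_frameL hy]
    · rw [← frameForm_frameL hy, ← conjL_frameL hy]
      exact h.pos _ fun h0 ↦ hv (frameL_injective hy (h0.trans (ContinuousLinearMap.map_zero _).symm))

/-- The symplectic form in the preferred coordinates at `x₀`. -/
def coordForm (om : SymplecticForm n M) (x₀ : M) (y : ModelR n) :
    ModelR n →L[ℝ] ModelR n →L[ℝ] ℝ := frameForm om x₀ ((extChartAt (𝓡 (2 * n)) x₀).symm y)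

theorem contDiffOn_coordForm (x₀ : M) :
    ContDiffOn ℝ ∞ (coordForm om x₀) (extChartAt (𝓡 (2 * n)) x₀).target := by
  rw [← contMDiffOn_iff_contDiffOn]
  have h : ContMDiffOn (𝓡 (2 * n)) 𝓘(ℝ, ModelR n →L[ℝ] ModelR n →L[ℝ] ℝ) ∞ (frameForm om x₀)
      (frameDom n x₀) := fun y hy ↦ (contMDiffAt_frameForm hy).contMDiffWithinAt
  refine h.comp (contMDiffOn_extChartAt_symm x₀) fun y hy ↦ ?_
  have := (extChartAt (𝓡 (2 * n)) x₀).map_target hy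
  rwa [extChartAt_source] at this

theorem finrank_modelR_prod_antiSp {Om : ModelR n →L[ℝ] ModelR n →L[ℝ] ℝ}
    {J : ModelR n →L[ℝ] ModelR n} (h : CompatibleStr Om J) :
    finrank ℝ (ModelR n × antiSp Om J) = n * (n + 3) := by
  have h1 : finrank ℝ (ModelR n) = 2 * n := finrank_euclideanSpace_fin
  rw [Module.finrank_prod, finrank_antiSp h h1, h1]
  ring

variable (om)

/-- The bundle chart of End(TM) at `z` carries compatible structures to pairs (y, J) with J
compatible with the coordinate expression of ω, where `exists_compatible_chart` applies; the model
spaces match by dimension. -/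
theorem exists_twistor_slice (z : TwistorSpace om) :
    ∃ U : Set (EndTM n M), IsOpen U ∧ z.1 ∈ U ∧
      ∃ V : Set (EuclideanSpace ℝ (Fin (n * (n + 3)))), IsOpen V ∧
      ∃ F : EndTM n M → EuclideanSpace ℝ (Fin (n * (n + 3))),
      ∃ G : EuclideanSpace ℝ (Fin (n * (n + 3))) → EndTM n M,
      ContMDiffOn ((𝓡 (2 * n)).prod 𝓘(ℝ, ModelR n →L[ℝ] ModelR n)) (𝓡 (n * (n + 3))) ∞ F U ∧
      ContMDiffOn (𝓡 (n * (n + 3))) ((𝓡 (2 * n)).prod 𝓘(ℝ, ModelR n →L[ℝ] ModelR n)) ∞ G V ∧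
      (∀ v ∈ V, G v ∈ U ∧ IsCompatible om (G v).1 (G v).2 ∧ F (G v) = v) ∧
      ∀ q ∈ U, IsCompatible om q.1 q.2 → F q ∈ V ∧ G (F q) = q := by
  let x₀ := z.1.1
  let I' := (𝓡 (2 * n)).prod 𝓘(ℝ, ModelR n →L[ℝ] ModelR n)
  let C := extChartAt I' z.1
  have hC : C = (trivializationAt (ModelR n →L[ℝ] ModelR n)
      (fun x : M ↦ TM n x →L[ℝ] TM n x) x₀).toPartialEquiv ≫
        (extChartAt (𝓡 (2 * n)) x₀).prod (PartialEquiv.refl _) := FiberBundle.extChartAt z.1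
  have hC1 : ∀ q, q.1 ∈ frameDom n x₀ → (C q).1 = extChartAt (𝓡 (2 * n)) x₀ q.1 := fun q hq ↦ by
    rw [hC]
    exact congrArg _ (Trivialization.coe_fst' _ (mem_baseSet_end hq))
  have hC2 : ∀ q, (C q).2 = conjL x₀ q.1 q.2 := fun q ↦ by
    rw [hC]
    exact trivializationAt_end_snd x₀ q
  have hsrc : ∀ q ∈ C.source, q.1 ∈ frameDom n x₀ := fun q hq ↦ by
    rw [hC, PartialEquiv.trans_source, Trivialization.source_eq] at hq
    have h : q.1 ∈ (chartAt (EuclideanSpace ℝ (Fin (2 * n))) x₀).source := by simpa using hq.1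
    exact h
  have hcomp : ∀ q ∈ C.source, (IsCompatible om q.1 q.2 ↔
      CompatibleStr (coordForm om x₀ (C q).1) (C q).2) := fun q hq ↦ by
    have hq' := hsrc q hq
    rw [isCompatible_iff_compatibleStr hq', hC1 q hq', hC2, coordForm,
      (extChartAt (𝓡 (2 * n)) x₀).left_inv (by rwa [extChartAt_source])]
  have hz : z.1 ∈ C.source := mem_extChartAt_source z.1
  have hx : x₀ ∈ frameDom n x₀ := mem_frameDom x₀
  have h₀ : CompatibleStr (coordForm om x₀ (C z.1).1) (C z.1).2 := (hcomp z.1 hz).1 z.2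
  have hfr : finrank ℝ (EuclideanSpace ℝ (Fin (n * (n + 3)))) =
      finrank ℝ (ModelR n × antiSp (coordForm om x₀ (C z.1).1) (C z.1).2) := by
    rw [finrank_modelR_prod_antiSp h₀, finrank_euclideanSpace_fin]
  have hy₀ : (C z.1).1 ∈ (extChartAt (𝓡 (2 * n)) x₀).target := by
    rw [hC1 z.1 hx]
    exact mem_extChartAt_target x₀
  obtain ⟨U, hUW, hU, hzU, V, hV, F, G, hF, hG, h1, h2⟩ := exists_compatible_chart
    (isOpen_extChartAt_target x₀) (contDiffOn_coordForm (om := om) x₀) (fun y _ a ↦ om.alt _ _)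
    (isOpen_extChartAt_target (I := I') z.1) hy₀ (C.map_source hz) h₀
    (ContinuousLinearEquiv.ofFinrankEq hfr)
  have hCs : ContMDiffOn I' 𝓘(ℝ, ModelR n × (ModelR n →L[ℝ] ModelR n)) ∞ C C.source := by
    have := contMDiffOn_extChartAt (I := I') (n := ∞) (x := z.1)
    rwa [← extChartAt_source I'] at this
  refine ⟨C.source ∩ C ⁻¹' U, (continuousOn_extChartAt z.1).isOpen_inter_preimage
    (isOpen_extChartAt_source z.1) hU, ⟨hz, hzU⟩, V, hV, F ∘ C, C.symm ∘ G,
    hF.contMDiffOn.comp (hCs.mono Set.inter_subset_left) Set.inter_subset_right,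
    (contMDiffOn_extChartAt_symm z.1).comp hG.contMDiffOn fun v hv ↦ hUW (h1 v hv).1,
    fun v hv ↦ ?_, fun q hq hcq ↦ ?_⟩
  · obtain ⟨e1, e2, e3⟩ := h1 v hv
    have ht : C (C.symm (G v)) = G v := C.right_inv (hUW e1)
    have hs : C.symm (G v) ∈ C.source := C.map_target (hUW e1)
    refine ⟨⟨hs, ?_⟩, (hcomp _ hs).2 ?_, ?_⟩
    · change C (C.symm (G v)) ∈ U
      rwa [ht]
    · rw [ht]
      exact e2
    · simp only [Function.comp_apply, ht, e3]
  · obtain ⟨e1, e2⟩ := h2 (C q) hq.2 ((hcomp q hq.1).1 hcq)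
    refine ⟨e1, ?_⟩
    simp only [Function.comp_apply, e2]
    exact C.left_inv hq.1

theorem exists_isTwistorManifold :
    ∃ cs : ChartedSpace (EuclideanSpace ℝ (Fin (n * (n + 3)))) (TwistorSpace om),
      @IsTwistorManifold n M _ _ _ om cs := by
  obtain ⟨cs, h1, h2, h3⟩ := exists_submanifold_structure
    ((𝓡 (2 * n)).prod 𝓘(ℝ, ModelR n →L[ℝ] ModelR n)) (exists_twistor_slice om)
  exact ⟨cs, @IsTwistorManifold.mk n M _ _ _ om cs h1 h2 h3⟩

end TwistorCharts

end TwistorLibrary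

/-! ### The theorem. -/

theorem theorem5p3 {n : ℕ} {M : Type*} [TopologicalSpace M] [T2Space M]
    [SecondCountableTopology M] [ChartedSpace (EuclideanSpace ℝ (Fin (2 * n))) M]
    [IsManifold (𝓡 (2 * n)) ∞ M] (om : SymplecticForm n M) (nab : LinConnection n M)
    (hnab : IsSymplecticConnection om nab) (t : ℝ) (ht : 0 < t) :
    -- the set `𝒵⁰` is a submanifold of `End(TM)`
    (∃ cs : ChartedSpace (EuclideanSpace ℝ (Fin (n * (n + 3)))) (TwistorSpace om),
      @IsTwistorManifold n M _ _ _ om cs) ∧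
    -- for its submanifold structure:
    ∀ [ChartedSpace (EuclideanSpace ℝ (Fin (n * (n + 3)))) (TwistorSpace om)]
      [IsTwistorManifold om],
      -- there are a Levi-Civita connection and exactly one tensor `S` as specified
      (∃ con : TwistorConnection om, IsLeviCivita nab t con) ∧
      (∃! S : Π z : TwistorSpace om, TZ z →L[ℝ] TZ z →L[ℝ] TZ z, IsTensorS nab t S) ∧
      ∀ con : TwistorConnection om, IsLeviCivita nab t con →
        -- (i)
        (∀ S : Π z : TwistorSpace om, TZ z →L[ℝ] TZ z →L[ℝ] TZ z, IsTensorS nab t S →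
          (∀ (Y : Π z : TwistorSpace om, TZ z) (z : TwistorSpace om) (X : TZ z),
            MDifferentiableAt (𝓡 (n * (n + 3))) (𝓡 (n * (n + 3))).tangent (TZ.sec Y) z →
            con Y z X = twistorD nab Y z X
              - horLift nab z (twistorP nab z (Y z) (dProj z X))
              - (1 / 2 : ℝ) • vertCurvature nab z X (Y z) + S z X (Y z)) ∧
          (∀ (z : TwistorSpace om) (X Y A B : TZ z),
            IsHorizontal nab z X → IsHorizontal nab z Y → IsVertical z A → IsVertical z B →
            vertPart nab z (S z X A) = 0 ∧ vertPart nab z (S z A B) = 0 ∧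
            horPart nab z (S z X Y) = 0 ∧ horPart nab z (S z A B) = 0)) ∧
        -- (ii)
        (∀ x : M, IsTotallyGeodesicFibre con x) ∧
        -- (iii)
        (IsFlat nab → ∀ (Y : Π z : TwistorSpace om, TZ z) (z : TwistorSpace om) (X : TZ z),
          MDifferentiableAt (𝓡 (n * (n + 3))) (𝓡 (n * (n + 3))).tangent (TZ.sec Y) z →
          con (fun z' ↦ twistorJ nab z' (Y z')) z X = twistorJ nab z (con Y z X)) := by
  refine ⟨exists_isTwistorManifold om, ?_⟩
  intro cs hcs
  obtain ⟨S₀, hS₀, -⟩ := existsUnique_tensorS (om := om) hnab ht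
  refine ⟨⟨_, isLeviCivita_lcConnection hnab hS₀⟩, existsUnique_tensorS hnab ht, fun con hcon ↦
    ⟨fun S hS ↦ ⟨fun Y z X hY ↦ ?_, fun z X Y A B hX hY hA hB ↦ hS.vanishing hnab ht hX hY hA hB⟩,
      hcon.isTotallyGeodesicFibre hnab ht, fun hf Y z X hY ↦ hcon.apply_twistorJ hnab ht hf hY X⟩⟩
  rw [hcon.apply hnab ht hS hY, lcTensor]
  abel
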